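/- Setup. Let $K$ be the function field of a smooth projective geometrically connected curve over a finite field $\mathbb F_q$ of characteristic $p$, let $\infty$ be a closed point of degree $d_\infty$ with valuation $v_\infty$ and $|x|_\infty=q^{-d_\infty v_\infty(x)}$, let $A\subset K$ be the ring of functions regular outside $\infty$, $K_\infty$ the completion of $K$ at $\infty$, and $\mathbf C_\infty$ the completion of an algebraic closure of $K_\infty$. Fix a uniformizer $u$ of $K_\infty$; call $a\in K_\infty^*$ positive if $a=u^m\gamma$ with $m\in\mathbb Z$ and $\gamma$ a $1$-unit, and then put $\langle a\rangle=\gamma$. Let $S_\infty=\mathbf C_\infty^*\times\mathbb Z_p$, with $(x_1,y_1)+(x_2,y_2)=(x_1x_2,y_1+y_2)$. For a nonzero ideal $I\subset A$ and $s=(x,y)\in S_\infty$ put $I^s=x^{\deg I}\langle I\rangle^y$, where $\deg I=\dim_{\mathbb F_q}A/I$, $I\mapsto\langle I\rangle$ is the extension of $(a)\mapsto\langle a\rangle$ ($a$ positive) to a multiplicative map from the nonzero ideals to the $1$-units of $\mathbf C_\infty$ (it exists and is unique), and $w^y=\sum_{j\ge 0}\binom yj(w-1)^j$ for a $1$-unit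 $w$. For $x\in\mathbf C_\infty^*$ write $I^{-x}=I^{-(x,0)}=x^{-\deg I}$. A (one-dimensional) $K$-lattice is a pair $L=(\Lambda,\phi)$ of a nonzero finitely generated $A$-submodule $\Lambda\subset K$ and an $A$-linear map $\phi:K/A\to K/\Lambda$; it is invertible if $\phi$ is an isomorphism. $K$-lattices are isomorphic if they differ by scaling by an element of $K^*$. Call $(\Lambda,\phi)$, $(\Lambda',\phi')$ matched if $\phi$ and $\phi'$ agree modulo $\Lambda+\Lambda'$; two isomorphism classes are commensurable if they have matched representatives. Let $c(L)$ be the set of isomorphism classes commensurable with that of $L$. Let $\mathcal A$ be the set of continuous $\mathbf C_\infty$-valued functions $f(L',L'')$ of matched pairs of $K$-lattices that are invariant under simultaneous scaling and compactly supported modulo scaling (here $\Lambda$ varies discretely and $\mathrm{Hom}(K/A,K/\Lambda)$ has its profinite topology). It is an associative algebra for $(f_1*f_2)(L',L'')=\sum_{M}f_1(L',M)f_2(M,L'')$. Write $\sigma_s$ for the time evolution $(\sigma_sf)(L_1,L_2)=\frac{I^s}{J^s}f(L_1,L_2)$ ($s\in S_\infty$), where $I,J\subset A$ are nonzero ideals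 with $I\Lambda_1=J\Lambda_2$; this is an action of $S_\infty$ by algebra automorphisms of $\mathcal A$. Let $\mathcal V_L$ be the space of finitely supported functions $c(L)\to\mathbf C_\infty$ with the supremum norm, and $\pi_L$ the representation of $\mathcal A$ on $\mathcal V_L$ by bounded operators, $(\pi_L(f)\xi)(L')=\sum_{L''\in c(L)}f(L',L'')\xi(L'')$ (with matched representatives of the classes). Theorem. Let $L=(\Lambda,\phi)$ be an invertible $K$-lattice. (1) The map sending a nonzero ideal $J\subset A$ to the class of $J^{-1}L:=(J^{-1}\Lambda,\ \phi \bmod J^{-1}\Lambda)$ is a bijection from the set of nonzero ideals of $A$ onto $c(L)$. Let $\epsilon_J\in\mathcal V_L$ be the characteristic function of the class of $J^{-1}L$. (2) The operators $(U(s)\xi)(J^{-1}L)=J^s\,\xi(J^{-1}L)$, that is $U(s)\epsilon_J=J^s\epsilon_J$, define a homomorphism $U:S_\infty\to\mathrm{Aut}(\mathcal V_L)$ such that $s\mapsto U(s)\xi$ is pointwise continuous for every $\xi\in\mathcal V_L$, $U(s)$ is isometric for $|x|_\infty=1$, and $$\pi_L(\sigma_s(f))=U(s)\,\pi_L(f)\,U(s)^{-1}\qquad(s\in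 S_\infty,\ f\in\mathcal A).$$ In particular the exponential of the Hamiltonian of $(\mathcal A,\sigma,\pi_L)$, namely $U(s_0)$ with $s_0=(1,1)$, is $(U(s_0)\xi)(J^{-1}L)=\langle J\rangle\,\xi(J^{-1}L)$. (3) For $s=(x,y)\in S_\infty$ with $|x|_\infty>q$ the series $\sum_J J^{-s}$ over the nonzero ideals of $A$ converges, $U(s)^{-1}$ is bounded, and $Z(s):=\mathrm{Tr}(U(s)^{-1})$, the sum of the diagonal matrix elements in the basis $(\epsilon_J)$, converges to $\sum_JJ^{-s}$. In particular the partition function is the Goss zeta function of $A$: $$Z(x)=\sum_{0\ne I\subset A}I^{-x}=\sum_{0\neq I\subset A}x^{-\deg I}\qquad(|x|_\infty>q).$$ -/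

import Mathlib

open scoped nonZeroDivisors

noncomputable section

/-! ### Function fields of curves, places, and the field `C_∞` -/

/-- `K` is the function field of a smooth projective geometrically connected curve over the finite
field `Fq`: a finite extension of a rational function field `Fq(t)` in which `Fq` is
algebraically closed. -/
structure IsCurveFunctionField (Fq K : Type*) [Field Fq] [Field K] [Algebra Fq K] : Prop where
  exists_finite_over_rational : ∃ t : K, Transcendental Fq t ∧
    FiniteDimensional (IntermediateField.adjoin Fq {t}) K
  constants : ∀ x : K, IsAlgebraic Fq x → x ∈ (algebraMap Fq K).range

/-- A place of `K` (a closed point of the curve): a discrete valuation ring of `K`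
with finite residue field. -/
structure Place (K : Type*) [Field K] where
  ring : ValuationSubring K
  dvr : IsDiscreteValuationRing ring
  finite_residue : Finite (IsLocalRing.ResidueField ring)

namespace Place

variable {K : Type*} [Field K] (P : Place K)

instance : IsDiscreteValuationRing P.ring := P.dvr

instance : Finite (IsLocalRing.ResidueField P.ring) := P.finite_residue

/-- The cardinality of the residue field, `q ^ d` for a place of degree `d` over `Fq`. -/
def residueCard : ℕ := Nat.card (IsLocalRing.ResidueField P.ring)

theorem one_lt_residueCard : (1 : NNReal) < (P.residueCard : NNReal) := by
  have h : 1 < P.residueCard := Finite.one_lt_card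
  exact_mod_cast h

/-- The normalized absolute value `|x| = (q ^ d) ^ (- v x)`, with `v` the valuation of the place
and `d` its degree. -/
def abv : AbsoluteValue K ℝ :=
  (IsDiscreteValuationRing.maximalIdeal P.ring).adicAbv P.one_lt_residueCard

theorem abv_nonarchimedean : IsNonarchimedean P.abv :=
  (IsDiscreteValuationRing.maximalIdeal P.ring).isNonarchimedean_adicAbv P.one_lt_residueCard

/-- The completion `K_∞` of `K` at the place. -/
abbrev KInfty := P.abv.Completion

/-- The embedding of `K` into its completion. -/
def toKInfty : K →+* P.KInfty :=
  (UniformSpace.Completion.coeRingHom (α := WithAbs P.abv)).comp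
    (WithAbs.equiv P.abv).symm.toRingHom

theorem norm_toKInfty (x : K) : ‖P.toKInfty x‖ = P.abv x :=
  UniformSpace.Completion.norm_coe (E := WithAbs P.abv) _

instance : IsUltrametricDist (WithAbs P.abv) :=
  IsUltrametricDist.isUltrametricDist_of_forall_norm_add_le_max_norm
    fun _ _ => P.abv_nonarchimedean _ _

instance : IsUltrametricDist P.KInfty := IsUltrametricDist.of_normedAlgebra (WithAbs P.abv)

instance : NontriviallyNormedField P.KInfty where
  non_trivial := by
    obtain ⟨x, hx⟩ := IsDiscreteValuationRing.exists_irreducible P.ring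
    have h1 : P.abv (x : K) < 1 :=
      ((IsDiscreteValuationRing.maximalIdeal P.ring).adicAbv_coe_lt_one_iff
        P.one_lt_residueCard x).2 ((IsLocalRing.mem_maximalIdeal x).2 hx.not_isUnit)
    have h0 : (x : K) ≠ 0 := by
      simpa using hx.ne_zero
    refine ⟨P.toKInfty (x : K)⁻¹, ?_⟩
    rw [norm_toKInfty, map_inv₀]
    exact (one_lt_inv₀ (P.abv.pos h0)).2 h1

instance : NormedField (AlgebraicClosure P.KInfty) :=
  spectralNorm.normedField P.KInfty (AlgebraicClosure P.KInfty)

/-- The field `C_∞`: the completion of an algebraic closure of `K_∞` for the unique extension of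
the absolute value. -/
def CInfty := UniformSpace.Completion (AlgebraicClosure P.KInfty)

instance : NormedField P.CInfty :=
  inferInstanceAs (NormedField (UniformSpace.Completion (AlgebraicClosure P.KInfty)))

/-- The embedding of `K_∞` into `C_∞`. -/
def toCInfty : P.KInfty →+* P.CInfty :=
  (UniformSpace.Completion.coeRingHom (α := AlgebraicClosure P.KInfty)).comp
    (algebraMap P.KInfty (AlgebraicClosure P.KInfty))

/-- A uniformizer of `K_∞`. -/
def IsUniformizer (u : P.KInfty) : Prop := ‖u‖ = (P.residueCard : ℝ)⁻¹

end Place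

/-- The ring `A` of functions regular outside the place `P = ∞`. -/
def regularRing (Fq : Type*) {K : Type*} [Field Fq] [Finite Fq] [Field K] [Algebra Fq K]
    (P : Place K) : Subalgebra Fq K where
  carrier := {x | ∀ V : Place K, V.ring ≠ P.ring → x ∈ V.ring}
  mul_mem' hx hy V hV := mul_mem (hx V hV) (hy V hV)
  add_mem' hx hy V hV := add_mem (hx V hV) (hy V hV)
  algebraMap_mem' c V _ := by
    rcases V.ring.mem_or_inv_mem (algebraMap Fq K c) with h | h
    · exact h
    · rcases eq_or_ne c 0 with rfl | hc
      · simp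
      · have hn := orderOf_pos (Units.mk0 c hc)
        have h1 : c ^ orderOf (Units.mk0 c hc) = 1 := by
          have h := congrArg Units.val (pow_orderOf_eq_one (Units.mk0 c hc))
          rwa [Units.val_pow_eq_pow_val, Units.val_mk0, Units.val_one] at h
        have h2 : c = c⁻¹ ^ (orderOf (Units.mk0 c hc) - 1) := by
          have h3 := pow_succ' c (orderOf (Units.mk0 c hc) - 1)
          rw [Nat.sub_add_cancel hn, h1] at h3
          rw [inv_pow]
          exact (eq_inv_of_mul_eq_one_left h3.symm)
        rw [h2, map_pow, map_inv₀]
        exact pow_mem h _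

/-! ### Exponentiation of ideals -/

section Exponentiation

variable (Fq : Type*) {K : Type*} [Field Fq] [Finite Fq] [Field K] [Algebra Fq K]
  (P : Place K) (p : ℕ) [Fact p.Prime] (u : P.KInfty)

/-- `χ` is a homomorphism from nonzero ideals of `A` to the `1`-units of `C_∞` that extends
`(a) ↦ ⟨a⟩` from the principal ideals with a positive generator. For the sign function attached to
the uniformizer `u`, an element `a` is positive with `⟨a⟩ = γ` exactly when `a = u ^ m * γ` for
some integer `m` and some `1`-unit `γ` of `K_∞`. -/
def IsOneUnitExtension (χ : (Ideal (regularRing Fq P))⁰ →* P.CInfty) : Prop :=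
  (∀ I, ‖χ I - 1‖ < 1) ∧
  ∀ (I : (Ideal (regularRing Fq P))⁰) (a : regularRing Fq P) (m : ℤ) (γ : P.KInfty),
    (I : Ideal (regularRing Fq P)) = Ideal.span {a} → ‖γ - 1‖ < 1 →
    P.toKInfty (a : K) = u ^ m * γ → χ I = P.toCInfty γ

/-- `I ↦ ⟨I⟩`: the unique homomorphism as in `IsOneUnitExtension`. -/
def oneUnitPart : (Ideal (regularRing Fq P))⁰ →* P.CInfty :=
  Classical.epsilon (IsOneUnitExtension Fq P u)

/-- The degree of an ideal: the dimension over `Fq` of the quotient ring. -/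
def idealDeg (I : (Ideal (regularRing Fq P))⁰) : ℕ :=
  Module.finrank Fq (regularRing Fq P ⧸ (I : Ideal (regularRing Fq P)))

/-- The power `w ^ y = ∑ j, binom(y, j) (w - 1) ^ j` of a `1`-unit by a `p`-adic integer; the
binomial coefficients are reduced modulo `p`. -/
def oneUnitPow {C : Type*} [NormedField C] (w : C) (y : ℤ_[p]) : C :=
  ∑' j : ℕ, ((PadicInt.toZMod (Ring.choose y j)).val : C) * (w - 1) ^ j

/-- The group `S_∞ = C_∞^* × ℤ_p`, written multiplicatively. -/
abbrev SInfty := P.CInftyˣ × Multiplicative ℤ_[p]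

/-- The exponentiation `I ^ s = x ^ deg I * ⟨I⟩ ^ y` for `s = (x, y)`. -/
def idealExp (s : SInfty P p) (I : (Ideal (regularRing Fq P))⁰) : P.CInfty :=
  (s.1 : P.CInfty) ^ idealDeg Fq P I * oneUnitPow p (oneUnitPart Fq P u I) s.2.toAdd

/-- The point `s_0 = (1, 1)` of `S_∞` (the unit of `C_∞^*`, the element `1` of `ℤ_p`). -/
def sZero : SInfty P p := (1, Multiplicative.ofAdd 1)

end Exponentiation

/-! ### One-dimensional `K`-rational lattices -/

/-- A `1`-dimensional `K`-rational lattice: a rank one lattice `Λ ⊆ K` with a homomorphism of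
`A`-modules `φ : K / A → K / Λ`. -/
structure KLattice (A K : Type*) [CommRing A] [Field K] [Algebra A K] where
  Λ : Submodule A K
  fg : Λ.FG
  ne_bot : Λ ≠ ⊥
  φ : (K ⧸ (1 : Submodule A K)) →ₗ[A] (K ⧸ Λ)

namespace KLattice

variable {A K : Type*} [CommRing A] [Field K] [Algebra A K]

/-- `(Λ, φ)` is invertible if `φ` is an isomorphism. -/
def IsInvertible (L : KLattice A K) : Prop := Function.Bijective L.φ

/-- `L.Rel x y` says that `φ` maps the class of `x` modulo `A` to the class of `y` modulo `Λ`. -/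
def Rel (L : KLattice A K) (x y : K) : Prop :=
  L.φ (Submodule.Quotient.mk x) = Submodule.Quotient.mk y

/-- `L' = γ L`, that is `Λ' = γ Λ` and `φ' = γ ∘ φ`. -/
def IsScaling (γ : Kˣ) (L L' : KLattice A K) : Prop :=
  (∀ z : K, z ∈ L.Λ ↔ (γ : K) * z ∈ L'.Λ) ∧ ∀ x y : K, L.Rel x y ↔ L'.Rel x (γ * y)

/-- Isomorphism of `K`-rational lattices. -/
instance isoSetoid : Setoid (KLattice A K) where
  r L L' := ∃ γ : Kˣ, IsScaling γ L L'
  iseqv :=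
    { refl := fun L => ⟨1, by simp [IsScaling]⟩
      symm := by
        rintro L L' ⟨γ, h1, h2⟩
        refine ⟨γ⁻¹, fun z => ?_, fun x y => ?_⟩
        · rw [h1]; simp
        · rw [h2]; simp
      trans := by
        rintro L L' L'' ⟨γ, h1, h2⟩ ⟨δ, h3, h4⟩
        refine ⟨δ * γ, fun z => ?_, fun x y => ?_⟩
        · rw [h1, h3, Units.val_mul, mul_assoc]
        · rw [h2, h4, Units.val_mul, mul_assoc] }

/-- `φ` and `φ'` agree modulo `Λ + Λ'`. -/
def Matched (L L' : KLattice A K) : Prop :=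
  ∀ x y y' : K, L.Rel x y → L'.Rel x y' → y - y' ∈ L.Λ ⊔ L'.Λ

/-- `L' = J⁻¹ L`, that is `J Λ' = Λ` and `φ'` is the composite of `φ` with `K / Λ → K / Λ'`. -/
def IsIdealTranslate (J : Ideal A) (L L' : KLattice A K) : Prop :=
  J • L'.Λ = L.Λ ∧ ∀ x y : K, L.Rel x y → L'.Rel x y

/-- The topology on lattices: `Λ` varies discretely, and `φ` in the topology of pointwise
convergence of maps to the discrete module `K / Λ` (the profinite topology of
`Hom(K / A, K / Λ)`). The set attached to `(L, x)` is the coset `φ(x)`, which for `x = 0`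
is `Λ`. -/
instance : TopologicalSpace (KLattice A K) :=
  TopologicalSpace.induced (fun (L : KLattice A K) (x : K) => {y : K | L.Rel x y})
    (@Pi.topologicalSpace K (fun _ => Set K) fun _ => ⊥)

end KLattice

/-- The set of isomorphism classes of `1`-dimensional `K`-rational lattices. -/
abbrev LatticeClass (A K : Type*) [CommRing A] [Field K] [Algebra A K] :=
  Quotient (KLattice.isoSetoid (A := A) (K := K))

section Algebra

variable {A K : Type*} [CommRing A] [Field K] [Algebra A K]

/-- Commensurability of isomorphism classes: after scaling by an element of `K^*`, the two
homomorphisms agree modulo the sum of the two lattices. -/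
def Commensurable1 (c c' : LatticeClass A K) : Prop :=
  ∃ L L' : KLattice A K, (⟦L⟧ : LatticeClass A K) = c ∧ (⟦L'⟧ : LatticeClass A K) = c' ∧
    L.Matched L'

/-- The commensurability class `c(L)`. -/
def commClass (L : KLattice A K) : Set (LatticeClass A K) := {c | Commensurable1 ⟦L⟧ c}

/-- The convolution algebra of the commensurability relation with coefficients in `C`. A function
on the groupoid of commensurable pairs is given as a function of pairs `L₁`, `L₂` of matched
lattices, invariant under simultaneous scaling (for `φ ≠ 0` a commensurable pair of classes has
exactly one pair of matched representatives up to such scaling), which is continuous and vanishes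
off the scalings of a compact set of pairs. -/
def convAlgebra (A K C : Type*) [CommRing A] [Field K] [Algebra A K] [NormedField C] :
    Submodule C (KLattice A K → KLattice A K → C) where
  carrier := {f |
    (∀ L₁ L₂, ¬ L₁.Matched L₂ → f L₁ L₂ = 0) ∧
    (∀ (γ : Kˣ) (L₁ L₂ L₁' L₂' : KLattice A K), KLattice.IsScaling γ L₁ L₁' →
      KLattice.IsScaling γ L₂ L₂' → f L₁ L₂ = f L₁' L₂') ∧
    ContinuousOn (fun z : KLattice A K × KLattice A K => f z.1 z.2) {z | z.1.Matched z.2} ∧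
    ∃ Z : Set (KLattice A K × KLattice A K), IsCompact Z ∧ Z ⊆ {z | z.1.Matched z.2} ∧
      ∀ L₁ L₂, f L₁ L₂ ≠ 0 → ∃ z ∈ Z, ∃ γ : Kˣ,
        KLattice.IsScaling γ z.1 L₁ ∧ KLattice.IsScaling γ z.2 L₂}
  zero_mem' := ⟨fun _ _ _ => rfl, fun _ _ _ _ _ _ _ => rfl, continuousOn_const,
    ∅, isCompact_empty, Set.empty_subset _, fun _ _ h => absurd rfl h⟩
  add_mem' := by
    rintro f g ⟨f1, f2, f3, Z, f4, f5, f6⟩ ⟨g1, g2, g3, W, g4, g5, g6⟩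
    refine ⟨fun L₁ L₂ h => ?_, fun γ L₁ L₂ L₁' L₂' h h' => ?_, f3.add g3, Z ∪ W, f4.union g4,
      Set.union_subset f5 g5, fun L₁ L₂ h => ?_⟩
    · simp [f1 _ _ h, g1 _ _ h]
    · simp [f2 _ _ _ _ _ h h', g2 _ _ _ _ _ h h']
    · by_cases hf : f L₁ L₂ = 0
      · have hg : g L₁ L₂ ≠ 0 := fun hg => h (by simp [hf, hg])
        obtain ⟨z, hz, r⟩ := g6 _ _ hg
        exact ⟨z, Or.inr hz, r⟩
      · obtain ⟨z, hz, r⟩ := f6 _ _ hf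
        exact ⟨z, Or.inl hz, r⟩
  smul_mem' := by
    rintro a f ⟨f1, f2, f3, Z, f4, f5, f6⟩
    refine ⟨fun L₁ L₂ h => ?_, fun γ L₁ L₂ L₁' L₂' h h' => ?_, f3.const_smul a, Z, f4, f5,
      fun L₁ L₂ h => f6 _ _ fun hf => h (by simp [hf])⟩
    · simp [f1 _ _ h]
    · simp [f2 _ _ _ _ _ h h']

variable {C : Type*} [NormedField C]

/-- The convolution product, a finite sum for `f` and `g` in the algebra. -/
def convMul (f g : KLattice A K → KLattice A K → C) (L₁ L₂ : KLattice A K) : C :=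
  ∑ᶠ M : KLattice A K, f L₁ M * g M L₂

variable (C) in
/-- The space `V_L` of finitely supported functions on `c(L)`, as functions of the isomorphism
class which vanish outside `c(L)`. -/
abbrev VSpace (L : KLattice A K) : Submodule C (LatticeClass A K →₀ C) :=
  Finsupp.supported C C (commClass L)

namespace VSpace

variable {L : KLattice A K}

variable (C) in
/-- The characteristic function of a point of `c(L)`. -/
def basisVec (c : commClass L) : VSpace C L :=
  ⟨Finsupp.single (c : LatticeClass A K) 1, Finsupp.single_mem_supported C 1 c.2⟩

/-- The supremum norm. -/
def supNorm (ξ : VSpace C L) : ℝ := ⨆ c : LatticeClass A K, ‖(ξ : LatticeClass A K →₀ C) c‖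

/-- The operator `T` is bounded for the supremum norm. -/
def IsBounded (T : Module.End C (VSpace C L)) : Prop :=
  ∃ M : ℝ, ∀ ξ, supNorm (T ξ) ≤ M * supNorm ξ

/-- The operator `T` is bounded, and the sum of its diagonal matrix elements converges to `z`. -/
def HasTrace (T : Module.End C (VSpace C L)) (z : C) : Prop :=
  IsBounded T ∧
  HasSum (fun c : commClass L => (T (basisVec C c) : LatticeClass A K →₀ C) c) z

/-- The formula `(π f ξ)(L') = ∑ f(L', L'') ξ(L'')` for the representation of the convolution
algebra on `V_L`; the sum is over `L''` matched with the chosen representative `L'`, that is over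
the class `c(L)`. -/
def IsPiL (π : convAlgebra A K C →ₗ[C] Module.End C (VSpace C L)) : Prop :=
  ∀ f ξ (L' : KLattice A K), (⟦L'⟧ : LatticeClass A K) ∈ commClass L →
    (π f ξ : LatticeClass A K →₀ C) ⟦L'⟧ =
      ∑ᶠ L'' : KLattice A K, f.1 L' L'' * (ξ : LatticeClass A K →₀ C) ⟦L''⟧

end VSpace

end Algebra

/-- The algebra of observables: the convolution algebra of commensurable lattices with
coefficients in `C_∞`. -/
abbrev Observables (Fq : Type*) {K : Type*} [Field Fq] [Finite Fq] [Field K] [Algebra Fq K]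
    (P : Place K) : Submodule P.CInfty
      (KLattice (regularRing Fq P) K → KLattice (regularRing Fq P) K → P.CInfty) :=
  convAlgebra (regularRing Fq P) K P.CInfty

/-- The formula `(σ_s f)(L₁, L₂) = (I ^ s / J ^ s) f(L₁, L₂)`, where `I` and `J` are the ideals
corresponding to `L₁` and `L₂`: matched lattices can be written `Λ₁ = I⁻¹ M` and `Λ₂ = J⁻¹ M`
for a lattice `M`, with nonzero ideals `I`, `J` whose quotient depends only on `Λ₁`, `Λ₂`. -/
def IsTimeEvolution {Fq K : Type*} [Field Fq] [Finite Fq] [Field K] [Algebra Fq K]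
    (P : Place K) (p : ℕ) [Fact p.Prime] (u : P.KInfty)
    (σ : SInfty P p →* (Observables Fq P ≃ₗ[P.CInfty] Observables Fq P)) : Prop :=
  ∀ s f (L₁ L₂ : KLattice (regularRing Fq P) K) (I J : (Ideal (regularRing Fq P))⁰),
    (I : Ideal (regularRing Fq P)) • L₁.Λ = (J : Ideal (regularRing Fq P)) • L₂.Λ →
    (σ s f).1 L₁ L₂ = idealExp Fq P p u s I / idealExp Fq P p u s J * f.1 L₁ L₂

end

/-! On the class of an invertible lattice everything becomes diagonal. If `L'` is matched with `L`,
then `Λ ⊆ Λ'` (`KLattice.IsInvertible.le_of_matched`), so `Λ' = J⁻¹Λ` for a unique ideal `J`, and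
`φ'` is forced to be `φ` reduced modulo `Λ'`. A class contains only one lattice matched with `L`: if
`L'` and `γL'` with `γ ≠ 1` both were, surjectivity of `φ` would make `γΛ'` all of `K`, which is not
finitely generated (`eq_one_of_matched_smul`). Hence `c(L)` is the set of nonzero ideals.

The time evolution multiplies `f` by the cocycle `(L₁, L₂) ↦ I^s / J^s` with `IΛ₁ = JΛ₂`. On
lattices `J₁⁻¹L` and `J₂⁻¹L` this is the coboundary `J₁^s / J₂^s`, so conjugation by the diagonal
operator `U(s)` implements it (`latticeRep_twistHom`), and the diagonal of `U(s)⁻¹` consists of the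
`J^(-s)`. In a complete nonarchimedean field a series converges once its terms tend to zero;
`|J^(-s)| = |x|^(-deg J)`, and only finitely many ideals have bounded degree, so `|x| > 1` already
suffices.

Three supports carry this. Arithmetic: `A` is the integral closure of `Fq[t]` for a nonconstant `t ∈
A` (`exists_regularRing_eq`), hence Dedekind with finite quotients and finite class group; its units
are constants. Such a `t` is found by a pigeonhole count, and possible inseparability of `K / Fq(t)`
is absorbed by a power of Frobenius.

One-units: some fixed power `I^n` of every ideal has a positive generator, and the `1`-units of
`C_∞` form a uniquely divisible group, so `⟨I⟩` must be the `n`-th root of the `1`-unit part of that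
generator.

Convolution: a lattice matched with `L` is determined by its module `Λ'` (`KLattice.Matched.eq`).
Compact support modulo scaling, with `Aˣ` finite, leaves finitely many modules, so all sums are
finite; and the matched lattice with given module varies continuously
(`KLattice.eventually_matched`), so products stay continuous. -/

open scoped nonZeroDivisors

noncomputable section

open scoped Polynomial

/-! ### Integral closures of polynomial rings in finite extensions -/

section IntegralClosure

open Polynomial

/-- An iterate of Frobenius is a finite endomorphism of a polynomial ring over a finite field. -/
theorem Polynomial.iterateFrobenius_finite (k : Type*) [Field k] [Finite k] (p n : ℕ)
    [ExpChar k p] : (iterateFrobenius k[X] p n).Finite := by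
  refine RingHom.IsIntegral.to_finite (fun f => ?_) ?_
  -- The coefficient `f` acts through Frobenius as `f ^ p ^ n`, so `f` itself is a root of this
  -- polynomial.
  · refine ⟨X ^ p ^ n - C f, monic_X_pow_sub_C f (pow_ne_zero n (expChar_pos k p).ne'), ?_⟩
    simp [iterateFrobenius_def]
  · let := (iterateFrobenius k[X] p n).toAlgebra
    refine ⟨⟨{X}, ?_⟩⟩
    rw [eq_top_iff]
    rintro f -
    induction f using Polynomial.induction_on' with
    | add f g hf hg => exact add_mem hf hg
    | monomial m a =>
      rw [← C_mul_X_pow_eq_monomial]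
      refine mul_mem ?_ (pow_mem (Algebra.subset_adjoin (by simp)) m)
      obtain ⟨b, rfl⟩ := (bijective_iterateFrobenius (R := k) (p := p) (n := n)).2 a
      have : C (iterateFrobenius k p n b) = algebraMap k[X] k[X] (C b) := by
        change _ = iterateFrobenius k[X] p n (C b)
        simp [iterateFrobenius_def]
      rw [this]
      exact Subalgebra.algebraMap_mem _ _

instance Polynomial.hasFiniteQuotients (k : Type*) [Field k] [Finite k] :
    Ring.HasFiniteQuotients k[X] where
  finiteQuotient {I} hI := by
    obtain ⟨f, rfl⟩ := Submodule.IsPrincipal.principal I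
    have hf : f ≠ 0 := by rintro rfl; simp at hI
    have : Module.Finite k (AdjoinRoot f) := (AdjoinRoot.powerBasis hf).finite
    exact Module.finite_of_finite k (M := AdjoinRoot f)

/-- Finiteness of a module descends along an injective map that is semilinear over a finite
ring homomorphism. -/
theorem Module.Finite.of_injective_semilinear {R S M N : Type*} [CommRing R] [CommRing S]
    [IsNoetherianRing R] [AddCommGroup M] [AddCommGroup N] [Module R M] [Module S N]
    [Module.Finite S N] (φ : R →+* S) (hφ : φ.Finite) (g : M →ₛₗ[φ] N)
    (hg : Function.Injective g) : Module.Finite R M := by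
  let := φ.toAlgebra
  let := Module.compHom N φ
  have : Module.Finite R S := hφ
  have : IsScalarTower R S N := ⟨fun a b c => by
    rw [Algebra.smul_def, mul_smul]; rfl⟩
  have : Module.Finite R N := Module.Finite.trans S N
  have : IsNoetherian R N := inferInstance
  exact Module.Finite.of_injective (⟨⟨g, g.map_add⟩, g.map_smulₛₗ⟩ : M →ₗ[R] N) hg

variable {k K : Type*} [Field k] [Finite k] [Field K] [Algebra k[X] K]
  (B : Type*) [CommRing B] [Algebra k[X] B] [Algebra B K] [IsScalarTower k[X] B K]

/-- The integral closure of `k[X]` in a finite extension of `k(X)`, for `k` a finite field, is a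
finite `k[X]`-module, also if the extension is inseparable. -/
theorem Polynomial.finite_isIntegralClosure
    (F : Type*) [Field F] [Algebra k[X] F] [IsFractionRing k[X] F] [Algebra F K]
    [IsScalarTower k[X] F K] [FiniteDimensional F K]
    [IsIntegralClosure B k[X] K] :
    Module.Finite k[X] B := by
  obtain ⟨p, hp⟩ := ExpChar.exists k
  have : ExpChar k[X] p := expChar_of_injective_ringHom (C_injective (R := k)) p
  have : ExpChar F p := expChar_of_injective_ringHom (IsFractionRing.injective k[X] F) p
  have : ExpChar K p := expChar_of_injective_ringHom (algebraMap F K).injective p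
  -- `K / E` is purely inseparable of finite exponent `n`, so the `p ^ n`-th power maps `B`
  -- injectively and semilinearly into the integral closure in the separable extension `E / F`,
  -- where finiteness is classical.
  let E := separableClosure F K
  have : ExpChar E p := expChar_of_injective_ringHom (algebraMap F E).injective p
  have : IsScalarTower k[X] E K := ⟨fun a b c => by
    rw [← algebraMap_smul F a b, ← algebraMap_smul F a (b • c), smul_assoc]⟩
  have hfin : Module.Finite k[X] (integralClosure k[X] E) :=
    IsIntegralClosure.finite k[X] F E (integralClosure k[X] E)
  set n := IsPurelyInseparable.exponent E K
  have hpow : ∀ b : B, ∃ e : integralClosure k[X] E,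
      ((e : E) : K) = algebraMap B K b ^ p ^ n := by
    intro b
    obtain ⟨e, he⟩ := (IsPurelyInseparable.exponent_def' E p (algebraMap B K b))
    refine ⟨⟨e, ?_⟩, he⟩
    have h1 : IsIntegral k[X] (algebraMap B K b) :=
      (IsIntegralClosure.isIntegral k[X] K b).map (IsScalarTower.toAlgHom k[X] B K)
    have h2 : IsIntegral k[X] (algebraMap E K e) := by rw [he]; exact h1.pow _
    exact (isIntegral_algHom_iff (IsScalarTower.toAlgHom k[X] E K) (algebraMap E K).injective).1 h2
  choose f hf using hpow
  let g : B →ₛₗ[iterateFrobenius k[X] p n] (integralClosure k[X] E) :=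
    ⟨⟨f, fun a b => by
        apply Subtype.ext; apply Subtype.ext
        have := hf (a + b)
        rw [map_add, add_pow_expChar_pow, ← hf, ← hf] at this
        simpa using this⟩, fun c b => by
        apply Subtype.ext; apply Subtype.ext
        refine (hf (c • b)).trans ?_
        rw [Algebra.smul_def, map_mul, mul_pow, ← hf b, ← IsScalarTower.algebraMap_apply, ← map_pow,
          ← iterateFrobenius_def]
        change _ = algebraMap E K (iterateFrobenius k[X] p n c • (f b : E))
        rw [Algebra.smul_def, map_mul, ← IsScalarTower.algebraMap_apply]
        rfl⟩
  refine Module.Finite.of_injective_semilinear _ (iterateFrobenius_finite k p n) g fun a b hab => ?_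
  have h1 : algebraMap B K a ^ p ^ n = algebraMap B K b ^ p ^ n := by
    rw [← hf, ← hf]
    exact congrArg (fun e : integralClosure k[X] E => ((e : E) : K)) hab
  exact IsIntegralClosure.algebraMap_injective B k[X] K (iterateFrobenius_inj K p n h1)

/-- Everything rests on `B` being finite over `k[X]`. Finiteness of the class group comes from
approximate division with respect to `f ↦ q ^ deg f`, which needs a basis of `B` but no
separability. -/
theorem Polynomial.isDedekindDomain_isIntegralClosure [IsDomain B]
    (F : Type*) [Field F] [Algebra k[X] F] [IsFractionRing k[X] F] [Algebra F K]
    [IsScalarTower k[X] F K] [FiniteDimensional F K]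
    [IsIntegralClosure B k[X] K] :
    IsDedekindDomain B ∧ Ring.HasFiniteQuotients B ∧ Finite (ClassGroup B) ∧
      IsFractionRing B K := by
  have hinj := IsIntegralClosure.algebraMap_injective B k[X] K
  have hfin : Module.Finite k[X] B := finite_isIntegralClosure (K := K) B F
  have hq : Ring.HasFiniteQuotients B := Ring.HasFiniteQuotients.of_module_finite k[X] B
  have hfr : IsFractionRing B K := IsIntegralClosure.isFractionRing_of_finite_extension k[X] F K B
  have hD : IsDedekindDomain B :=
    { (inferInstance : IsNoetherianRing B), (inferInstance : Ring.DimensionLEOne B),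
      (isIntegrallyClosed_iff K).mpr fun {x} hx =>
        have := IsIntegralClosure.isIntegral_algebra (A := B) k[X] K
        ⟨IsIntegralClosure.mk' B x (isIntegral_trans (R := k[X]) _ hx),
          IsIntegralClosure.algebraMap_mk' _ _ _⟩ with }
  have htf : Module.IsTorsionFree k[X] B := by
    have : Module.IsTorsionFree k[X] K := .trans_faithfulSMul k[X] F K
    exact IsIntegralClosure.isTorsionFree k[X] K
  have hint : Algebra.IsIntegral k[X] B := IsIntegralClosure.isIntegral_algebra k[X] K
  have := Fintype.ofFinite k
  classical
  have hC := ClassGroup.fintypeOfAdmissibleOfAlgebraic (Module.Free.chooseBasis k[X] B)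
    (Polynomial.cardPowDegreeIsAdmissible (Fq := k))
  exact ⟨hD, hq, inferInstance, hfr⟩

end IntegralClosure

/-! ### Function fields as finite extensions of rational function fields -/

section FunctionField

open Polynomial
open scoped IntermediateField.algebraAdjoinAdjoin

variable {Fq K : Type*} [Field Fq] [Field K] [Algebra Fq K]

namespace IsCurveFunctionField

/-- `K` has transcendence degree at most one over `Fq`, so `x` is a transcendence basis; an
algebraic and finitely generated field extension is finite. -/
theorem finiteDimensional_adjoin (hK : IsCurveFunctionField Fq K) {x : K}
    (hx : Transcendental Fq x) : FiniteDimensional (IntermediateField.adjoin Fq {x}) K := by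
  have ⟨t, _, hfin⟩ := hK.exists_finite_over_rational
  have hess : Algebra.EssFiniteType Fq K := by
    have h1 : Algebra.EssFiniteType Fq (IntermediateField.adjoin Fq {t}) :=
      IntermediateField.essFiniteType_iff.2 ⟨{t}, by simp⟩
    exact Algebra.EssFiniteType.comp Fq (IntermediateField.adjoin Fq {t}) K
  have hta : Algebra.IsAlgebraic (Algebra.adjoin Fq {t}) K := by
    have := Algebra.IsAlgebraic.of_finite (IntermediateField.adjoin Fq {t}) K
    exact (IsFractionRing.comap_isAlgebraic_iff (A := Algebra.adjoin Fq {t})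
      (K := IntermediateField.adjoin Fq {t}) (C := K)).2 this
  have htr : Algebra.trdeg Fq K ≤ 1 := by
    simpa using Algebra.IsAlgebraic.trdeg_le_cardinalMk Fq (A := K) (s := {t})
  have hb : IsTranscendenceBasis Fq (fun _ : Unit => x) := by
    refine AlgebraicIndependent.isTranscendenceBasis_of_lift_trdeg_le_of_finite ?_ (by simpa using htr)
    exact algebraicIndependent_unique_type_iff.2 hx
  have halg : Algebra.IsAlgebraic (IntermediateField.adjoin Fq {x}) K := by
    have := hb.isAlgebraic_field
    rwa [Set.range_const] at this
  have : Algebra.EssFiniteType (IntermediateField.adjoin Fq {x}) K :=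
    Algebra.EssFiniteType.of_comp Fq _ K
  obtain ⟨s, hs⟩ := IntermediateField.fg_top (IntermediateField.adjoin Fq {x}) K
  have := IntermediateField.finiteDimensional_adjoin (K := IntermediateField.adjoin Fq {x})
    (L := K) (S := s) fun z _ => (halg.isAlgebraic z).isIntegral
  rw [hs] at this
  exact IntermediateField.topEquiv.toLinearEquiv.finiteDimensional

end IsCurveFunctionField

variable (Fq) in
/-- The integral closure of `Fq[x]` in `K`. -/
def integralOver (x : K) : Subalgebra Fq K where
  carrier := {z | (aeval (R := Fq) x).toRingHom.IsIntegralElem z}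
  mul_mem' := RingHom.IsIntegralElem.mul _
  add_mem' := RingHom.IsIntegralElem.add _
  algebraMap_mem' c := by
    have := RingHom.isIntegralElem_map (aeval (R := Fq) x).toRingHom (x := C c)
    simpa using this

theorem mem_integralOver_self (x : K) : x ∈ integralOver Fq x := by
  have := RingHom.isIntegralElem_map (aeval (R := Fq) x).toRingHom (x := X)
  rwa [AlgHom.toRingHom_eq_coe, RingHom.coe_coe, aeval_X] at this

theorem aeval_mem_integralOver (x : K) (f : Fq[X]) : aeval x f ∈ integralOver Fq x :=
  RingHom.isIntegralElem_map (aeval (R := Fq) x).toRingHom (x := f)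

theorem integralOver_le_of_mem {x : K} (V : Subalgebra Fq K) [IsIntegrallyClosed V]
    [IsFractionRing V K] (hx : x ∈ V) :
    integralOver Fq x ≤ V := by
  rintro z ⟨f, hf, hz⟩
  have : IsIntegral V z := by
    refine ⟨f.map (aeval (⟨x, hx⟩ : V)).toRingHom, hf.map _, ?_⟩
    rw [eval₂_map]
    have h : (algebraMap V K).comp (aeval (⟨x, hx⟩ : V)).toRingHom =
        (aeval (R := Fq) x).toRingHom := by
      refine Polynomial.ringHom_ext (fun c => ?_) ?_
      · simp
      · simp
    rwa [h]
  obtain ⟨y, rfl⟩ := IsIntegrallyClosed.isIntegral_iff.1 this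
  exact y.2

/-- The integral closure of a polynomial ring in a function field is a Dedekind domain with finite
quotients and finite class group, and it is a free module of finite rank. -/
theorem IsCurveFunctionField.integralOver_spec [Finite Fq] (hK : IsCurveFunctionField Fq K) {x : K}
    (hx : Transcendental Fq x) : IsDedekindDomain (integralOver Fq x) ∧
      Ring.HasFiniteQuotients (integralOver Fq x) ∧ Finite (ClassGroup (integralOver Fq x)) ∧
      IsFractionRing (integralOver Fq x) K ∧
      (∀ z : K, ∃ f : Fq[X], f ≠ 0 ∧ aeval x f * z ∈ integralOver Fq x) ∧
      ∃ (n : ℕ) (β : Fin n → integralOver Fq x),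
        (∀ g : Fin n → Fq[X], ∑ i, aeval x (g i) * (β i : K) = 0 → g = 0) ∧
        ∀ b : integralOver Fq x, ∃ g : Fin n → Fq[X], (b : K) = ∑ i, aeval x (g i) * (β i : K) := by
  let F := IntermediateField.adjoin Fq {x}
  -- The `Fq[X]`-algebra structures depend on `x` and exist only inside this proof; the conclusion
  -- is phrased with `aeval x` for that reason.
  let : Algebra Fq[X] K := (aeval x).toAlgebra
  let : Algebra Fq[X] F := (aeval (IntermediateField.AdjoinSimple.gen Fq x)).toAlgebra
  let : Algebra Fq[X] (integralOver Fq x) :=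
    (aeval (⟨x, mem_integralOver_self x⟩ : integralOver Fq x)).toAlgebra
  have : IsScalarTower Fq[X] (integralOver Fq x) K := .of_algebraMap_eq fun f => by
    change aeval x f = (integralOver Fq x).val (aeval _ f)
    rw [← aeval_algHom_apply]; rfl
  have : IsScalarTower Fq[X] F K := .of_algebraMap_eq fun f => by
    change aeval x f = F.val (aeval _ f)
    rw [← aeval_algHom_apply]; rfl
  have : FiniteDimensional F K := hK.finiteDimensional_adjoin hx
  have hinj : Function.Injective (algebraMap Fq[X] K) := transcendental_iff_injective.1 hx
  have : FaithfulSMul Fq[X] F := by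
    rw [faithfulSMul_iff_algebraMap_injective]
    rw [IsScalarTower.algebraMap_eq Fq[X] F K, RingHom.coe_comp] at hinj
    exact Function.Injective.of_comp hinj
  have : IsFractionRing Fq[X] F := IsFractionRing.of_field _ _ fun z => by
    obtain ⟨r, s, h⟩ := (IntermediateField.mem_adjoin_simple_iff Fq (z : K)).1 z.2
    refine ⟨r, s, Subtype.ext ?_⟩
    rw [h, IntermediateField.coe_div]
    congr 1
    · exact IsScalarTower.algebraMap_apply Fq[X] F K r
    · exact IsScalarTower.algebraMap_apply Fq[X] F K s
  have : IsIntegralClosure (integralOver Fq x) Fq[X] K :=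
    ⟨Subtype.val_injective, fun {z} => ⟨fun h => ⟨⟨z, h⟩, rfl⟩, by rintro ⟨y, rfl⟩; exact y.2⟩⟩
  obtain ⟨h1, h2, h3, h4⟩ :=
    isDedekindDomain_isIntegralClosure (k := Fq) (K := K) (integralOver Fq x) F
  refine ⟨h1, h2, h3, h4, fun z => ?_, ?_⟩
  · have : Algebra.IsAlgebraic Fq[X] K :=
      (IsFractionRing.comap_isAlgebraic_iff (A := Fq[X]) (K := F) (C := K)).2
        (Algebra.IsAlgebraic.of_finite F K)
    obtain ⟨f, hf, hz⟩ := (Algebra.IsAlgebraic.isAlgebraic (R := Fq[X]) z).exists_integral_multiple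
    exact ⟨f, hf, by rwa [Algebra.smul_def] at hz⟩
  · have   := finite_isIntegralClosure (k := Fq) (K := K) (integralOver Fq x) F
    have : Module.IsTorsionFree Fq[X] K := .trans_faithfulSMul Fq[X] F K
    have : Module.IsTorsionFree Fq[X] (integralOver Fq x) := IsIntegralClosure.isTorsionFree Fq[X] K
    have hsum : ∀ (n : ℕ) (β : Fin n → integralOver Fq x) (g : Fin n → Fq[X]),
        ∑ i, aeval x (g i) * (β i : K) = ((∑ i, g i • β i : integralOver Fq x) : K) := by
      intro n β g
      rw [AddSubmonoidClass.coe_finsetSum]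
      refine Finset.sum_congr rfl fun i _ => ?_
      rw [Algebra.smul_def, MulMemClass.coe_mul]
      congr 1
      exact IsScalarTower.algebraMap_apply Fq[X] (integralOver Fq x) K (g i)
    refine ⟨_, Module.finBasis Fq[X] (integralOver Fq x), fun g hg => ?_, fun b => ?_⟩
    · rw [hsum, ZeroMemClass.coe_eq_zero] at hg
      exact funext (Fintype.linearIndependent_iff.1
        (Module.finBasis Fq[X] (integralOver Fq x)).linearIndependent g hg)
    · refine ⟨fun i => (Module.finBasis Fq[X] (integralOver Fq x)).repr b i, ?_⟩
      rw [hsum, Module.Basis.sum_repr]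

end FunctionField

/-! ### Places and their centers on Dedekind subrings -/

section Places

open Polynomial IsDedekindDomain

variable {Fq K : Type*} [Field Fq] [Field K] [Algebra Fq K]

namespace Place

/-- Constants are roots of `X ^ q - X`, and a valuation ring is integrally closed. -/
theorem algebraMap_mem [Finite Fq] (V : Place K) (c : Fq) : algebraMap Fq K c ∈ V.ring := by
  have := Fintype.ofFinite Fq
  have h : IsIntegral V.ring (algebraMap Fq K c) := by
    refine ⟨X ^ Fintype.card Fq - X, ?_, ?_⟩
    · exact monic_X_pow_sub (by simpa using Fintype.one_lt_card (α := Fq))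
    · rw [eval₂_sub, eval₂_X_pow, eval₂_X, ← map_pow, FiniteField.pow_card, sub_self]
  obtain ⟨y, hy⟩ := IsIntegrallyClosed.isIntegral_iff.1 h
  rw [← hy]
  exact y.2

theorem ring_ne_top (V : Place K) : V.ring ≠ ⊤ := by
  intro h
  have : ¬ IsField V.ring := IsDiscreteValuationRing.not_isField V.ring
  apply this
  refine ⟨⟨0, 1, zero_ne_one⟩, mul_comm, fun {a} ha => ?_⟩
  refine ⟨⟨(a : K)⁻¹, h.symm.le (ValuationSubring.mem_top _)⟩, Subtype.ext ?_⟩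
  exact mul_inv_cancel₀ (by simpa using ha)

theorem integralOver_le [Finite Fq] (V : Place K) {x : K} (hx : x ∈ V.ring) {z : K}
    (hz : z ∈ integralOver Fq x) : z ∈ V.ring :=
  let W : Subalgebra Fq K := { V.ring.toSubring with algebraMap_mem' := V.algebraMap_mem }
  have : IsIntegrallyClosed W := (inferInstance : IsIntegrallyClosed V.ring)
  have : IsFractionRing W K := (inferInstance : IsFractionRing V.ring K)
  integralOver_le_of_mem W hx hz

variable (B : Subalgebra Fq K) [IsDedekindDomain B] [IsFractionRing B K]

/-- The place attached to a maximal ideal of a Dedekind domain with finite quotients. -/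
def ofPrime [Ring.HasFiniteQuotients B] (v : HeightOneSpectrum B) : Place K where
  ring := v.valuationSubringAtPrime K
  dvr := IsLocalization.AtPrime.isDiscreteValuationRing_of_dedekind_domain B v.ne_bot
    (v.valuationSubringAtPrime K)
  finite_residue := by
    have := Ring.HasFiniteQuotients.finiteQuotient v.ne_bot
    exact Finite.of_equiv _
      (IsLocalization.AtPrime.equivQuotMaximalIdeal v.asIdeal
        (v.valuationSubringAtPrime K)).toEquiv

theorem mem_ofPrime_iff [Ring.HasFiniteQuotients B] (v : HeightOneSpectrum B) (z : K) :
    z ∈ (ofPrime B v).ring ↔ v.valuation K z ≤ 1 := by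
  change z ∈ v.valuationSubringAtPrime K ↔ _
  rw [v.valuationSubringAtPrime_eq_valuationSubring, Valuation.mem_valuationSubring_iff]

/-- The maximal ideal of `B` below a place. -/
theorem exists_center (V : Place K) (hB : ∀ b ∈ B, b ∈ V.ring) :
    ∃ v : HeightOneSpectrum B, V.ring = v.valuationSubringAtPrime K ∧
      (∀ b : B, b ∈ v.asIdeal → ((b : K) = 0 ∨ (b : K)⁻¹ ∉ V.ring)) ∧
      ∀ b : B, b ∉ v.asIdeal → (b : K)⁻¹ ∈ V.ring := by
  let ι : B →+* V.ring := ⟨⟨⟨fun b => ⟨b, hB b b.2⟩, rfl⟩, fun _ _ => rfl⟩, rfl, fun _ _ => rfl⟩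
  let I := (IsLocalRing.maximalIdeal V.ring).comap ι
  have hinv : ∀ b : B, b ∉ I → (b : K)⁻¹ ∈ V.ring := by
    intro b hb
    have hu : IsUnit (ι b) := by simpa [I] using hb
    obtain ⟨c, hc⟩ := hu.exists_right_inv
    have : (b : K)⁻¹ = c := inv_eq_of_mul_eq_one_right (congrArg Subtype.val hc)
    rw [this]
    exact c.2
  have hI : I ≠ ⊥ := by
    intro h
    apply V.ring_ne_top
    rw [eq_top_iff]
    rintro z -
    obtain ⟨a, b, hb, rfl⟩ := IsFractionRing.div_surjective (A := B) z
    rw [div_eq_mul_inv]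
    refine mul_mem (hB _ a.2) (hinv b ?_)
    rw [h]
    simpa using nonZeroDivisors.ne_zero hb
  let v : HeightOneSpectrum B := ⟨I, inferInstance, hI⟩
  -- The localization of `B` at the center is a discrete valuation ring contained in `V`, and no
  -- ring lies strictly between it and `K`.
  refine ⟨v, (ValuationSubring.eq_of_le_of_ne_top _ ?_ V.ring_ne_top).symm, fun b hb => ?_, hinv⟩
  · rintro _ ⟨a, s, hs, rfl⟩
    exact mul_mem (hB _ a.2) (hinv s hs)
  · by_contra! h
    have : IsUnit (ι b) := IsUnit.of_mul_eq_one ⟨(b : K)⁻¹, h.2⟩ (Subtype.ext (mul_inv_cancel₀ h.1))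
    exact hb this

end Place

variable [Finite Fq]

/-- A transcendental element has a zero at some place. -/
theorem IsCurveFunctionField.exists_inv_notMem (hK : IsCurveFunctionField Fq K) {y : K}
    (hy : Transcendental Fq y) : ∃ V : Place K, y⁻¹ ∉ V.ring := by
  obtain ⟨hD, hq, -, hf, -, n, β, hβ, hβ'⟩ := hK.integralOver_spec hy
  have hy0 : y ≠ 0 := by rintro rfl; exact hy isAlgebraic_zero
  set b : integralOver Fq y := ⟨y, mem_integralOver_self y⟩
  -- An injective integral extension reflects units, and `X` is not a unit of `Fq[X]`; so some
  -- maximal ideal contains `y`, and `y` vanishes at its place.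
  have hb : ¬ IsUnit b := by
    intro h
    have hinj : Function.Injective (aeval (R := Fq) b).toRingHom :=
      fun f g hfg => transcendental_iff_injective.1 hy (by
        have h1 : ∀ f : Fq[X], aeval y f = (integralOver Fq y).val (aeval b f) := fun f => by
          rw [← aeval_algHom_apply]; rfl
        rw [h1, h1]
        exact congrArg (integralOver Fq y).val hfg)
    have hint : (aeval (R := Fq) b).toRingHom.IsIntegral := fun c => by
      obtain ⟨f, hf, hz⟩ := c.2
      refine ⟨f, hf, Subtype.ext ?_⟩
      change (integralOver Fq y).val.toRingHom _ = _
      have h1 : (integralOver Fq y).val.toRingHom.comp (aeval (R := Fq) b).toRingHom =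
          (aeval (R := Fq) y).toRingHom := by
        refine ringHom_ext (fun c => by simp) (by simp [b])
      rw [hom_eval₂, h1]
      exact hz
    have := hint.isLocalHom hinj
    have hX : IsUnit (X : Fq[X]) := by
      refine isUnit_of_map_unit (aeval (R := Fq) b).toRingHom X ?_
      simpa using h
    exact not_isUnit_X hX
  obtain ⟨M, hM, hbM⟩ := exists_max_ideal_of_mem_nonunits hb
  have hM0 : M ≠ ⊥ := by
    rintro rfl
    exact hy0 (congrArg Subtype.val ((Submodule.mem_bot _).1 hbM))
  let v : HeightOneSpectrum (integralOver Fq y) := ⟨M, hM.isPrime, hM0⟩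
  refine ⟨Place.ofPrime _ v, fun h => ?_⟩
  rw [Place.mem_ofPrime_iff, map_inv₀, inv_le_one₀] at h
  · have := (v.valuation_lt_one_iff_mem (K := K) b).2 hbM
    exact absurd this (not_lt.2 h)
  · simpa [zero_lt_iff] using hy0

theorem IsCurveFunctionField.exists_notMem (hK : IsCurveFunctionField Fq K) {z : K}
    (hz : Transcendental Fq z) : ∃ V : Place K, z ∉ V.ring := by
  obtain ⟨V, hV⟩ := hK.exists_inv_notMem (y := z⁻¹) (by
    intro h; apply hz; simpa using h.inv)
  exact ⟨V, by simpa using hV⟩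

end Places

/-- Multiplicativity of the ideal norm in an infinite Dedekind domain. -/
theorem IsDedekindDomain.cardQuot_mul {S : Type*} [CommRing S] [IsDedekindDomain S] [Infinite S]
    (I J : Ideal S) :
    Submodule.cardQuot (I * J) = Submodule.cardQuot I * Submodule.cardQuot J :=
  UniqueFactorizationMonoid.multiplicative_of_coprime Submodule.cardQuot I J
    (Submodule.cardQuot_bot _ _)
    (fun {I J} hI => by simp [Ideal.isUnit_iff.mp hI, Ideal.mul_top])
    (fun {I} i hI =>
      have : Ideal.IsPrime I := Ideal.isPrime_of_prime hI
      cardQuot_pow_of_prime hI.ne_zero)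
    fun {I J} hIJ => cardQuot_mul_of_coprime <| Ideal.isCoprime_iff_sup_eq.mpr
      (Ideal.isUnit_iff.mp
        (hIJ (Ideal.dvd_iff_le.mpr le_sup_left) (Ideal.dvd_iff_le.mpr le_sup_right)))

theorem IsDedekindDomain.cardQuot_pow {S : Type*} [CommRing S] [IsDedekindDomain S] [Infinite S]
    (I : Ideal S) (n : ℕ) : Submodule.cardQuot (I ^ n) = Submodule.cardQuot I ^ n := by
  induction n with
  | zero => simp
  | succ n ih => rw [pow_succ, cardQuot_mul, ih, pow_succ]

/-! ### The ring of functions regular outside a place -/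

section RegularRing

open Polynomial IsDedekindDomain

theorem Polynomial.pow_mul_aeval_inv {Fq K : Type*} [Field Fq] [Field K] [Algebra Fq K] (y : K) (hy : y ≠ 0) (m : ℕ) (f : Fq[X])
    (hf : f.natDegree ≤ m) : y ^ m * aeval y⁻¹ f = aeval y (f.reflect m) := by
  let := invertibleOfNonzero (inv_ne_zero hy)
  have h := eval₂_reflect_mul_pow (algebraMap Fq K) y⁻¹ m f hf
  rw [invOf_eq_inv, inv_inv] at h
  rw [aeval_def, aeval_def, ← h, inv_pow]
  field_simp

variable {Fq K : Type*} [Field Fq] [Finite Fq] [Field K] [Algebra Fq K]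

namespace IsCurveFunctionField

theorem transcendental_of_notMem (hK : IsCurveFunctionField Fq K) {V : Place K} {z : K}
    (hz : z ∉ V.ring) : Transcendental Fq z := fun h => by
  obtain ⟨c, rfl⟩ := hK.constants z h
  exact hz (V.algebraMap_mem c)

/-- Modulo `y` only the constant coefficients of the coordinates with respect to `β` survive. -/
theorem card_quot_self_le {y : K} (n : ℕ)
    (β : Fin n → integralOver Fq y)
    (hβ : ∀ b : integralOver Fq y, ∃ g : Fin n → Fq[X], (b : K) = ∑ i, aeval y (g i) * (β i : K)) :
    Submodule.cardQuot (Ideal.span {(⟨y, mem_integralOver_self y⟩ : integralOver Fq y)}) ≤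
      Nat.card Fq ^ n := by
  set b : integralOver Fq y := ⟨y, mem_integralOver_self y⟩
  have : Function.Surjective fun a : Fin n → Fq =>
      Ideal.Quotient.mk (Ideal.span {b}) (∑ i, a i • β i) := by
    intro z
    obtain ⟨z, rfl⟩ := Ideal.Quotient.mk_surjective z
    obtain ⟨g, hg⟩ := hβ z
    refine ⟨fun i => (g i).coeff 0, ?_⟩
    have hz : z = ∑ i, aeval b (g i) * β i := by
      apply Subtype.ext
      rw [hg, AddSubmonoidClass.coe_finsetSum]
      refine Finset.sum_congr rfl fun i _ => ?_
      rw [MulMemClass.coe_mul]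
      congr 1
      exact aeval_algHom_apply (integralOver Fq y).val b (g i)
    change Ideal.Quotient.mk (Ideal.span {b}) (∑ i, (g i).coeff 0 • β i) = _
    rw [hz, eq_comm, Ideal.Quotient.eq, ← Finset.sum_sub_distrib]
    refine Ideal.sum_mem _ fun i _ => ?_
    rw [Algebra.smul_def, ← sub_mul]
    refine Ideal.mul_mem_right _ _ (Ideal.mem_span_singleton.2 ?_)
    nth_rewrite 1 [← divX_mul_X_add (g i)]
    simp
  have h := Nat.card_le_card_of_surjective _ this
  rwa [Nat.card_fun, Nat.card_fin] at h

/-- There are nonconstant functions regular outside a given place. -/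
theorem exists_transcendental_mem_regularRing (hK : IsCurveFunctionField Fq K) (P : Place K) :
    ∃ t ∈ regularRing Fq P, Transcendental Fq t := by
  -- A pigeonhole count in place of the Riemann–Roch inequality: `y` has a zero at `P`, and among
  -- functions whose poles are zeros of `y` one is sought with poles at `P` only.
  obtain ⟨y, hyP⟩ : ∃ y : K, y⁻¹ ∉ P.ring := by
    by_contra! h
    exact P.ring_ne_top (eq_top_iff.2 fun z _ => by simpa using h z⁻¹)
  have hx : Transcendental Fq y⁻¹ := hK.transcendental_of_notMem hyP
  have hy : Transcendental Fq y := fun h => hx h.inv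
  have hy0 : y ≠ 0 := by rintro rfl; exact hy isAlgebraic_zero
  have hyP' : y ∈ P.ring := (P.ring.mem_or_inv_mem y).resolve_right hyP
  obtain ⟨hD, hq, -, hf, -, n, β, hβ, hβ'⟩ := hK.integralOver_spec hy
  have hden := (hK.integralOver_spec hx).2.2.2.2.1
  choose F hF0 hF using fun i => hden (β i : K)
  set f := ∏ i, F i
  have hf0 : f ≠ 0 := Finset.prod_ne_zero_iff.2 fun i _ => hF0 i
  have hfβ : ∀ i, aeval y⁻¹ f * (β i : K) ∈ integralOver Fq y⁻¹ := by
    intro i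
    rw [show f = (∏ j ∈ Finset.univ.erase i, F j) * F i from
      (Finset.prod_erase_mul _ _ (Finset.mem_univ i)).symm, map_mul, mul_assoc]
    exact mul_mem (aeval_mem_integralOver _ _) (hF i)
  set b : integralOver Fq y := ⟨y, mem_integralOver_self y⟩ with hb
  have hB : ∀ V : Place K, y ∈ V.ring → ∀ b ∈ integralOver Fq y, b ∈ V.ring :=
    fun V hV b hb => V.integralOver_le hV hb
  obtain ⟨v, hv, hv1, hv2⟩ := P.exists_center (integralOver Fq y) (hB P hyP')
  have hbv : b ∈ v.asIdeal := by
    by_contra h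
    exact hyP (hv2 b h)
  obtain ⟨d, hd⟩ := Ideal.dvd_span_singleton.2 hbv
  have hinf : Infinite (integralOver Fq y) := by
    refine Infinite.of_injective (fun m : ℕ => b ^ m) fun i j hij => ?_
    have h := transcendental_iff_injective.1 hy (a₁ := X ^ i) (a₂ := X ^ j) (by
      simpa [hb] using congrArg Subtype.val hij)
    simpa using congrArg natDegree h
  -- With `(y) = v d` and `v` the prime of `P`, omitting `v` gains a factor at least `2` in the
  -- norm. Raised to a high power, this gain beats the fixed loss caused by the denominator `f`.
  have hcard : 2 * Submodule.cardQuot d ≤ Nat.card Fq ^ n := by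
    refine le_trans ?_ (card_quot_self_le n β hβ')
    rw [hd, IsDedekindDomain.cardQuot_mul]
    gcongr
    have h0 := Ring.HasFiniteQuotients.cardQuot_pos v.asIdeal v.ne_bot
    have h1 : Submodule.cardQuot v.asIdeal ≠ 1 := by
      rw [Ne, Submodule.cardQuot_eq_one_iff]
      exact v.isPrime.ne_top
    omega
  set c := f.natDegree
  -- The degree bound is chosen so that a kernel of at most `q` elements would give `2 ^ (e + c) ≤
  -- e` below.
  set e := Nat.card Fq * Nat.card Fq ^ (n * c)
  -- functions with poles of bounded order at the zeros of `y`
  have hGdeg : ∀ (g : Fin n → degreeLT Fq (e + 1)) i, ((g i : Fq[X])).natDegree ≤ e := fun g i => by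
    have := mem_degreeLT.1 (g i).2
    rw [natDegree_le_iff_degree_le]
    exact degree_le_of_natDegree_le (Nat.lt_succ_iff.1 (by
      rcases eq_or_ne (g i : Fq[X]) 0 with h | h
      · simp [h]
      · exact (natDegree_lt_iff_degree_lt h).2 this))
  have hGcard : Nat.card (Fin n → degreeLT Fq (e + 1)) = Nat.card Fq ^ (n * (e + 1)) := by
    rw [Nat.card_fun, Nat.card_fin, Nat.card_congr (degreeLTEquiv Fq (e + 1)).toEquiv,
      Nat.card_fun, Nat.card_fin, ← pow_mul, mul_comm]
  have hGfin : Finite (Fin n → degreeLT Fq (e + 1)) := Nat.finite_of_card_ne_zero (by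
    rw [hGcard]; exact pow_ne_zero _ Nat.card_pos.ne')
  let τ : (Fin n → degreeLT Fq (e + 1)) →+ K :=
    { toFun := fun g => ∑ i, aeval y⁻¹ (g i : Fq[X]) * (aeval y⁻¹ f * β i)
      map_zero' := by simp
      map_add' := fun g h => by simp [add_mul, Finset.sum_add_distrib] }
  let ω : (Fin n → degreeLT Fq (e + 1)) →+ integralOver Fq y :=
    { toFun := fun g => ∑ i, aeval b (reflect (e + c) ((g i : Fq[X]) * f)) * β i
      map_zero' := by simp
      map_add' := fun g h => by simp [add_mul, reflect_add, Finset.sum_add_distrib] }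
  have hω : ∀ g, (ω g : K) = y ^ (e + c) * τ g := by
    intro g
    simp only [ω, τ, AddMonoidHom.coe_mk, ZeroHom.coe_mk, AddSubmonoidClass.coe_finsetSum,
      MulMemClass.coe_mul, Finset.mul_sum]
    refine Finset.sum_congr rfl fun i _ => ?_
    have h1 : ((aeval b (reflect (e + c) ((g i : Fq[X]) * f)) : integralOver Fq y) : K) =
        y ^ (e + c) * aeval y⁻¹ ((g i : Fq[X]) * f) := by
      rw [pow_mul_aeval_inv y hy0 _ _ (natDegree_mul_le_of_le (hGdeg g i) le_rfl)]
      exact (aeval_algHom_apply (integralOver Fq y).val b _).symm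
    rw [h1, map_mul]
    ring
  have hτ : Function.Injective τ := by
    rw [injective_iff_map_eq_zero]
    intro g hg
    have h1 : (ω g : K) = 0 := by rw [hω, hg, mul_zero]
    have h2 := hβ (fun i => reflect (e + c) ((g i : Fq[X]) * f)) (by
      rw [← h1]
      simp only [ω, AddMonoidHom.coe_mk, ZeroHom.coe_mk, AddSubmonoidClass.coe_finsetSum,
        MulMemClass.coe_mul]
      exact Finset.sum_congr rfl fun i _ =>
        congrArg (· * (β i : K)) (aeval_algHom_apply (integralOver Fq y).val b _))
    funext i
    have h3 := congrFun h2 i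
    simp only [Pi.zero_apply, reflect_eq_zero_iff, mul_eq_zero, hf0, or_false] at h3
    exact Subtype.ext h3
  -- On the kernel, `ω g` is divisible by `d ^ (e + c)`, so among the zeros of `y` the quotient `τ g
  -- = ω g / y ^ (e + c)` can have a pole only at `v`. More than `q` such functions force a
  -- nonconstant one.
  let ψ := (Ideal.Quotient.mk (d ^ (e + c))).toAddMonoidHom.comp ω
  have hker : Nat.card Fq < Nat.card ψ.ker := by
    have h1 : Nat.card ψ.ker * Nat.card ψ.range = Nat.card Fq ^ (n * (e + 1)) := by
      rw [← hGcard, ← AddSubgroup.index_ker, AddSubgroup.card_mul_index]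
    have hd0 : d ≠ ⊥ := by
      rintro rfl
      rw [Ideal.mul_bot, Ideal.span_singleton_eq_bot] at hd
      exact hy0 (congrArg Subtype.val hd)
    have h2 : Nat.card ψ.range ≤ Submodule.cardQuot d ^ (e + c) := by
      rw [← IsDedekindDomain.cardQuot_pow, Submodule.cardQuot_apply]
      have := Ring.HasFiniteQuotients.finiteQuotient (pow_ne_zero (e + c) hd0)
      exact Nat.card_le_card_of_injective _ Subtype.val_injective
    have hq0 : 0 < Nat.card Fq := Nat.card_pos
    have h3 : 2 ^ (e + c) * Nat.card Fq ^ (n * (e + 1)) ≤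
        Nat.card ψ.ker * Nat.card Fq ^ (n * (e + c)) := by
      calc 2 ^ (e + c) * Nat.card Fq ^ (n * (e + 1))
          = 2 ^ (e + c) * (Nat.card ψ.ker * Nat.card ψ.range) := by rw [h1]
        _ ≤ 2 ^ (e + c) * (Nat.card ψ.ker * Submodule.cardQuot d ^ (e + c)) := by gcongr
        _ = Nat.card ψ.ker * (2 * Submodule.cardQuot d) ^ (e + c) := by ring
        _ ≤ Nat.card ψ.ker * (Nat.card Fq ^ n) ^ (e + c) := by gcongr
        _ = _ := by rw [← pow_mul]
    by_contra! h4
    have h5 : 2 ^ (e + c) * Nat.card Fq ^ (n * e) ≤ e * Nat.card Fq ^ (n * e) := by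
      calc 2 ^ (e + c) * Nat.card Fq ^ (n * e) ≤ 2 ^ (e + c) * Nat.card Fq ^ (n * (e + 1)) := by
            gcongr
            omega
        _ ≤ Nat.card Fq * Nat.card Fq ^ (n * (e + c)) := h3.trans (by gcongr)
        _ = e * Nat.card Fq ^ (n * e) := by simp only [e]; ring
    have h6 := Nat.le_of_mul_le_mul_right h5 (by positivity)
    exact absurd (((Nat.lt_two_pow_self (n := e)).trans_le
      (Nat.pow_le_pow_right two_pos (Nat.le_add_right e c))).trans_le h6) (lt_irrefl _)
  obtain ⟨g, hg, ht⟩ : ∃ g ∈ ψ.ker, τ g ∉ (algebraMap Fq K).range := by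
    by_contra! h
    choose r hr using h
    refine absurd (Nat.card_le_card_of_injective (fun g : ψ.ker => r g g.2) fun g g' hgg => ?_)
      (not_le.2 hker)
    apply Subtype.ext
    apply hτ
    rw [← hr g g.2, ← hr g' g'.2]
    exact congrArg _ hgg
  refine ⟨τ g, fun V hV => ?_, fun h => ht (hK.constants _ h)⟩
  rcases V.ring.mem_or_inv_mem y with hyV | hyV
  · obtain ⟨v', hv', -, hv2'⟩ := V.exists_center (integralOver Fq y) (hB V hyV)
    have hne : ¬ v.asIdeal ^ (e + c) ≤ v'.asIdeal := by
      intro h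
      have h1 : v.asIdeal ≤ v'.asIdeal := v'.isPrime.le_of_pow_le h
      have h2 := v.isMaximal.eq_of_le v'.isPrime.ne_top h1
      exact hV (by rw [hv', hv, HeightOneSpectrum.ext h2])
    -- `s` lies in `v ^ (e + c)` but is a unit at `V`; then `s * ω g` is divisible by `y ^ (e + c)`,
    -- so `s * τ g` is integral and `τ g` is regular at `V`.
    obtain ⟨s, hs, hs'⟩ := SetLike.not_le_iff_exists.1 hne
    have hw : ω g ∈ d ^ (e + c) := Ideal.Quotient.eq_zero_iff_mem.1 hg
    have hsw : s * ω g ∈ Ideal.span {b ^ (e + c)} := by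
      rw [← Ideal.span_singleton_pow, hd, mul_pow]
      exact Ideal.mul_mem_mul hs hw
    obtain ⟨a, ha⟩ := Ideal.mem_span_singleton.1 hsw
    have h1 : (s : K) * τ g = a := by
      have := congrArg Subtype.val ha
      simp only [MulMemClass.coe_mul, hω, SubmonoidClass.coe_pow, hb] at this
      refine mul_left_cancel₀ (pow_ne_zero (e + c) hy0) ?_
      rw [← this]; ring
    have hs0 : (s : K) ≠ 0 := by
      intro h
      exact hs' (by rw [show s = 0 from Subtype.ext h]; exact zero_mem _)
    rw [show τ g = a * (s : K)⁻¹ by rw [← h1]; field_simp]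
    exact mul_mem (hB V hyV _ a.2) (hv2' s hs')
  · refine sum_mem (t := Finset.univ) fun i _ => mul_mem (V.integralOver_le hyV (aeval_mem_integralOver _ _))
      (V.integralOver_le hyV (hfβ i))

/-- The ring of functions regular outside a place is the integral closure of a polynomial ring. -/
theorem exists_regularRing_eq (hK : IsCurveFunctionField Fq K) (P : Place K) :
    ∃ t : K, Transcendental Fq t ∧ regularRing Fq P = integralOver Fq t := by
  obtain ⟨t, ht, htr⟩ := hK.exists_transcendental_mem_regularRing P
  have htP : t ∉ P.ring := by
    obtain ⟨V, hV⟩ := hK.exists_notMem htr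
    by_cases h : V.ring = P.ring
    · rwa [← h]
    · exact absurd (ht V h) hV
  refine ⟨t, htr, le_antisymm (fun a ha => ?_) fun b hb V hV => V.integralOver_le (ht V hV) hb⟩
  obtain ⟨hD, hq, -, hf, -⟩ := hK.integralOver_spec htr
  -- Each prime of the integral closure gives a place where `t` is finite, hence a place other than
  -- `P`; so `a` is regular at all primes.
  obtain ⟨b, rfl⟩ := HeightOneSpectrum.mem_integers_of_valuation_le_one
    (R := integralOver Fq t) K a fun v => by
      rw [← Place.mem_ofPrime_iff]
      refine ha _ fun h => htP ?_
      rw [← h, Place.mem_ofPrime_iff]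
      exact v.valuation_le_one (⟨t, mem_integralOver_self t⟩ : integralOver Fq t)
  exact b.2

theorem isDedekindDomain_regularRing (hK : IsCurveFunctionField Fq K) (P : Place K) :
    IsDedekindDomain (regularRing Fq P) := by
  obtain ⟨t, ht, h⟩ := hK.exists_regularRing_eq P
  rw [h]
  exact (hK.integralOver_spec ht).1

theorem hasFiniteQuotients_regularRing (hK : IsCurveFunctionField Fq K) (P : Place K) :
    Ring.HasFiniteQuotients (regularRing Fq P) := by
  obtain ⟨t, ht, h⟩ := hK.exists_regularRing_eq P
  rw [h]
  exact (hK.integralOver_spec ht).2.1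

theorem finite_classGroup_regularRing (hK : IsCurveFunctionField Fq K) (P : Place K) :
    Finite (ClassGroup (regularRing Fq P)) := by
  obtain ⟨t, ht, h⟩ := hK.exists_regularRing_eq P
  rw [h]
  exact (hK.integralOver_spec ht).2.2.1

theorem isFractionRing_regularRing (hK : IsCurveFunctionField Fq K) (P : Place K) :
    IsFractionRing (regularRing Fq P) K := by
  obtain ⟨t, ht, h⟩ := hK.exists_regularRing_eq P
  rw [h]
  exact (hK.integralOver_spec ht).2.2.2.1

/-- The units of the ring of functions regular outside a place are constants. -/
theorem mem_range_of_inv_mem_regularRing (hK : IsCurveFunctionField Fq K) {P : Place K} {a : K}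
    (ha : a ∈ regularRing Fq P) (ha' : a⁻¹ ∈ regularRing Fq P) :
    a ∈ (algebraMap Fq K).range := by
  refine hK.constants a (by_contra fun h => ?_)
  have key : ∀ b ∈ regularRing Fq P, Transcendental Fq b → b ∉ P.ring := fun b hb ht => by
    obtain ⟨V, hV⟩ := hK.exists_notMem ht
    by_cases h : V.ring = P.ring
    · rwa [← h]
    · exact absurd (hb V h) hV
  exact (P.ring.mem_or_inv_mem a).elim (key a ha h)
    (key _ ha' fun h' => h (by simpa using h'.inv))

theorem not_isField_regularRing (hK : IsCurveFunctionField Fq K) (P : Place K) :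
    ¬ IsField (regularRing Fq P) := by
  obtain ⟨t, ht, htr⟩ := hK.exists_transcendental_mem_regularRing P
  intro h
  have ht0 : t ≠ 0 := by rintro rfl; exact htr isAlgebraic_zero
  obtain ⟨b, hb⟩ := h.mul_inv_cancel (a := ⟨t, ht⟩) fun h => ht0 (congrArg Subtype.val h)
  have hb' : (b : K) = t⁻¹ := (inv_eq_of_mul_eq_one_right (congrArg Subtype.val hb)).symm
  obtain ⟨c, rfl⟩ := hK.mem_range_of_inv_mem_regularRing ht (hb' ▸ b.2)
  exact htr (isAlgebraic_algebraMap c)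

theorem finite_units_regularRing (hK : IsCurveFunctionField Fq K) (P : Place K) :
    Finite (regularRing Fq P)ˣ := by
  have h : ∀ a : (regularRing Fq P)ˣ, ∃ c : Fq, algebraMap Fq K c = (a : regularRing Fq P) :=
    fun a => hK.mem_range_of_inv_mem_regularRing (a : regularRing Fq P).2 (by
      rw [inv_eq_of_mul_eq_one_right (congrArg Subtype.val a.mul_inv)]
      exact (a⁻¹ : (regularRing Fq P)ˣ).1.2)
  choose f hf using h
  refine Finite.of_injective f fun a b hab => Units.ext (Subtype.ext ?_)
  rw [← hf, ← hf, hab]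

theorem infinite_regularRing (hK : IsCurveFunctionField Fq K) (P : Place K) :
    Infinite (regularRing Fq P) :=
  not_finite_iff_infinite.1 fun _ => hK.not_isField_regularRing P (Finite.isField_of_domain _)

/-! ### Degrees of ideals -/

section IdealDeg

variable (P : Place K)

theorem card_pow_idealDeg (hK : IsCurveFunctionField Fq K)
    (I : (Ideal (regularRing Fq P))⁰) :
    Nat.card Fq ^ idealDeg Fq P I = Submodule.cardQuot (I : Ideal (regularRing Fq P)) := by
  have := hK.hasFiniteQuotients_regularRing P
  have := Ring.HasFiniteQuotients.finiteQuotient (nonZeroDivisors.ne_zero I.2)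
  have : Module.Finite Fq (regularRing Fq P ⧸ (I : Ideal (regularRing Fq P))) :=
    Module.Finite.of_finite
  rw [Submodule.cardQuot_apply, idealDeg]
  exact Module.natCard_eq_pow_finrank.symm

theorem idealDeg_mul (hK : IsCurveFunctionField Fq K) (I J : (Ideal (regularRing Fq P))⁰) :
    idealDeg Fq P (I * J) = idealDeg Fq P I + idealDeg Fq P J := by
  have := hK.isDedekindDomain_regularRing P
  have := hK.infinite_regularRing P
  refine Nat.pow_right_injective (Finite.one_lt_card (α := Fq)) ?_
  change Nat.card Fq ^ _ = Nat.card Fq ^ _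
  rw [pow_add, hK.card_pow_idealDeg, hK.card_pow_idealDeg, hK.card_pow_idealDeg, Submonoid.coe_mul,
    IsDedekindDomain.cardQuot_mul]

theorem finite_idealDeg_le (hK : IsCurveFunctionField Fq K) (n : ℕ) :
    {I : (Ideal (regularRing Fq P))⁰ | idealDeg Fq P I ≤ n}.Finite := by
  have := hK.hasFiniteQuotients_regularRing P
  refine Set.Finite.subset ((Ring.HasFiniteQuotients.finite_cardQuot_le
    (R := regularRing Fq P) (Nat.card Fq ^ n)).preimage Subtype.val_injective.injOn) fun I hI => ?_
  change Submodule.cardQuot (I : Ideal (regularRing Fq P)) ≤ _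
  rw [← hK.card_pow_idealDeg]
  exact Nat.pow_le_pow_right Nat.card_pos hI

end IdealDeg

end IsCurveFunctionField

end RegularRing

/-! ### One-units and their `p`-adic powers -/

section OneUnits

open Filter Topology

variable {p : ℕ} [Fact p.Prime] {C : Type*} [NormedField C] [CharP C p]

/-- Reduction of `p`-adic integers modulo `p`, in a field of characteristic `p`. -/
def padicCast (p : ℕ) [Fact p.Prime] (C : Type*) [NormedField C] [CharP C p] : ℤ_[p] →+* C :=
  (ZMod.castHom dvd_rfl C).comp PadicInt.toZMod

theorem padicCast_apply (z : ℤ_[p]) : padicCast p C z = ((PadicInt.toZMod z).val : C) := by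
  change ZMod.castHom dvd_rfl C _ = _
  rw [ZMod.castHom_apply, ZMod.natCast_val]

theorem continuous_padicCast : Continuous (padicCast p C) := by
  refine IsLocallyConstant.continuous ((IsLocallyConstant.iff_eventually_eq _).2 fun z => ?_)
  filter_upwards [Metric.ball_mem_nhds z one_pos] with y hy
  rw [← sub_eq_zero, ← map_sub, padicCast, RingHom.comp_apply]
  have : y - z ∈ RingHom.ker (PadicInt.toZMod (p := p)) := by
    rw [PadicInt.ker_toZMod, IsLocalRing.mem_maximalIdeal, PadicInt.mem_nonunits]
    rwa [mem_ball_iff_norm] at hy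
  rw [RingHom.mem_ker.1 this, map_zero]

theorem pow_expChar_pow_sub_one (w : C) (k : ℕ) : (w - 1) ^ p ^ k = w ^ p ^ k - 1 := by
  have := ExpChar.prime (R := C) (Fact.out : p.Prime)
  rw [sub_pow_expChar_pow, one_pow]

theorem exists_natCast_mul_eq_one {m : ℕ} (hm : ¬ p ∣ m) : ∃ y : ℤ_[p], (m : ℤ_[p]) * y = 1 := by
  have : IsUnit (m : ℤ_[p]) := by
    rw [PadicInt.isUnit_iff, PadicInt.norm_natCast_eq_one_iff]
    exact (Nat.Prime.coprime_iff_not_dvd Fact.out).2 hm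
  exact this.exists_right_inv

/-- For natural exponents the series is the binomial theorem. Since `ℕ` is dense in `ℤ_p`, this and
continuity in the exponent yield the power laws below. -/
theorem oneUnitPow_natCast (w : C) (n : ℕ) : oneUnitPow p w (n : ℤ_[p]) = w ^ n := by
  have h : ∀ j, ((PadicInt.toZMod (Ring.choose (n : ℤ_[p]) j)).val : C) = (n.choose j : C) := by
    intro j
    rw [← padicCast_apply, Ring.choose_natCast, map_natCast]
  simp only [oneUnitPow, h]
  rw [tsum_eq_sum (s := Finset.range (n + 1))]
  · nth_rewrite 2 [← sub_add_cancel w 1]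
    rw [add_pow]
    refine Finset.sum_congr rfl fun j _ => by simp [mul_comm]
  · intro j hj
    rw [Nat.choose_eq_zero_of_lt (by simpa [Nat.succ_le_iff] using hj)]
    simp

theorem oneUnitPow_zero (w : C) : oneUnitPow p w (0 : ℤ_[p]) = 1 := by
  simpa using oneUnitPow_natCast (p := p) w 0

theorem oneUnitPow_one (w : C) : oneUnitPow p w (1 : ℤ_[p]) = w := by
  simpa using oneUnitPow_natCast (p := p) w 1

theorem one_oneUnitPow (y : ℤ_[p]) : oneUnitPow p (1 : C) y = 1 := by
  rw [oneUnitPow, tsum_eq_single 0 (fun j hj => by simp [hj])]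
  rw [← padicCast_apply]
  simp

variable [IsUltrametricDist C]

theorem norm_padicCast_le (z : ℤ_[p]) : ‖padicCast p C z‖ ≤ 1 := by
  rw [padicCast_apply]
  exact IsUltrametricDist.norm_natCast_le_one C _

theorem norm_padicCast_mul_le (w : C) (y : ℤ_[p]) (j : ℕ) :
    ‖((PadicInt.toZMod (Ring.choose y j)).val : C) * (w - 1) ^ j‖ ≤ ‖w - 1‖ ^ j := by
  rw [norm_mul, norm_pow, ← padicCast_apply]
  exact mul_le_of_le_one_left (by positivity) (norm_padicCast_le _)

theorem norm_eq_one_of_norm_sub_one_lt {w : C} (hw : ‖w - 1‖ < 1) : ‖w‖ = 1 := by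
  have := IsUltrametricDist.norm_add_eq_max_of_norm_ne_norm (x := w - 1) (y := 1)
    (by rw [norm_one]; exact hw.ne)
  rwa [sub_add_cancel, norm_one, max_eq_right hw.le] at this

theorem norm_mul_sub_one_lt {v w : C} (hv : ‖v - 1‖ < 1) (hw : ‖w - 1‖ < 1) :
    ‖v * w - 1‖ < 1 := by
  rw [show v * w - 1 = v * (w - 1) + (v - 1) by ring]
  refine (IsUltrametricDist.norm_add_le_max _ _).trans_lt (max_lt ?_ hv)
  rwa [norm_mul, norm_eq_one_of_norm_sub_one_lt hv, one_mul]

theorem norm_inv_sub_one_lt {w : C} (hw : ‖w - 1‖ < 1) : ‖w⁻¹ - 1‖ < 1 := by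
  have h := norm_eq_one_of_norm_sub_one_lt hw
  have hw0 : w ≠ 0 := by rintro rfl; simp at h
  rw [show w⁻¹ - 1 = -(w⁻¹ * (w - 1)) by field_simp; ring, norm_neg, norm_mul, norm_inv, h]
  simpa using hw

theorem norm_pow_sub_one_le {w : C} (hw : ‖w - 1‖ < 1) (n : ℕ) : ‖w ^ n - 1‖ ≤ ‖w - 1‖ := by
  induction n with
  | zero => simp
  | succ n ih =>
    rw [show w ^ (n + 1) - 1 = w * (w ^ n - 1) + (w - 1) by ring]
    refine (IsUltrametricDist.norm_add_le_max _ _).trans (max_le ?_ le_rfl)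
    rwa [norm_mul, norm_eq_one_of_norm_sub_one_lt hw, one_mul]

variable [CompleteSpace C]

/-- The terms are continuous in `y`, because reduction modulo `p` is locally constant, and are
dominated by the geometric series of `‖w - 1‖`. -/
theorem continuous_oneUnitPow {w : C} (hw : ‖w - 1‖ < 1) :
    Continuous fun y : ℤ_[p] => oneUnitPow p w y := by
  refine continuous_tsum (fun j => ?_) (summable_geometric_of_lt_one (norm_nonneg _) hw)
    fun j y => norm_padicCast_mul_le w y j
  simp only [← padicCast_apply]
  exact (continuous_padicCast.comp (PadicInt.continuous_choose j)).mul continuous_const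

theorem oneUnitPow_add {w : C} (hw : ‖w - 1‖ < 1) (y z : ℤ_[p]) :
    oneUnitPow p w (y + z) = oneUnitPow p w y * oneUnitPow p w z := by
  have hc := continuous_oneUnitPow (p := p) hw
  have h := (PadicInt.denseRange_natCast (p := p)).prodMap
    (PadicInt.denseRange_natCast (p := p))
  have := h.equalizer (g := fun a : ℤ_[p] × ℤ_[p] => oneUnitPow p w (a.1 + a.2))
    (h := fun a => oneUnitPow p w a.1 * oneUnitPow p w a.2) (by fun_prop)
    (by fun_prop) (by
      funext ⟨m, n⟩
      simp only [Function.comp, Prod.map, ← Nat.cast_add, oneUnitPow_natCast, pow_add])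
  exact congrFun this (y, z)

theorem mul_oneUnitPow {v w : C} (hv : ‖v - 1‖ < 1) (hw : ‖w - 1‖ < 1) (y : ℤ_[p]) :
    oneUnitPow p (v * w) y = oneUnitPow p v y * oneUnitPow p w y := by
  have h1 := continuous_oneUnitPow (p := p) hv
  have h2 := continuous_oneUnitPow (p := p) hw
  have h3 := continuous_oneUnitPow (p := p) (norm_mul_sub_one_lt hv hw)
  have := (PadicInt.denseRange_natCast (p := p)).equalizer
    (g := fun y => oneUnitPow p (v * w) y) (h := fun y => oneUnitPow p v y * oneUnitPow p w y) h3
    (by fun_prop) (by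
      funext n
      simp only [Function.comp, oneUnitPow_natCast, mul_pow])
  exact congrFun this y

theorem norm_oneUnitPow_sub_one_lt {w : C} (hw : ‖w - 1‖ < 1) (y : ℤ_[p]) :
    ‖oneUnitPow p w y - 1‖ < 1 := by
  refine lt_of_le_of_lt ?_ hw
  have h1 := continuous_oneUnitPow (p := p) hw
  refine isClosed_property (PadicInt.denseRange_natCast (p := p))
    (p := fun y => ‖oneUnitPow p w y - 1‖ ≤ ‖w - 1‖)
    (isClosed_le (by fun_prop) continuous_const) (fun n => ?_) y
  rw [oneUnitPow_natCast]
  exact norm_pow_sub_one_le hw n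

theorem norm_oneUnitPow {w : C} (hw : ‖w - 1‖ < 1) (y : ℤ_[p]) : ‖oneUnitPow p w y‖ = 1 :=
  norm_eq_one_of_norm_sub_one_lt (norm_oneUnitPow_sub_one_lt hw y)

theorem oneUnitPow_natCast_mul {w : C} (hw : ‖w - 1‖ < 1) (n : ℕ) (y : ℤ_[p]) :
    oneUnitPow p w (n * y) = oneUnitPow p w y ^ n := by
  induction n with
  | zero => simp [oneUnitPow_zero]
  | succ n ih => rw [Nat.cast_succ, add_mul, one_mul, oneUnitPow_add hw, ih, pow_succ]

theorem pow_oneUnitPow {w : C} (hw : ‖w - 1‖ < 1) (n : ℕ) (y : ℤ_[p]) :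
    oneUnitPow p (w ^ n) y = oneUnitPow p w y ^ n := by
  induction n with
  | zero => simp [one_oneUnitPow]
  | succ n ih =>
    rw [pow_succ, mul_oneUnitPow ((norm_pow_sub_one_le hw n).trans_lt hw) hw, ih, pow_succ]

/-- `1`-units in a field with `p`-th roots are divisible. -/
theorem exists_oneUnit_pow_eq (hroot : ∀ z : C, ∃ y : C, y ^ p = z) {n : ℕ} (hn : n ≠ 0) {w : C}
    (hw : ‖w - 1‖ < 1) : ∃ v : C, ‖v - 1‖ < 1 ∧ v ^ n = w := by
  -- In `n = p ^ k * m`, the factor `p ^ k` is handled by `p`-th roots and `m` by the exponent `1 /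
  -- m ∈ ℤ_p`.
  obtain ⟨k, m, hm, rfl⟩ := Nat.exists_eq_pow_mul_and_not_dvd hn p (Fact.out : p.Prime).ne_one
  have hk : ∀ k, ∃ y : C, y ^ p ^ k = w := by
    intro k
    induction k with
    | zero => exact ⟨w, by simp⟩
    | succ k ih =>
      obtain ⟨y, hy⟩ := ih
      obtain ⟨z, hz⟩ := hroot y
      exact ⟨z, by rw [pow_succ', pow_mul, hz, hy]⟩
  obtain ⟨v, hv⟩ := hk k
  have hv1 : ‖v - 1‖ < 1 := by
    rw [← hv, ← pow_expChar_pow_sub_one (p := p), norm_pow] at hw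
    exact (pow_lt_one_iff_of_nonneg (norm_nonneg _)
      (pow_ne_zero k (Fact.out : p.Prime).ne_zero)).1 hw
  obtain ⟨y, hy⟩ := exists_natCast_mul_eq_one hm
  refine ⟨oneUnitPow p v y, norm_oneUnitPow_sub_one_lt hv1 y, ?_⟩
  rw [mul_comm, pow_mul, ← oneUnitPow_natCast_mul hv1, hy, oneUnitPow_one, hv]

/-- The group of `1`-units is torsion free. -/
theorem oneUnit_eq_one_of_pow_eq_one (p : ℕ) [Fact p.Prime] [CharP C p] {n : ℕ} (hn : n ≠ 0)
    {w : C} (hw : ‖w - 1‖ < 1) (h : w ^ n = 1) : w = 1 := by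
  -- The `p`-part disappears because `(w - 1) ^ p ^ k = w ^ p ^ k - 1`; the part prime to `p` is
  -- inverted in `ℤ_p`.
  obtain ⟨k, m, hm, rfl⟩ := Nat.exists_eq_pow_mul_and_not_dvd hn p (Fact.out : p.Prime).ne_one
  have h1 : w ^ m = 1 := by
    rw [mul_comm, pow_mul, ← sub_eq_zero, ← pow_expChar_pow_sub_one (p := p)] at h
    exact sub_eq_zero.1 (pow_eq_zero_iff (pow_ne_zero k (Fact.out : p.Prime).ne_zero) |>.1 h)
  obtain ⟨y, hy⟩ := exists_natCast_mul_eq_one hm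
  rw [← oneUnitPow_one (p := p) w, ← hy, oneUnitPow_natCast_mul hw, ← pow_oneUnitPow hw, h1,
    one_oneUnitPow]

/-- `p`-th roots exist in the completion of a field with `p`-th roots. -/
theorem UniformSpace.Completion.exists_pow_char_eq (p : ℕ) [Fact p.Prime] (E : Type*)
    [NormedField E] [CharP (UniformSpace.Completion E) p] (hE : ∀ z : E, ∃ y, y ^ p = z)
    (z : UniformSpace.Completion E) : ∃ y, y ^ p = z := by
  have hp : p ≠ 0 := (Fact.out : p.Prime).ne_zero
  have := ExpChar.prime (R := UniformSpace.Completion E) (Fact.out : p.Prime)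
  -- In characteristic `p`, `‖a ^ p - b ^ p‖ = ‖a - b‖ ^ p`, so roots of a convergent sequence form
  -- a Cauchy sequence.
  have hclosed : IsClosed (Set.range fun y : UniformSpace.Completion E => y ^ p) := by
    refine IsSeqClosed.isClosed fun x a hx ha => ?_
    choose y hy using hx
    have hcau : CauchySeq y := by
      refine Metric.cauchySeq_iff.2 fun ε hε => ?_
      obtain ⟨N, hN⟩ := Metric.cauchySeq_iff.1 ha.cauchySeq (ε ^ p) (by positivity)
      refine ⟨N, fun m hm n hn => lt_of_pow_lt_pow_left₀ p hε.le ?_⟩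
      have h := hN m hm n hn
      rw [dist_eq_norm, ← hy, ← hy] at h
      rwa [dist_eq_norm, ← norm_pow, sub_pow_expChar]
    obtain ⟨b, hb⟩ := cauchySeq_tendsto_of_complete hcau
    refine ⟨b, tendsto_nhds_unique (hb.pow p) ?_⟩
    simpa only [hy] using ha
  have hsub : Set.range (fun x : E => (x : UniformSpace.Completion E)) ⊆
      Set.range fun y : UniformSpace.Completion E => y ^ p := by
    rintro _ ⟨x, rfl⟩
    obtain ⟨y, rfl⟩ := hE x
    exact ⟨y, (map_pow (UniformSpace.Completion.coeRingHom (α := E)) y p).symm⟩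
  have h1 := hclosed.closure_subset_iff.2 hsub
  rw [UniformSpace.Completion.denseRange_coe.closure_range] at h1
  exact h1 (Set.mem_univ z)

end OneUnits

/-! ### The field `C_∞` -/

namespace Place

variable {K : Type*} [Field K] (P : Place K)

instance : IsUltrametricDist (AlgebraicClosure P.KInfty) :=
  IsUltrametricDist.isUltrametricDist_of_forall_norm_add_le_max_norm
    fun x y => isNonarchimedean_spectralNorm x y

instance : CompleteSpace P.CInfty :=
  inferInstanceAs (CompleteSpace (UniformSpace.Completion (AlgebraicClosure P.KInfty)))

instance : IsUltrametricDist P.CInfty :=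
  IsUltrametricDist.of_normedAlgebra (L := UniformSpace.Completion (AlgebraicClosure P.KInfty)) (AlgebraicClosure P.KInfty)

theorem norm_toCInfty (x : P.KInfty) : ‖P.toCInfty x‖ = ‖x‖ := by
  refine (UniformSpace.Completion.norm_coe (E := AlgebraicClosure P.KInfty) _).trans ?_
  exact spectralNorm_extends x

variable (p : ℕ)

theorem charP_KInfty [CharP K p] : CharP P.KInfty p := charP_of_injective_ringHom P.toKInfty.injective p

theorem charP_CInfty [CharP K p] : CharP P.CInfty p :=
  charP_of_injective_ringHom (P.toCInfty.comp P.toKInfty).injective p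

theorem exists_pow_char_eq [Fact p.Prime] [CharP K p] (z : P.CInfty) : ∃ y, y ^ p = z := by
  have : CharP (UniformSpace.Completion (AlgebraicClosure P.KInfty)) p := P.charP_CInfty p
  exact UniformSpace.Completion.exists_pow_char_eq p (AlgebraicClosure P.KInfty)
    (fun z => IsAlgClosed.exists_pow_nat_eq z (Fact.out : p.Prime).pos) z

end Place

/-! ### Positive elements and the one-unit part of an ideal -/

section Positive

namespace Place

variable {K : Type*} [Field K] (P : Place K)

theorem exists_abv_eq_zpow {a : K} (ha : a ≠ 0) : ∃ m : ℤ, P.abv a = (P.residueCard : ℝ) ^ m := by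
  set v := IsDiscreteValuationRing.maximalIdeal P.ring
  have h : v.valuation K a ≠ 0 := by simpa using ha
  refine ⟨(WithZero.unzero h).toAdd, ?_⟩
  change (((WithZeroMulInt.toNNReal (zero_lt_one.trans P.one_lt_residueCard).ne'
    (v.valuation K a)) : NNReal) : ℝ) = _
  rw [WithZeroMulInt.toNNReal_neg_apply _ h]
  simp

theorem mem_ring_of_abv_eq_one {c : K} (hc : P.abv c = 1) : c ∈ P.ring := by
  by_contra h
  have hinv := (P.ring.mem_or_inv_mem c).resolve_left h
  have h1 : P.abv c⁻¹ = 1 := by rw [map_inv₀, hc, inv_one]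
  have h2 := ((IsDiscreteValuationRing.maximalIdeal P.ring).adicAbv_coe_eq_one_iff
    P.one_lt_residueCard (K := K) ⟨c⁻¹, hinv⟩).1 h1
  have h3 : IsUnit (⟨c⁻¹, hinv⟩ : P.ring) := by
    by_contra h4
    exact h2 ((IsLocalRing.mem_maximalIdeal _).2 h4)
  obtain ⟨d, hd⟩ := h3.exists_right_inv
  have h4 : (d : K) = c⁻¹⁻¹ := (inv_eq_of_mul_eq_one_right (congrArg Subtype.val hd)).symm
  rw [inv_inv] at h4
  exact h (h4 ▸ d.2)

/-- The residue of `c` is a nonzero element of a finite field with `P.residueCard` elements. -/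
theorem abv_pow_sub_one_lt {c : K} (hc : P.abv c = 1) :
    P.abv (c ^ (P.residueCard - 1) - 1) < 1 := by
  set z : P.ring := ⟨c, P.mem_ring_of_abv_eq_one hc⟩
  refine ((IsDiscreteValuationRing.maximalIdeal P.ring).adicAbv_coe_lt_one_iff
    P.one_lt_residueCard (K := K) (z ^ (P.residueCard - 1) - 1)).2 ?_
  have hz : z ∉ IsLocalRing.maximalIdeal P.ring :=
    ((IsDiscreteValuationRing.maximalIdeal P.ring).adicAbv_coe_eq_one_iff
      P.one_lt_residueCard (K := K) z).1 hc
  change _ ∈ IsLocalRing.maximalIdeal P.ring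
  rw [← IsLocalRing.residue_eq_zero_iff] at hz ⊢
  have := Fintype.ofFinite (IsLocalRing.ResidueField P.ring)
  rw [map_sub, map_pow, map_one, residueCard, Nat.card_eq_fintype_card,
    FiniteField.pow_card_sub_one_eq_one _ hz, sub_self]

/-- A power of every nonzero element of `K` is positive. -/
theorem exists_pow_eq_zpow_mul {u : P.KInfty} (hu : P.IsUniformizer u) {a : K} (ha : a ≠ 0) :
    ∃ (m : ℤ) (γ : P.KInfty), ‖γ - 1‖ < 1 ∧ P.toKInfty a ^ (P.residueCard - 1) = u ^ m * γ := by
  obtain ⟨k, hk⟩ := P.exists_abv_eq_zpow ha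
  have hr : (P.residueCard : ℝ) ≠ 0 := by
    have := P.one_lt_residueCard
    exact_mod_cast (zero_lt_one.trans this).ne'
  have hu0 : u ≠ 0 := by
    rintro rfl
    rw [IsUniformizer, norm_zero, eq_comm, inv_eq_zero] at hu
    exact hr hu
  set b := P.toKInfty a * u ^ k with hb
  have hb1 : ‖b‖ = 1 := by
    rw [hb, norm_mul, norm_zpow, norm_toKInfty, hk, hu, inv_zpow, mul_inv_cancel₀]
    exact zpow_ne_zero _ hr
  -- By density the residue of the unit `b` is represented in `K`, where the residue field is known
  -- to be finite; then `b / c` and `c ^ (P.residueCard - 1)` are both `1`-units.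
  obtain ⟨c, hc⟩ : ∃ c : K, ‖b - P.toKInfty c‖ < 1 := by
    obtain ⟨c, hc⟩ := Metric.denseRange_iff.1
      (UniformSpace.Completion.denseRange_coe (α := WithAbs P.abv)) b 1 one_pos
    exact ⟨WithAbs.equiv P.abv c, by rwa [dist_eq_norm] at hc⟩
  have hc1 : ‖P.toKInfty c‖ = 1 := by
    have := IsUltrametricDist.norm_eq_of_add_norm_lt_max (x := -P.toKInfty c) (y := b)
      (by rw [hb1, neg_add_eq_sub]; exact hc.trans_le (le_max_right _ _))
    rwa [norm_neg, hb1] at this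
  have hc0 : P.toKInfty c ≠ 0 := by rw [← norm_ne_zero_iff, hc1]; exact one_ne_zero
  refine ⟨-k * (P.residueCard - 1 : ℕ), b ^ (P.residueCard - 1), ?_, ?_⟩
  · have h1 : ‖b / P.toKInfty c - 1‖ < 1 := by
      rw [div_sub_one hc0, norm_div, hc1, div_one]
      exact hc
    have h2 : ‖P.toKInfty c ^ (P.residueCard - 1) - 1‖ < 1 := by
      rw [← map_pow, ← map_one P.toKInfty, ← map_sub, norm_toKInfty]
      exact P.abv_pow_sub_one_lt (by rw [← norm_toKInfty, hc1])
    have h3 := norm_mul_sub_one_lt ((norm_pow_sub_one_le h1 (P.residueCard - 1)).trans_lt h1) h2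
    rwa [← mul_pow, div_mul_cancel₀ _ hc0] at h3
  · rw [hb, mul_pow, ← zpow_natCast (u ^ k), ← zpow_mul, mul_left_comm, ← zpow_add₀ hu0]
    simp

end Place

section Extension

variable {Fq K : Type*} [Field Fq] [Finite Fq] [Field K] [Algebra Fq K]
  (P : Place K)

theorem oneUnit_pow_left_injective {C : Type*} [NormedField C] [CompleteSpace C]
    [IsUltrametricDist C] (p : ℕ) [Fact p.Prime] [CharP C p] {n : ℕ} (hn : n ≠ 0) {v w : C}
    (hv : ‖v - 1‖ < 1) (hw : ‖w - 1‖ < 1) (h : v ^ n = w ^ n) : v = w := by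
  have hw0 : w ≠ 0 := by
    rw [← norm_ne_zero_iff, norm_eq_one_of_norm_sub_one_lt hw]; exact one_ne_zero
  have := oneUnit_eq_one_of_pow_eq_one p hn (w := v * w⁻¹)
    (norm_mul_sub_one_lt hv (norm_inv_sub_one_lt hw))
    (by rw [mul_pow, h, inv_pow, mul_inv_cancel₀ (pow_ne_zero n hw0)])
  exact (mul_inv_eq_one₀ hw0).1 this

/-- The `1`-unit part of a positive generator depends only on the ideal. -/
theorem oneUnit_eq_of_span_eq (hK : IsCurveFunctionField Fq K) (p : ℕ) [Fact p.Prime] [CharP K p]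
    {u : P.KInfty} (hu : P.IsUniformizer u) {a a' : regularRing Fq P}
    (h : Ideal.span {a} = Ideal.span {a'}) {m m' : ℤ} {γ γ' : P.KInfty}
    (hγ : ‖γ - 1‖ < 1) (hγ' : ‖γ' - 1‖ < 1) (h1 : P.toKInfty (a : K) = u ^ m * γ)
    (h2 : P.toKInfty (a' : K) = u ^ m' * γ') : γ = γ' := by
  have := P.charP_KInfty p
  obtain ⟨ε, rfl⟩ := Ideal.span_singleton_eq_span_singleton.1 h
  have := hK.finite_units_regularRing P
  -- Two generators differ by a unit of `A`, whose `n`-th power is `1`. The `n`-th powers of the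
  -- generators then agree, norms give `m = m'`, and torsion-freeness of the `1`-units does the
  -- rest.
  set n := Nat.card (regularRing Fq P)ˣ
  have hn : n ≠ 0 := Nat.card_pos.ne'
  have hr1 : (1 : ℝ) < P.residueCard := by exact_mod_cast P.one_lt_residueCard
  have hu1 : ‖u‖ < 1 := by rw [hu]; exact inv_lt_one_of_one_lt₀ hr1
  have hu0 : 0 < ‖u‖ := by rw [hu]; positivity
  have hε : P.toKInfty ((ε : regularRing Fq P) : K) ^ n = 1 := by
    have : ε ^ n = 1 := pow_card_eq_one'
    rw [← map_pow, ← SubmonoidClass.coe_pow, ← Units.val_pow_eq_pow_val, this]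
    simp
  have h3 : (u ^ m * γ) ^ n = (u ^ m' * γ') ^ n := by
    rw [← h1, ← h2, MulMemClass.coe_mul, map_mul, mul_pow, hε, mul_one]
  have h4 : m = m' := by
    have := congrArg norm h3
    rw [norm_pow, norm_pow, norm_mul, norm_mul, norm_eq_one_of_norm_sub_one_lt hγ,
      norm_eq_one_of_norm_sub_one_lt hγ', mul_one, mul_one, pow_left_inj₀ (norm_nonneg _)
      (norm_nonneg _) hn, norm_zpow, norm_zpow] at this
    exact zpow_right_injective₀ hu0 hu1.ne this
  subst h4
  refine oneUnit_pow_left_injective p hn hγ hγ' ?_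
  rw [mul_pow, mul_pow] at h3
  exact mul_left_cancel₀ (pow_ne_zero n (zpow_ne_zero m (norm_pos_iff.1 hu0))) h3

theorem exists_pow_eq_span_of_mk0_pow_eq_one {R : Type*} [CommRing R] [IsDedekindDomain R]
    {I : Ideal R} (hI : I ∈ (Ideal R)⁰) {c : ℕ} (h : ClassGroup.mk0 ⟨I, hI⟩ ^ c = 1) :
    ∃ a : R, I ^ c = Ideal.span {a} := by
  rw [← map_pow] at h
  obtain ⟨a, ha⟩ := (ClassGroup.mk0_eq_one_iff (pow_mem hI c)).1 h
  exact ⟨a, ha⟩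

theorem exists_pow_eq_one_of_finite (G : Type*) [Group G] [Finite G] :
    ∃ c : ℕ, c ≠ 0 ∧ ∀ g : G, g ^ c = 1 :=
  ⟨Nat.card G, Nat.card_pos.ne', fun _ => pow_card_eq_one'⟩

theorem exists_pow_eq_span_of_finite_classGroup (R : Type*) [CommRing R] [IsDedekindDomain R]
    [Finite (ClassGroup R)] :
    ∃ c : ℕ, c ≠ 0 ∧ ∀ I : (Ideal R)⁰, ∃ a : R, (I : Ideal R) ^ c = Ideal.span {a} := by
  obtain ⟨c, hc, h⟩ := exists_pow_eq_one_of_finite (ClassGroup R)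
  exact ⟨c, hc, fun I => exists_pow_eq_span_of_mk0_pow_eq_one I.2 (h _)⟩

/-- A common power of all ideals is generated by a positive element. -/
theorem exists_pow_eq_span (hK : IsCurveFunctionField Fq K) {u : P.KInfty}
    (hu : P.IsUniformizer u) : ∃ n : ℕ, n ≠ 0 ∧ ∀ I : (Ideal (regularRing Fq P))⁰,
      ∃ (a : regularRing Fq P) (m : ℤ) (γ : P.KInfty),
        (I : Ideal (regularRing Fq P)) ^ n = Ideal.span {a} ∧ ‖γ - 1‖ < 1 ∧
          P.toKInfty (a : K) = u ^ m * γ := by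
  have := hK.isDedekindDomain_regularRing P
  have := hK.finite_classGroup_regularRing P
  have hr1 : 1 < P.residueCard := by exact_mod_cast P.one_lt_residueCard
  obtain ⟨c, hc0, hc⟩ := exists_pow_eq_span_of_finite_classGroup (regularRing Fq P)
  -- The exponent `c` makes every ideal principal; the factor `P.residueCard - 1` makes the
  -- generator positive.
  refine ⟨c * (P.residueCard - 1), mul_ne_zero hc0 (by omega), fun I => ?_⟩
  obtain ⟨a, ha⟩ := hc I
  have ha0 : (a : K) ≠ 0 := by
    intro h0
    rw [show a = 0 from Subtype.ext h0, Ideal.span_singleton_eq_bot.2 rfl] at ha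
    exact nonZeroDivisors.coe_ne_zero I (pow_eq_zero_iff hc0 |>.1 ha)
  obtain ⟨m, γ, hγ, h1⟩ := P.exists_pow_eq_zpow_mul hu ha0
  refine ⟨a ^ (P.residueCard - 1), m, γ, ?_, hγ, ?_⟩
  · rw [pow_mul, ← Ideal.span_singleton_pow, ha]
  · rw [SubmonoidClass.coe_pow, map_pow, h1]

/-- The `1`-unit parts of ideals are given by a unique extension of the `1`-unit parts of
positive elements. -/
theorem existsUnique_isOneUnitExtension (hK : IsCurveFunctionField Fq K) (p : ℕ) [Fact p.Prime]
    [CharP Fq p] {u : P.KInfty} (hu : P.IsUniformizer u) :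
    ∃! χ, IsOneUnitExtension Fq P u χ := by
  have : CharP K p := charP_of_injective_algebraMap (algebraMap Fq K).injective p
  have := P.charP_CInfty p
  have := hK.isDedekindDomain_regularRing P
  obtain ⟨n, hn, hI⟩ := exists_pow_eq_span P hK hu
  choose a m γ ha hγ hm using hI
  have hC : ∀ γ : P.KInfty, ‖γ - 1‖ < 1 → ‖P.toCInfty γ - 1‖ < 1 := fun γ h => by
    rwa [← map_one P.toCInfty, ← map_sub, P.norm_toCInfty]
  -- The value at `I` is forced: it is the only `1`-unit whose `n`-th power is the `1`-unit part of
  -- a positive generator of `I ^ n`. Every property of `v` is checked on `n`-th powers.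
  choose v hv hvn using fun I =>
    exists_oneUnit_pow_eq (p := p) (P.exists_pow_char_eq p) hn (hC (γ I) (hγ I))
  have hmul : ∀ I J, v (I * J) = v I * v J := fun I J => by
    refine oneUnit_pow_left_injective p hn (hv _) (norm_mul_sub_one_lt (hv I) (hv J)) ?_
    rw [mul_pow, hvn, hvn, hvn, ← map_mul]
    congr 1
    refine oneUnit_eq_of_span_eq P hK p hu (a' := a I * a J) ?_ (hγ _)
      (norm_mul_sub_one_lt (hγ I) (hγ J)) (hm _) (m' := m I + m J) ?_
    · rw [← ha, ← Ideal.span_singleton_mul_span_singleton, ← ha, ← ha, Submonoid.coe_mul, mul_pow]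
    · have hu0 : u ≠ 0 := by
        rintro rfl
        rw [Place.IsUniformizer, norm_zero, eq_comm, inv_eq_zero] at hu
        have := P.one_lt_residueCard
        exact (zero_lt_one.trans this).ne' (by exact_mod_cast hu)
      rw [MulMemClass.coe_mul, map_mul, hm, hm, zpow_add₀ hu0]
      ring
  have hone : v 1 = 1 := by
    have h := hmul 1 1
    rw [one_mul] at h
    have h0 : v 1 ≠ 0 := by
      rw [← norm_ne_zero_iff, norm_eq_one_of_norm_sub_one_lt (hv 1)]; exact one_ne_zero
    exact (mul_eq_left₀ h0).1 h.symm
  refine ⟨⟨⟨v, hone⟩, hmul⟩, ⟨hv, fun I b k δ hb hδ hk => ?_⟩, fun χ hχ => ?_⟩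
  · refine oneUnit_pow_left_injective p hn (hv I) (hC δ hδ) ((hvn I).trans ?_)
    rw [← map_pow]
    congr 1
    refine oneUnit_eq_of_span_eq P hK p hu (a' := b ^ n) ?_ (hγ _)
      ((norm_pow_sub_one_le hδ n).trans_lt hδ) (hm _) (m' := k * n) ?_
    · rw [← ha, hb, Ideal.span_singleton_pow]
    · rw [SubmonoidClass.coe_pow, map_pow, hk, mul_pow, zpow_mul, zpow_natCast]
  · ext I
    refine oneUnit_pow_left_injective p hn (hχ.1 I) (hv I) ?_
    rw [← map_pow]
    exact (hχ.2 (I ^ n) (a I) (m I) (γ I) (by rw [← ha]; rfl) (hγ I) (hm I)).trans (hvn I).symm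

theorem isOneUnitExtension_oneUnitPart (hK : IsCurveFunctionField Fq K) (p : ℕ) [Fact p.Prime]
    [CharP Fq p] {u : P.KInfty} (hu : P.IsUniformizer u) :
    IsOneUnitExtension Fq P u (oneUnitPart Fq P u) :=
  Classical.epsilon_spec (existsUnique_isOneUnitExtension P hK p hu).exists

end Extension

end Positive

/-! ### Matched lattices and the scaling action -/

section Lattices

open scoped Pointwise

variable {A K : Type*} [CommRing A] [Field K] [Algebra A K]

namespace KLattice

theorem Rel.smul {L : KLattice A K} {x y : K} (h : L.Rel x y) (a : A) : L.Rel (a • x) (a • y) := by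
  unfold Rel at *
  rw [Submodule.Quotient.mk_smul, map_smul, h, Submodule.Quotient.mk_smul]

theorem Rel.sub_mem {L : KLattice A K} {x y y' : K} (h : L.Rel x y) (h' : L.Rel x y') :
    y - y' ∈ L.Λ :=
  (Submodule.Quotient.eq _).1 (h.symm.trans h')

theorem Rel.congr {L : KLattice A K} {x y y' : K} (h : L.Rel x y) (h' : y - y' ∈ L.Λ) :
    L.Rel x y' :=
  Eq.trans h ((Submodule.Quotient.eq _).2 h')

theorem exists_rel (L : KLattice A K) (x : K) : ∃ y, L.Rel x y := by
  obtain ⟨y, hy⟩ := Submodule.Quotient.mk_surjective _ (L.φ (Submodule.Quotient.mk x))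
  exact ⟨y, hy.symm⟩

theorem rel_zero {L : KLattice A K} {x : K} (hx : x ∈ (1 : Submodule A K)) : L.Rel x 0 := by
  unfold Rel
  rw [(Submodule.Quotient.mk_eq_zero _).2 hx, map_zero, Submodule.Quotient.mk_zero]

theorem rel_zero_iff {L : KLattice A K} {y : K} : L.Rel 0 y ↔ y ∈ L.Λ := by
  unfold Rel
  rw [Submodule.Quotient.mk_zero, map_zero, eq_comm, Submodule.Quotient.mk_eq_zero]

/-- `Rel` is the graph of `φ` lifted to `K × K`, and its fibre over `0` is `Λ`. Lattices can thus be
compared without transport between the quotients `K / Λ`. -/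
theorem ext_of_rel {L L' : KLattice A K} (h : ∀ x y, L.Rel x y ↔ L'.Rel x y) : L = L' := by
  obtain ⟨Λ, h1, h2, φ⟩ := L
  obtain ⟨Λ', h1', h2', φ'⟩ := L'
  obtain rfl : Λ = Λ' := by
    ext y
    have := h 0 y
    rwa [rel_zero_iff, rel_zero_iff] at this
  congr 1
  ext x
  obtain ⟨y, hy⟩ := exists_rel ⟨Λ, h1, h2, φ⟩ x
  exact Eq.trans hy ((h x y).1 hy).symm

theorem ext_of_rel_imp {L L' : KLattice A K} (hΛ : L'.Λ ≤ L.Λ)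
    (h : ∀ x y, L.Rel x y → L'.Rel x y) : L = L' := by
  refine ext_of_rel fun x y => ⟨h x y, fun h' => ?_⟩
  obtain ⟨z, hz⟩ := L.exists_rel x
  exact hz.congr (hΛ ((h x z hz).sub_mem h'))

/-- The scaling action of `K^*`. -/
instance : SMul Kˣ (KLattice A K) where
  smul γ L :=
    { Λ := γ • L.Λ
      fg := L.fg.map _
      ne_bot := fun h => L.ne_bot (by
        rw [← inv_smul_smul γ L.Λ, h]; exact Submodule.smul_bot' _)
      φ := (Submodule.Quotient.equiv L.Λ (γ • L.Λ) (DistribMulAction.toLinearEquiv A K γ) rfl :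
        (K ⧸ L.Λ) →ₗ[A] (K ⧸ γ • L.Λ)) ∘ₗ L.φ }

theorem smul_Λ (γ : Kˣ) (L : KLattice A K) : (γ • L).Λ = γ • L.Λ := rfl

theorem Rel.units_smul {L : KLattice A K} {x y : K} (h : L.Rel x y) (γ : Kˣ) :
    (γ • L).Rel x (γ * y) := by
  change Submodule.Quotient.equiv L.Λ (γ • L.Λ) _ rfl (L.φ (Submodule.Quotient.mk x)) = _
  rw [h]
  rfl

theorem mem_units_smul_iff {γ : Kˣ} {Λ : Submodule A K} {z : K} :
    z ∈ γ • Λ ↔ (γ : K)⁻¹ * z ∈ Λ := by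
  constructor
  · rintro ⟨w, hw, rfl⟩
    change (γ : K)⁻¹ * (γ * w) ∈ Λ
    rwa [inv_mul_cancel_left₀ γ.ne_zero]
  · intro h
    exact ⟨_, h, by change (γ : K) * _ = z; simp⟩

theorem units_smul_rel_iff {γ : Kˣ} {L : KLattice A K} {x y : K} :
    (γ • L).Rel x y ↔ L.Rel x ((γ : K)⁻¹ * y) := by
  refine ⟨fun h => ?_, fun h => by simpa using h.units_smul γ⟩
  obtain ⟨z, hz⟩ := L.exists_rel x
  refine hz.congr ?_
  have := h.sub_mem (hz.units_smul γ)
  rw [smul_Λ, mem_units_smul_iff, mul_sub, inv_mul_cancel_left₀ γ.ne_zero] at this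
  rw [← neg_sub]
  exact neg_mem this

instance : MulAction Kˣ (KLattice A K) where
  one_smul L := ext_of_rel fun x y => by simp [units_smul_rel_iff]
  mul_smul γ δ L := ext_of_rel fun x y => by simp [units_smul_rel_iff, mul_assoc]

theorem isScaling_iff {γ : Kˣ} {L L' : KLattice A K} : IsScaling γ L L' ↔ L' = γ • L := by
  constructor
  · rintro ⟨-, h⟩
    exact ext_of_rel fun x y => by rw [units_smul_rel_iff, h]; simp
  · rintro rfl
    exact ⟨fun z => by simp [smul_Λ, mem_units_smul_iff], fun x y => by simp [units_smul_rel_iff]⟩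

theorem mk_eq_mk_iff {L L' : KLattice A K} :
    (⟦L⟧ : LatticeClass A K) = ⟦L'⟧ ↔ ∃ γ : Kˣ, L' = γ • L := by
  rw [Quotient.eq]
  exact exists_congr fun γ => isScaling_iff

theorem mk_smul (γ : Kˣ) (L : KLattice A K) : (⟦γ • L⟧ : LatticeClass A K) = ⟦L⟧ :=
  (mk_eq_mk_iff.2 ⟨γ, rfl⟩).symm

theorem Matched.smul {L L' : KLattice A K} (h : L.Matched L') (γ : Kˣ) :
    (γ • L).Matched (γ • L') := fun x y y' hy hy' => by
  rw [units_smul_rel_iff] at hy hy'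
  obtain ⟨a, ha, b, hb, hab⟩ := Submodule.mem_sup.1 (h _ _ _ hy hy')
  refine Submodule.mem_sup.2 ⟨γ • a, Submodule.smul_mem_pointwise_smul _ _ _ ha, γ • b,
    Submodule.smul_mem_pointwise_smul _ _ _ hb, ?_⟩
  rw [← smul_add, hab, ← mul_sub]
  exact mul_inv_cancel_left₀ γ.ne_zero _

theorem Matched.symm {L L' : KLattice A K} (h : L.Matched L') : L'.Matched L :=
  fun x y y' hy hy' => by
    rw [sup_comm, ← neg_sub]
    exact neg_mem (h x y' y hy' hy)

/-- The discrepancy of `φ` and `φ'` lies in `Λ + Λ'`, and `d` pushes its `Λ`-part into `Λ'`. -/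
theorem Matched.rel {L L' : KLattice A K} (h : L.Matched L') {d : A}
    (hd : ∀ z ∈ L.Λ, d • z ∈ L'.Λ) {x y : K} (hxy : L.Rel x y) : L'.Rel (d • x) (d • y) := by
  obtain ⟨y', hy'⟩ := L'.exists_rel x
  refine (hy'.smul d).congr ?_
  rw [← smul_sub, ← neg_sub, smul_neg]
  refine neg_mem ?_
  obtain ⟨a, ha, b, hb, hab⟩ := Submodule.mem_sup.1 (h x y y' hxy hy')
  rw [← hab, smul_add]
  exact add_mem (hd a ha) (L'.Λ.smul_mem d hb)

theorem Matched.rel_of_le {L L' : KLattice A K} (h : L.Matched L') (hle : L.Λ ≤ L'.Λ) {x y : K}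
    (hxy : L.Rel x y) : L'.Rel x y := by
  simpa using h.rel (d := 1) (fun z hz => by simpa using hle hz) hxy

theorem Matched.eq {L L' : KLattice A K} (h : L.Matched L') (hΛ : L.Λ = L'.Λ) : L = L' :=
  ext_of_rel_imp hΛ.ge fun _ _ => h.rel_of_le hΛ.le

section FractionRing

variable [IsFractionRing A K]

/-- `K` is divisible: if `z` represents `φ(x / d)`, then `d • z` represents both `φ(x)` and `φ'(x)`.
-/
theorem matched_of_rel {L L' : KLattice A K} {d : A} (hd : d ≠ 0)
    (h : ∀ x y, L.Rel x y → L'.Rel (d • x) (d • y)) : L.Matched L' := fun x y y' hy hy' => by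
  have hd' : algebraMap A K d ≠ 0 := by simpa using hd
  have hx : d • ((algebraMap A K d)⁻¹ * x) = x := by
    rw [Algebra.smul_def, mul_inv_cancel_left₀ hd']
  obtain ⟨z, hz⟩ := L.exists_rel ((algebraMap A K d)⁻¹ * x)
  have h1 := hz.smul d
  have h2 := h _ _ hz
  rw [hx] at h1 h2
  exact Submodule.mem_sup.2 ⟨_, hy.sub_mem h1, _, h2.sub_mem hy', by ring⟩

variable [IsDomain A]

theorem exists_smul_mem {Λ Λ' : Submodule A K} (h : Λ.FG) (h' : Λ' ≠ ⊥) :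
    ∃ d : A, d ≠ 0 ∧ ∀ z ∈ Λ, d • z ∈ Λ' := by
  obtain ⟨w, hw, hw0⟩ := Λ'.ne_bot_iff.1 h'
  have : IsFractional A⁰ (Submodule.map (LinearMap.mulLeft A w⁻¹) Λ) :=
    FractionalIdeal.isFractional_of_fg (h.map _)
  obtain ⟨d, hd, hz⟩ := this
  refine ⟨d, nonZeroDivisors.ne_zero hd, fun z hz' => ?_⟩
  obtain ⟨a, ha⟩ := hz _ (Submodule.mem_map_of_mem hz')
  rw [LinearMap.mulLeft_apply] at ha
  rw [show d • z = a • w by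
    rw [Algebra.smul_def a, ha, smul_mul_assoc, mul_right_comm, inv_mul_cancel₀ hw0, one_mul]]
  exact Λ'.smul_mem a hw

/-- Two lattices are matched if and only if multiplication by some `d ≠ 0` is compatible with
`φ` and `φ'`. -/
theorem matched_iff {L L' : KLattice A K} :
    L.Matched L' ↔ ∃ d : A, d ≠ 0 ∧ ∀ x y, L.Rel x y → L'.Rel (d • x) (d • y) := by
  constructor
  · intro h
    obtain ⟨d, hd, hd'⟩ := exists_smul_mem L.fg L'.ne_bot
    exact ⟨d, hd, fun x y hxy => h.rel hd' hxy⟩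
  · rintro ⟨d, hd, h⟩
    exact matched_of_rel hd h

/-- Comparing values directly only gives agreement modulo `Λ + Λ' + Λ''`; the multipliers of
`matched_iff`, on the other hand, compose. -/
theorem Matched.trans {L L' L'' : KLattice A K} (h : L.Matched L') (h' : L'.Matched L'') :
    L.Matched L'' := by
  obtain ⟨d, hd, h1⟩ := matched_iff.1 h
  obtain ⟨d', hd', h2⟩ := matched_iff.1 h'
  exact matched_of_rel (mul_ne_zero hd' hd) fun x y hxy => by
    rw [mul_smul, mul_smul]
    exact h2 _ _ (h1 _ _ hxy)

/-- For `z ∈ Λ` choose `x` with `φ(x) = z / d`. Then `φ(d x) = 0`, so `d x ∈ A` by injectivity, and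
`φ'(d x)`, which is the class of `z`, vanishes. -/
theorem IsInvertible.le_of_matched {L L' : KLattice A K} (hL : L.IsInvertible)
    (h : L.Matched L') : L.Λ ≤ L'.Λ := fun z hz => by
  obtain ⟨d, hd, h1⟩ := matched_iff.1 h
  have hd' : algebraMap A K d ≠ 0 := by simpa using hd
  obtain ⟨x, hx⟩ := hL.2 (Submodule.Quotient.mk ((algebraMap A K d)⁻¹ * z))
  obtain ⟨x, rfl⟩ := Submodule.Quotient.mk_surjective _ x
  have h2 : L.Rel x ((algebraMap A K d)⁻¹ * z) := hx
  have h3 := h2.smul d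
  have h4 := h1 _ _ h2
  rw [Algebra.smul_def d ((algebraMap A K d)⁻¹ * z), mul_inv_cancel_left₀ hd'] at h3 h4
  have h5 : d • x ∈ (1 : Submodule A K) := by
    rw [← Submodule.Quotient.mk_eq_zero]
    apply hL.1
    rw [map_zero, h3, Submodule.Quotient.mk_eq_zero]
    exact hz
  simpa using h4.sub_mem (rel_zero h5)

end FractionRing

end KLattice

end Lattices

/-! ### Lattice modules as fractional ideals -/

section LatticeIdeals

open scoped Pointwise

variable {A K : Type*} [CommRing A] [Field K] [Algebra A K]

/-- Moves the action of ideals on lattice modules into the fractional ideals, where nonzero elements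
can be cancelled and inverted. -/
theorem ideal_smul_fractionalIdeal (J : Ideal A) (M : FractionalIdeal A⁰ K) :
    J • (M : Submodule A K) = ((J * M : FractionalIdeal A⁰ K) : Submodule A K) := by
  rw [FractionalIdeal.coe_mul, FractionalIdeal.coe_coeIdeal]
  apply le_antisymm
  · refine Submodule.smul_le.2 fun r hr n hn => ?_
    rw [Algebra.smul_def]
    exact Submodule.mul_mem_mul (Submodule.mem_map_of_mem hr) hn
  · refine Submodule.mul_le.2 ?_
    rintro _ ⟨r, hr, rfl⟩ n hn
    rw [Algebra.linearMap_apply, ← Algebra.smul_def]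
    exact Submodule.smul_mem_smul hr hn

theorem units_smul_ideal_smul (γ : Kˣ) (J : Ideal A) (Λ : Submodule A K) :
    γ • J • Λ = J • γ • Λ :=
  Submodule.map_smul'' J Λ (DistribSMul.toLinearMap A K γ)

variable [IsFractionRing A K]

theorem exists_fractionalIdeal_eq {Λ : Submodule A K} (h : Λ.FG) (h0 : Λ ≠ ⊥) :
    ∃ M : FractionalIdeal A⁰ K, M ≠ 0 ∧ (M : Submodule A K) = Λ :=
  ⟨⟨Λ, FractionalIdeal.isFractional_of_fg h⟩, fun h' => h0 (by
    have := congrArg (fun M : FractionalIdeal A⁰ K => (M : Submodule A K)) h'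
    simpa using this), rfl⟩

variable [IsDedekindDomain A]

theorem coeIdeal_ne_zero_of_mem (J : (Ideal A)⁰) : ((J : Ideal A) : FractionalIdeal A⁰ K) ≠ 0 :=
  FractionalIdeal.coeIdeal_ne_zero.2 (nonZeroDivisors.ne_zero J.2)

theorem exists_ideal_smul_eq {Λ Λ' : Submodule A K} (h : Λ.FG) (h0 : Λ ≠ ⊥) (h' : Λ'.FG)
    (hle : Λ ≤ Λ') : ∃ J : (Ideal A)⁰, (J : Ideal A) • Λ' = Λ := by
  obtain ⟨M, hM, rfl⟩ := exists_fractionalIdeal_eq h h0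
  obtain ⟨M', hM', rfl⟩ := exists_fractionalIdeal_eq h' fun h' => h0 (le_bot_iff.1 (h' ▸ hle))
  have h1 : M * M'⁻¹ ≤ 1 := by
    rw [← mul_inv_cancel₀ hM']
    exact mul_le_mul_left (show M ≤ M' from hle) _
  obtain ⟨J, hJ⟩ := FractionalIdeal.le_one_iff_exists_coeIdeal.1 h1
  have h2 : (J : FractionalIdeal A⁰ K) ≠ 0 := hJ ▸ mul_ne_zero hM (inv_ne_zero hM')
  refine ⟨⟨J, mem_nonZeroDivisors_of_ne_zero (FractionalIdeal.coeIdeal_ne_zero.1 h2)⟩, ?_⟩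
  rw [ideal_smul_fractionalIdeal, hJ, inv_mul_cancel_right₀ hM']

theorem ideal_smul_left_inj {Λ : Submodule A K} (h : Λ.FG) (h0 : Λ ≠ ⊥) {J J' : Ideal A} :
    J • Λ = J' • Λ ↔ J = J' := by
  obtain ⟨M, hM, rfl⟩ := exists_fractionalIdeal_eq h h0
  rw [ideal_smul_fractionalIdeal, ideal_smul_fractionalIdeal,
    FractionalIdeal.coeToSubmodule_inj, mul_left_inj' hM, FractionalIdeal.coeIdeal_inj]

theorem exists_ideal_smul_eq_of_ideal {Λ : Submodule A K} (h : Λ.FG) (h0 : Λ ≠ ⊥)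
    (J : (Ideal A)⁰) : ∃ Λ' : Submodule A K, Λ'.FG ∧ Λ' ≠ ⊥ ∧ (J : Ideal A) • Λ' = Λ := by
  obtain ⟨M, hM, rfl⟩ := exists_fractionalIdeal_eq h h0
  have hJ := coeIdeal_ne_zero_of_mem (K := K) J
  have h1 : ((J : Ideal A) : FractionalIdeal A⁰ K)⁻¹ * M ≠ 0 := mul_ne_zero (inv_ne_zero hJ) hM
  refine ⟨_, FractionalIdeal.fg_of_isUnit _ h1.isUnit, ?_, ?_⟩
  · rwa [Ne, FractionalIdeal.coeToSubmodule_eq_bot]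
  · rw [ideal_smul_fractionalIdeal, mul_inv_cancel_left₀ hJ]

theorem ideal_smul_right_inj {Λ Λ' : Submodule A K} (h : Λ.FG) (h0 : Λ ≠ ⊥) (h' : Λ'.FG)
    (h0' : Λ' ≠ ⊥) (J : (Ideal A)⁰) : (J : Ideal A) • Λ = (J : Ideal A) • Λ' ↔ Λ = Λ' := by
  obtain ⟨M, hM, rfl⟩ := exists_fractionalIdeal_eq h h0
  obtain ⟨M', hM', rfl⟩ := exists_fractionalIdeal_eq h' h0'
  rw [ideal_smul_fractionalIdeal, ideal_smul_fractionalIdeal,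
    FractionalIdeal.coeToSubmodule_inj, mul_right_inj' (coeIdeal_ne_zero_of_mem J),
    FractionalIdeal.coeToSubmodule_inj]

theorem exists_ideal_smul_eq_ideal_smul {Λ Λ' : Submodule A K} (h : Λ.FG) (h0 : Λ ≠ ⊥)
    (h' : Λ'.FG) (h0' : Λ' ≠ ⊥) :
    ∃ I J : (Ideal A)⁰, (I : Ideal A) • Λ = (J : Ideal A) • Λ' := by
  obtain ⟨d, hd, hd'⟩ := KLattice.exists_smul_mem h h0'
  let I : (Ideal A)⁰ := ⟨Ideal.span {d}, mem_nonZeroDivisors_of_ne_zero (by simpa using hd)⟩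
  have hle : (I : Ideal A) • Λ ≤ Λ' := by
    rw [Submodule.ideal_span_singleton_smul]
    rintro _ ⟨z, hz, rfl⟩
    exact hd' z hz
  have hne : (I : Ideal A) • Λ ≠ ⊥ := by
    obtain ⟨M, hM, rfl⟩ := exists_fractionalIdeal_eq h h0
    rw [ideal_smul_fractionalIdeal, Ne, FractionalIdeal.coeToSubmodule_eq_bot]
    exact mul_ne_zero (coeIdeal_ne_zero_of_mem I) hM
  have hfg : ((I : Ideal A) • Λ).FG := by
    rw [Submodule.ideal_span_singleton_smul]
    exact h.map _
  obtain ⟨J, hJ⟩ := exists_ideal_smul_eq hfg hne h' hle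
  exact ⟨I, J, hJ.symm⟩

theorem ideal_mul_eq_of_smul_eq {Λ Λ' : Submodule A K} (h : Λ.FG) (h0 : Λ ≠ ⊥) {I J I' J' : (Ideal A)⁰} (h1 : (I : Ideal A) • Λ = (J : Ideal A) • Λ')
    (h2 : (I' : Ideal A) • Λ = (J' : Ideal A) • Λ') : I * J' = I' * J := by
  refine Subtype.ext ((ideal_smul_left_inj h h0).1 ?_)
  rw [Submonoid.coe_mul, Submonoid.coe_mul, mul_comm, mul_comm (I' : Ideal A), Submodule.mul_smul,
    Submodule.mul_smul, h1, h2, ← Submodule.mul_smul, ← Submodule.mul_smul, mul_comm]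

/-- The set is empty or a coset of the stabilizer of `Λ`. A scalar preserving a finitely generated
nonzero module is integral over `A`, so the stabilizer consists of units of `A`. -/
theorem finite_setOf_units_smul_eq [Finite Aˣ] {Λ : Submodule A K} (h : Λ.FG) (h0 : Λ ≠ ⊥)
    (Λ' : Submodule A K) : {γ : Kˣ | γ • Λ = Λ'}.Finite := by
  rcases Set.eq_empty_or_nonempty {γ : Kˣ | γ • Λ = Λ'} with he | ⟨γ₀, h₀⟩
  · rw [he]; exact Set.finite_empty
  have hint : ∀ γ : Kˣ, γ • Λ = Λ → (γ : K) ∈ (algebraMap A K).range := fun γ hγ => by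
    have hi : IsIntegral A (γ : K) := by
      refine isIntegral_of_smul_mem_submodule (M := K) Λ h0 h _ fun z hz => ?_
      exact hγ.le (Submodule.smul_mem_pointwise_smul z γ Λ hz)
    obtain ⟨a, ha⟩ := IsIntegrallyClosed.isIntegral_iff.1 hi
    exact ⟨a, ha⟩
  refine ((Set.finite_range fun a : Aˣ => γ₀ * Units.map (algebraMap A K).toMonoidHom a)).subset ?_
  intro γ hγ
  have h1 : (γ₀⁻¹ * γ) • Λ = Λ := by
    rw [mul_smul, show γ • Λ = Λ' from hγ, ← show γ₀ • Λ = Λ' from h₀, inv_smul_smul]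
  have h2 : (γ₀⁻¹ * γ)⁻¹ • Λ = Λ := by rw [inv_smul_eq_iff, h1]
  obtain ⟨a, ha⟩ := hint _ h1
  obtain ⟨b, hb⟩ := hint _ h2
  have hab : a * b = 1 := IsFractionRing.injective A K (by
    rw [map_mul, ha, hb, Units.mul_inv, map_one])
  refine ⟨⟨a, b, hab, by rw [mul_comm, hab]⟩, ?_⟩
  rw [← mul_inv_cancel_left γ₀ γ]
  exact congrArg (γ₀ * ·) (Units.ext ha)

end LatticeIdeals

/-! ### The commensurability class of an invertible lattice -/

section Translates

open scoped Pointwise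

namespace KLattice

variable {A K : Type*} [CommRing A] [Field K] [Algebra A K]

theorem mk_mem_commClass_iff {L L' : KLattice A K} :
    (⟦L'⟧ : LatticeClass A K) ∈ commClass L ↔ ∃ γ : Kˣ, L.Matched (γ • L') := by
  constructor
  · rintro ⟨L₁, L₂, h1, h2, h⟩
    obtain ⟨γ, rfl⟩ := mk_eq_mk_iff.1 h1
    obtain ⟨δ, rfl⟩ := mk_eq_mk_iff.1 h2
    exact ⟨γ * δ⁻¹, by simpa [mul_smul] using h.smul γ⟩
  · rintro ⟨γ, h⟩
    exact ⟨L, γ • L', rfl, mk_smul _ _, h⟩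

theorem Matched.mk_mem_commClass {L L' : KLattice A K} (h : L.Matched L') :
    (⟦L'⟧ : LatticeClass A K) ∈ commClass L :=
  ⟨L, L', rfl, rfl, h⟩

theorem IsIdealTranslate.matched {J : Ideal A} {L L' : KLattice A K}
    (h : IsIdealTranslate J L L') : L.Matched L' := fun x y _ hy hy' =>
  Submodule.mem_sup_right ((h.2 x y hy).sub_mem hy')

variable [IsFractionRing A K]

theorem Λ_ne_top (hA : ¬ IsField A) (L : KLattice A K) : L.Λ ≠ ⊤ := fun h => by
  have : Module.Finite A K := ⟨h ▸ L.fg⟩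
  exact hA (isField_of_isIntegral_of_isField (IsFractionRing.injective A K) (Field.toIsField K))

variable [IsDedekindDomain A]

theorem exists_isIdealTranslate (L : KLattice A K) (J : (Ideal A)⁰) :
    ∃ L', IsIdealTranslate (J : Ideal A) L L' := by
  obtain ⟨Λ', h1, h2, h3⟩ := exists_ideal_smul_eq_of_ideal L.fg L.ne_bot J
  have hle : L.Λ ≤ Λ' := h3 ▸ Submodule.smul_le_right
  refine ⟨⟨Λ', h1, h2, Submodule.mapQ L.Λ Λ' LinearMap.id hle ∘ₗ L.φ⟩, h3, fun x y h => ?_⟩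
  change Submodule.mapQ L.Λ Λ' LinearMap.id hle (L.φ _) = _
  rw [h]
  rfl

theorem IsIdealTranslate.eq {J : (Ideal A)⁰} {L L' L'' : KLattice A K}
    (h : IsIdealTranslate (J : Ideal A) L L') (h' : IsIdealTranslate (J : Ideal A) L L'') :
    L' = L'' :=
  (h.matched.symm.trans h'.matched).eq
    ((ideal_smul_right_inj L'.fg L'.ne_bot L''.fg L''.ne_bot J).1 (h.1.trans h'.1.symm))

theorem IsInvertible.exists_isIdealTranslate {L L' : KLattice A K} (hL : L.IsInvertible)
    (h : L.Matched L') : ∃ J : (Ideal A)⁰, IsIdealTranslate (J : Ideal A) L L' := by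
  have hle := hL.le_of_matched h
  obtain ⟨J, hJ⟩ := exists_ideal_smul_eq L.fg L.ne_bot L'.fg hle
  exact ⟨J, hJ, fun x y => h.rel_of_le hle⟩

/-- If `φ(x) = z / (γ - 1)`, then modulo `γΛ'` the value of `γφ'` at `x` is both `γ z / (γ - 1)` and
`z / (γ - 1)`, whose difference is `z`. As `φ` is surjective, `z` is arbitrary. -/
theorem IsInvertible.eq_one_of_matched_smul (hA : ¬ IsField A) {L L' : KLattice A K}
    (hL : L.IsInvertible) (h : L.Matched L') {γ : Kˣ} (hγ : L.Matched (γ • L')) : γ = 1 := by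
  by_contra hne
  have hγ1 : (γ : K) - 1 ≠ 0 := fun h' => hne (Units.ext (sub_eq_zero.1 h'))
  refine Λ_ne_top hA (γ • L') (eq_top_iff.2 fun z _ => ?_)
  obtain ⟨x, hx⟩ := hL.2 (Submodule.Quotient.mk (((γ : K) - 1)⁻¹ * z))
  obtain ⟨x, rfl⟩ := Submodule.Quotient.mk_surjective _ x
  have h1 : L.Rel x (((γ : K) - 1)⁻¹ * z) := hx
  have h2 := (h.rel_of_le (hL.le_of_matched h) h1).units_smul γ
  have h3 := h2.sub_mem (hγ.rel_of_le (hL.le_of_matched hγ) h1)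
  rwa [← sub_one_mul, mul_inv_cancel_left₀ hγ1] at h3

theorem IsInvertible.existsUnique_matched (hA : ¬ IsField A) {L : KLattice A K}
    (hL : L.IsInvertible) {c : LatticeClass A K} (hc : c ∈ commClass L) :
    ∃! L', (⟦L'⟧ : LatticeClass A K) = c ∧ L.Matched L' := by
  obtain ⟨L', rfl⟩ := Quotient.exists_rep c
  obtain ⟨γ, hγ⟩ := mk_mem_commClass_iff.1 hc
  refine ⟨γ • L', ⟨mk_smul _ _, hγ⟩, ?_⟩
  rintro L'' ⟨h1, h2⟩
  obtain ⟨δ, hδ⟩ := mk_eq_mk_iff.1 (h1.trans (mk_smul γ L').symm)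
  rw [hδ] at hγ
  rw [hδ, hL.eq_one_of_matched_smul hA h2 hγ, one_smul]

/-- The bijection between the class `c(L)` of an invertible lattice and the nonzero ideals. -/
theorem IsInvertible.exists_commClass_equiv (hA : ¬ IsField A) {L : KLattice A K}
    (hL : L.IsInvertible) :
    ∃ e : commClass L ≃ (Ideal A)⁰, ∀ c J, e c = J ↔
      ∃ L' : KLattice A K, (⟦L'⟧ : LatticeClass A K) = c ∧ IsIdealTranslate (J : Ideal A) L L' := by
  choose t ht using L.exists_isIdealTranslate
  let f : (Ideal A)⁰ → commClass L := fun J => ⟨⟦t J⟧, (ht J).matched.mk_mem_commClass⟩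
  have hf : Function.Bijective f := by
    constructor
    · intro J J' h
      have h1 : (⟦t J⟧ : LatticeClass A K) = ⟦t J'⟧ := congrArg Subtype.val h
      have h2 := (hL.existsUnique_matched hA (f J).2).unique ⟨rfl, (ht J).matched⟩
        ⟨h1.symm, (ht J').matched⟩
      refine Subtype.ext ((ideal_smul_left_inj (t J).fg (t J).ne_bot).1 ?_)
      rw [(ht J).1, h2, (ht J').1]
    · rintro ⟨c, hc⟩
      obtain ⟨L', ⟨rfl, h⟩, -⟩ := hL.existsUnique_matched hA hc
      obtain ⟨J, hJ⟩ := hL.exists_isIdealTranslate h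
      exact ⟨J, Subtype.ext (congrArg (Quotient.mk _) ((ht J).eq hJ))⟩
  refine ⟨(Equiv.ofBijective f hf).symm, fun c J => ?_⟩
  rw [Equiv.symm_apply_eq, Subtype.ext_iff]
  constructor
  · intro h
    exact ⟨t J, h.symm, ht J⟩
  · rintro ⟨L', h, h'⟩
    rw [← h, h'.eq (ht J)]
    rfl

end KLattice

end Translates

/-! ### The topology on lattices and continuity of matching -/

section LatticeTopology

open scoped Pointwise Topology
open Filter

variable {A K : Type*} [CommRing A] [Field K] [Algebra A K]

namespace KLattice

theorem tendsto_nhds_iff {α : Type*} {F : Filter α} {f : α → KLattice A K} {L : KLattice A K} :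
    Tendsto f F (𝓝 L) ↔ ∀ x, ∀ᶠ a in F, ∀ y, (f a).Rel x y ↔ L.Rel x y := by
  let _ : TopologicalSpace (Set K) := ⊥
  have : DiscreteTopology (Set K) := ⟨rfl⟩
  rw [nhds_induced, tendsto_comap_iff, tendsto_pi_nhds]
  refine forall_congr' fun x => ?_
  rw [nhds_discrete, tendsto_pure]
  refine eventually_congr (Eventually.of_forall fun a => ?_)
  exact Set.ext_iff

theorem eventually_rel_iff (L : KLattice A K) (x : K) :
    ∀ᶠ L' in 𝓝 L, ∀ y, L'.Rel x y ↔ L.Rel x y :=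
  tendsto_nhds_iff.1 tendsto_id x

theorem eventually_Λ_eq (L : KLattice A K) : ∀ᶠ L' in 𝓝 L, L'.Λ = L.Λ := by
  filter_upwards [L.eventually_rel_iff 0] with L' h
  ext y
  simpa only [rel_zero_iff] using h y

instance : T2Space (KLattice A K) := by
  let _ : TopologicalSpace (Set K) := ⊥
  have : DiscreteTopology (Set K) := ⟨rfl⟩
  refine T2Space.of_injective_continuous (f := fun (L : KLattice A K) (x : K) => {y : K | L.Rel x y})
    (fun L L' h => ext_of_rel fun x y => ?_) continuous_induced_dom
  exact Set.ext_iff.1 (congrFun h x) y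

instance : ContinuousConstSMul Kˣ (KLattice A K) where
  continuous_const_smul γ := continuous_iff_continuousAt.2 fun L => tendsto_nhds_iff.2 fun x => by
    filter_upwards [L.eventually_rel_iff x] with L' h y
    rw [units_smul_rel_iff, units_smul_rel_iff, h]

/-- The modules are locally constant functions of the lattice, so a compact set sees finitely many
of them. -/
theorem finite_image_Λ {Z : Set (KLattice A K × KLattice A K)} (hZ : IsCompact Z) :
    ((fun z : KLattice A K × KLattice A K => (z.1.Λ, z.2.Λ)) '' Z).Finite := by
  let _ : TopologicalSpace (Submodule A K × Submodule A K) := ⊥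
  have : DiscreteTopology (Submodule A K × Submodule A K) := ⟨rfl⟩
  have h : IsLocallyConstant fun z : KLattice A K × KLattice A K => (z.1.Λ, z.2.Λ) := by
    refine (IsLocallyConstant.iff_eventually_eq _).2 fun z => ?_
    filter_upwards [(eventually_Λ_eq z.1).prod_nhds (eventually_Λ_eq z.2)] with w hw
    exact Prod.ext hw.1 hw.2
  exact (hZ.image h.continuous).finite_of_discrete

section Matching

variable [IsFractionRing A K]

theorem Matched.rel_iff {L M : KLattice A K} (h : L.Matched M) {d : A} (hd : d ≠ 0)
    (hdΛ : ∀ z ∈ L.Λ, d • z ∈ M.Λ) {x y : K} :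
    M.Rel x y ↔ ∃ z, L.Rel ((algebraMap A K d)⁻¹ * x) z ∧ y - d • z ∈ M.Λ := by
  have hd' : algebraMap A K d ≠ 0 := by simpa using hd
  have key : ∀ z, L.Rel ((algebraMap A K d)⁻¹ * x) z → M.Rel x (d • z) := fun z hz => by
    have := h.rel hdΛ hz
    rwa [Algebra.smul_def d ((algebraMap A K d)⁻¹ * x), mul_inv_cancel_left₀ hd'] at this
  constructor
  · intro hy
    obtain ⟨z, hz⟩ := L.exists_rel ((algebraMap A K d)⁻¹ * x)
    exact ⟨z, hz, hy.sub_mem (key z hz)⟩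
  · rintro ⟨z, hz, hyz⟩
    refine (key z hz).congr ?_
    rw [← neg_sub]
    exact neg_mem hyz

/-- The only candidate is `φ'(x) = d φ(x / d)` modulo `Λ`, and it descends to `K / A` exactly when
it kills `1`. The criterion involves `φ` at the single point `1 / d`, hence is locally constant. -/
theorem exists_matched_iff {L : KLattice A K} {Λ : Submodule A K} (hfg : Λ.FG) (h0 : Λ ≠ ⊥) {d : A}
    (hd : d ≠ 0) (hdΛ : ∀ z ∈ L.Λ, d • z ∈ Λ) :
    (∃ M : KLattice A K, L.Matched M ∧ M.Λ = Λ) ↔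
      ∃ y, L.Rel (algebraMap A K d)⁻¹ y ∧ d • y ∈ Λ := by
  have hd' : algebraMap A K d ≠ 0 := by simpa using hd
  constructor
  · rintro ⟨M, hM, rfl⟩
    obtain ⟨z, hz, hz'⟩ := (hM.rel_iff hd hdΛ (x := 1) (y := 0)).1
      (rel_zero (Submodule.one_le.1 le_rfl))
    rw [mul_one] at hz
    rw [zero_sub, neg_mem_iff] at hz'
    exact ⟨z, hz, hz'⟩
  · rintro ⟨y, hy, hyΛ⟩
    let ψ : K →ₗ[A] (K ⧸ Λ) := Submodule.mapQ L.Λ Λ (LinearMap.lsmul A K d) hdΛ ∘ₗ L.φ ∘ₗ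
      Submodule.mkQ 1 ∘ₗ LinearMap.mulLeft A (algebraMap A K d)⁻¹
    have hψ : ∀ x y, L.Rel ((algebraMap A K d)⁻¹ * x) y → ψ x = Submodule.Quotient.mk (d • y) :=
      fun x y h => by
        change Submodule.mapQ L.Λ Λ (LinearMap.lsmul A K d) hdΛ (L.φ (Submodule.Quotient.mk _)) = _
        rw [LinearMap.mulLeft_apply, h]
        rfl
    have h1 : (1 : Submodule A K) ≤ LinearMap.ker ψ := by
      rw [Submodule.one_le, LinearMap.mem_ker, hψ 1 y (by rwa [mul_one]),
        Submodule.Quotient.mk_eq_zero]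
      exact hyΛ
    refine ⟨⟨Λ, hfg, h0, Submodule.liftQ 1 ψ h1⟩, matched_of_rel hd fun x z h => ?_, rfl⟩
    refine hψ (d • x) z ?_
    rwa [Algebra.smul_def, inv_mul_cancel_left₀ hd']

variable [IsDomain A]

/-- Lattices matched with `L` with a prescribed module `Λ` vary continuously with `L`. -/
theorem eventually_matched (L : KLattice A K) (Λ : Submodule A K) :
    (∀ᶠ L' in 𝓝 L, ∀ M : KLattice A K, L'.Matched M → M.Λ ≠ Λ) ∨
      ∃ m : KLattice A K → KLattice A K, ContinuousAt m L ∧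
        ∀ᶠ L' in 𝓝 L, L'.Matched (m L') ∧ (m L').Λ = Λ := by
  by_cases hΛ : ∃ M : KLattice A K, L.Matched M ∧ M.Λ = Λ
  · right
    obtain ⟨M₀, hM₀, rfl⟩ := hΛ
    -- One `d` serves all lattices near `L`, as `Λ` is locally constant. Existence of the matched
    -- lattice and its values are then read off `φ` at `1 / d` and `x / d`.
    obtain ⟨d, hd, hdΛ⟩ := exists_smul_mem L.fg M₀.ne_bot
    have hex : ∀ᶠ L' in 𝓝 L, ∃ M : KLattice A K, L'.Matched M ∧ M.Λ = M₀.Λ := by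
      filter_upwards [L.eventually_Λ_eq, L.eventually_rel_iff (algebraMap A K d)⁻¹] with L' h1 h2
      rw [exists_matched_iff M₀.fg M₀.ne_bot hd (by rwa [h1])]
      simp only [h2]
      exact (exists_matched_iff M₀.fg M₀.ne_bot hd hdΛ).1 ⟨M₀, hM₀, rfl⟩
    -- `M₀` is a default value, never used close to `L`.
    have hm : ∀ L' : KLattice A K, ∃ M, (∃ M : KLattice A K, L'.Matched M ∧ M.Λ = M₀.Λ) →
        L'.Matched M ∧ M.Λ = M₀.Λ := fun L' => by
      by_cases h : ∃ M : KLattice A K, L'.Matched M ∧ M.Λ = M₀.Λ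
      · obtain ⟨M, hM⟩ := h
        exact ⟨M, fun _ => hM⟩
      · exact ⟨M₀, fun h' => absurd h' h⟩
    choose m hm using hm
    have hm' : ∀ᶠ L' in 𝓝 L, L'.Matched (m L') ∧ (m L').Λ = M₀.Λ := hex.mono fun L' h => hm L' h
    refine ⟨m, tendsto_nhds_iff.2 fun x => ?_, hm'⟩
    obtain ⟨h3, h4⟩ := hm'.self_of_nhds
    filter_upwards [L.eventually_Λ_eq, L.eventually_rel_iff ((algebraMap A K d)⁻¹ * x), hm']
      with L' h1 h2 h5 y
    rw [h5.1.rel_iff hd (by rwa [h1, h5.2]), h3.rel_iff hd (by rwa [h4]), h4, h5.2]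
    simp only [h2]
  · left
    by_cases hM : ∃ M : KLattice A K, M.Λ = Λ
    · obtain ⟨M, rfl⟩ := hM
      obtain ⟨d, hd, hdΛ⟩ := exists_smul_mem L.fg M.ne_bot
      filter_upwards [L.eventually_Λ_eq, L.eventually_rel_iff (algebraMap A K d)⁻¹]
        with L' h1 h2 M' hM' hΛ'
      have h3 := (exists_matched_iff M.fg M.ne_bot hd (by rwa [h1])).1 ⟨M', hM', hΛ'⟩
      simp only [h2] at h3
      exact hΛ ((exists_matched_iff M.fg M.ne_bot hd hdΛ).2 h3)
    · exact Eventually.of_forall fun _ M _ h => hM ⟨M, h⟩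

end Matching

end KLattice

end LatticeTopology

/-! ### The convolution algebra -/

section Convolution

open scoped Pointwise Topology
open Filter KLattice

variable {A K C : Type*} [CommRing A] [Field K] [Algebra A K] [NormedField C]

theorem mem_convAlgebra_iff {f : KLattice A K → KLattice A K → C} :
    f ∈ convAlgebra A K C ↔
      (∀ L₁ L₂, ¬ L₁.Matched L₂ → f L₁ L₂ = 0) ∧
      (∀ (γ : Kˣ) (L₁ L₂ : KLattice A K), f (γ • L₁) (γ • L₂) = f L₁ L₂) ∧
      ContinuousOn (fun z : KLattice A K × KLattice A K => f z.1 z.2) {z | z.1.Matched z.2} ∧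
      ∃ Z : Set (KLattice A K × KLattice A K), IsCompact Z ∧ Z ⊆ {z | z.1.Matched z.2} ∧
        ∀ L₁ L₂, f L₁ L₂ ≠ 0 → ∃ z ∈ Z, ∃ γ : Kˣ, L₁ = γ • z.1 ∧ L₂ = γ • z.2 := by
  refine and_congr Iff.rfl (and_congr ⟨fun h γ L₁ L₂ => ?_, fun h γ L₁ L₂ L₁' L₂' h1 h2 => ?_⟩
    (and_congr Iff.rfl ?_))
  · exact (h γ L₁ L₂ _ _ (isScaling_iff.2 rfl) (isScaling_iff.2 rfl)).symm
  · rw [isScaling_iff.1 h1, isScaling_iff.1 h2, h]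
  · simp only [isScaling_iff]

theorem convAlgebra.matched {f : KLattice A K → KLattice A K → C} (hf : f ∈ convAlgebra A K C)
    {L M : KLattice A K} (h : f L M ≠ 0) : L.Matched M :=
  by_contra fun h' => h (hf.1 L M h')

theorem convAlgebra.smul_apply {f : KLattice A K → KLattice A K → C} (hf : f ∈ convAlgebra A K C)
    (γ : Kˣ) (L M : KLattice A K) : f (γ • L) (γ • M) = f L M :=
  (mem_convAlgebra_iff.1 hf).2.1 γ L M

/-- Finiteness of the rows of `a` and `b` confines both sides to finite sets, so `c` may be
arbitrary. It serves associativity and, with `c` a vector, multiplicativity of the representation.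
-/
theorem finsum_finsum_mul_mul {X : Type*} {a : X → C} {b : X → X → C} {c : X → C}
    (ha : {N | a N ≠ 0}.Finite) (hb : ∀ N, {M | b N M ≠ 0}.Finite) :
    ∑ᶠ M, (∑ᶠ N, a N * b N M) * c M = ∑ᶠ N, a N * ∑ᶠ M, b N M * c M := by
  have hB : (⋃ N ∈ ha.toFinset, {M | b N M ≠ 0}).Finite :=
    ha.toFinset.finite_toSet.biUnion fun N _ => hb N
  have h1 : ∀ M, ∑ᶠ N, a N * b N M = ∑ N ∈ ha.toFinset, a N * b N M := fun M =>
    finsum_eq_sum_of_support_subset _ fun N hN => by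
      simpa using left_ne_zero_of_mul hN
  have h2 : ∀ N ∈ ha.toFinset, ∑ᶠ M, b N M * c M = ∑ M ∈ hB.toFinset, b N M * c M := fun N hN =>
    finsum_eq_sum_of_support_subset _ fun M hM => by
      rw [Set.Finite.coe_toFinset]
      exact Set.mem_biUnion hN (left_ne_zero_of_mul hM)
  have h3 : Function.support (fun M => (∑ᶠ N, a N * b N M) * c M) ⊆ hB.toFinset := fun M hM => by
    have hM' := left_ne_zero_of_mul hM
    rw [h1] at hM'
    obtain ⟨N, hN, hNM⟩ := Finset.exists_ne_zero_of_sum_ne_zero hM'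
    rw [Set.Finite.coe_toFinset]
    exact Set.mem_biUnion hN (right_ne_zero_of_mul hNM)
  have h4 : Function.support (fun N => a N * ∑ᶠ M, b N M * c M) ⊆ ha.toFinset := fun N hN => by
    simpa using left_ne_zero_of_mul hN
  have h5 : ∑ N ∈ ha.toFinset, a N * ∑ᶠ M, b N M * c M =
      ∑ N ∈ ha.toFinset, ∑ M ∈ hB.toFinset, a N * (b N M * c M) :=
    Finset.sum_congr rfl fun N hN => by rw [h2 N hN, Finset.mul_sum]
  rw [finsum_eq_sum_of_support_subset _ h3, finsum_eq_sum_of_support_subset _ h4, h5,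
    Finset.sum_comm]
  simp only [h1, Finset.sum_mul, mul_assoc]

theorem convMul_smul_smul {f g : KLattice A K → KLattice A K → C} (hf : f ∈ convAlgebra A K C)
    (hg : g ∈ convAlgebra A K C) (γ : Kˣ) (L₁ L₂ : KLattice A K) :
    convMul f g (γ • L₁) (γ • L₂) = convMul f g L₁ L₂ := by
  refine (finsum_comp_equiv (MulAction.toPerm γ)).symm.trans (finsum_congr fun M => ?_)
  rw [MulAction.toPerm_apply, convAlgebra.smul_apply hf, convAlgebra.smul_apply hg]

variable [IsFractionRing A K]

theorem convMul_eq_zero [IsDomain A] {f g : KLattice A K → KLattice A K → C}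
    (hf : f ∈ convAlgebra A K C)
    (hg : g ∈ convAlgebra A K C) {L₁ L₂ : KLattice A K} (h : ¬ L₁.Matched L₂) :
    convMul f g L₁ L₂ = 0 := by
  refine finsum_eq_zero_of_forall_eq_zero fun M => ?_
  by_contra hne
  exact h ((convAlgebra.matched hf (left_ne_zero_of_mul hne)).trans
    (convAlgebra.matched hg (right_ne_zero_of_mul hne)))

variable [IsDedekindDomain A] [Finite Aˣ]

theorem finite_setOf_exists_units_smul {S : Set (Submodule A K × Submodule A K)} (hS : S.Finite)
    (h : ∀ s ∈ S, s.1.FG ∧ s.1 ≠ ⊥) (Λ : Submodule A K) :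
    {Λ' | ∃ s ∈ S, ∃ γ : Kˣ, Λ = γ • s.1 ∧ Λ' = γ • s.2}.Finite := by
  refine (hS.biUnion fun s hs => (finite_setOf_units_smul_eq (h s hs).1 (h s hs).2 Λ).image
    fun γ => γ • s.2).subset ?_
  rintro Λ' ⟨s, hs, γ, h1, h2⟩
  simp only [Set.mem_iUnion]
  exact ⟨s, hs, γ, h1.symm, h2.symm⟩

theorem convAlgebra.exists_finite_right {f : KLattice A K → KLattice A K → C}
    (hf : f ∈ convAlgebra A K C) (Λ : Submodule A K) :
    ∃ S : Set (Submodule A K), S.Finite ∧ ∀ L M : KLattice A K, L.Λ = Λ → f L M ≠ 0 → M.Λ ∈ S := by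
  obtain ⟨-, -, -, Z, hZ, -, hZ'⟩ := mem_convAlgebra_iff.1 hf
  refine ⟨_, finite_setOf_exists_units_smul (finite_image_Λ hZ) ?_ Λ, ?_⟩
  · rintro _ ⟨z, -, rfl⟩
    exact ⟨z.1.fg, z.1.ne_bot⟩
  · rintro L M rfl h
    obtain ⟨z, hz, γ, rfl, rfl⟩ := hZ' L M h
    exact ⟨_, ⟨z, hz, rfl⟩, γ, rfl, rfl⟩

theorem convAlgebra.exists_finite_left {f : KLattice A K → KLattice A K → C}
    (hf : f ∈ convAlgebra A K C) (Λ : Submodule A K) :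
    ∃ S : Set (Submodule A K), S.Finite ∧ ∀ L M : KLattice A K, M.Λ = Λ → f L M ≠ 0 → L.Λ ∈ S := by
  obtain ⟨-, -, -, Z, hZ, -, hZ'⟩ := mem_convAlgebra_iff.1 hf
  refine ⟨_, finite_setOf_exists_units_smul ((finite_image_Λ hZ).image Prod.swap) ?_ Λ, ?_⟩
  · rintro _ ⟨_, ⟨z, -, rfl⟩, rfl⟩
    exact ⟨z.2.fg, z.2.ne_bot⟩
  · rintro L M rfl h
    obtain ⟨z, hz, γ, rfl, rfl⟩ := hZ' L M h
    exact ⟨_, ⟨_, ⟨z, hz, rfl⟩, rfl⟩, γ, rfl, rfl⟩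

/-- Only finitely many modules occur, and two lattices matched with `L` that have the same module
coincide. -/
theorem convAlgebra.finite_right {f : KLattice A K → KLattice A K → C}
    (hf : f ∈ convAlgebra A K C) (L : KLattice A K) : {M | f L M ≠ 0}.Finite := by
  obtain ⟨S, hS, h⟩ := convAlgebra.exists_finite_right hf L.Λ
  refine Set.Finite.of_finite_image (f := fun M => M.Λ) (hS.subset ?_) ?_
  · rintro _ ⟨M, hM, rfl⟩
    exact h L M rfl hM
  · intro M hM N hN hMN
    exact ((convAlgebra.matched hf hM).symm.trans (convAlgebra.matched hf hN)).eq hMN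

theorem convAlgebra.finite_left {f : KLattice A K → KLattice A K → C}
    (hf : f ∈ convAlgebra A K C) (L : KLattice A K) : {M | f M L ≠ 0}.Finite := by
  obtain ⟨S, hS, h⟩ := convAlgebra.exists_finite_left hf L.Λ
  refine Set.Finite.of_finite_image (f := fun M => M.Λ) (hS.subset ?_) ?_
  · rintro _ ⟨M, hM, rfl⟩
    exact h M L rfl hM
  · intro M hM N hN hMN
    exact ((convAlgebra.matched hf hM).trans (convAlgebra.matched hf hN).symm).eq hMN

theorem convMul_assoc {f g h : KLattice A K → KLattice A K → C} (hf : f ∈ convAlgebra A K C)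
    (hg : g ∈ convAlgebra A K C) : convMul (convMul f g) h = convMul f (convMul g h) :=
  funext₂ fun _ _ => finsum_finsum_mul_mul (convAlgebra.finite_right hf _)
    fun N => convAlgebra.finite_right hg N

-- Split the sum by the module of the middle lattice. Near `L₁` finitely many modules matter, and
-- for each the middle lattice is either absent or unique and continuous in `L₁`.
open Classical in
theorem continuousOn_convMul {f g : KLattice A K → KLattice A K → C}
    (hf : f ∈ convAlgebra A K C) (hg : g ∈ convAlgebra A K C) :
    ContinuousOn (fun z : KLattice A K × KLattice A K => convMul f g z.1 z.2)
      {z | z.1.Matched z.2} := by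
  rintro ⟨L₁, L₂⟩ hL
  obtain ⟨S, hS, hfS⟩ := convAlgebra.exists_finite_right hf L₁.Λ
  let F : Submodule A K → KLattice A K × KLattice A K → C := fun Λ z =>
    ∑ᶠ M : KLattice A K, if M.Λ = Λ then f z.1 M * g M z.2 else 0
  have hfst : ∀ {p : KLattice A K → Prop}, (∀ᶠ L in 𝓝 L₁, p L) →
      ∀ᶠ z : KLattice A K × KLattice A K in 𝓝[{z | z.1.Matched z.2}] (L₁, L₂), p z.1 := fun h =>
    ((continuous_fst.tendsto (L₁, L₂)).mono_left nhdsWithin_le_nhds).eventually h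
  have hsum : ∀ᶠ z in 𝓝[{z | z.1.Matched z.2}] (L₁, L₂),
      convMul f g z.1 z.2 = ∑ Λ ∈ hS.toFinset, F Λ z := by
    filter_upwards [hfst (eventually_Λ_eq L₁)] with z hz
    rw [← finsum_sum_comm]
    · refine finsum_congr fun M => ?_
      rw [Finset.sum_ite_eq]
      split_ifs with h
      · rfl
      · by_contra hne
        exact h (hS.mem_toFinset.2 (hfS _ _ hz (left_ne_zero_of_mul hne)))
    · intro Λ _
      refine (convAlgebra.finite_right hf z.1).subset fun M hM => ?_
      rw [Function.mem_support] at hM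
      split_ifs at hM with h
      · exact left_ne_zero_of_mul hM
      · exact absurd rfl hM
  have hF : ∀ Λ, ContinuousWithinAt (F Λ) {z | z.1.Matched z.2} (L₁, L₂) := fun Λ => by
    rcases eventually_matched L₁ Λ with h | ⟨m, hm, h⟩
    · refine (continuousWithinAt_const (b := 0)).congr_of_eventuallyEq_of_mem ?_ hL
      filter_upwards [hfst h] with z hz
      refine finsum_eq_zero_of_forall_eq_zero fun M => ite_eq_right_iff.2 fun hM => ?_
      by_contra hne
      exact hz M (convAlgebra.matched hf (left_ne_zero_of_mul hne)) hM
    · have hlim : Tendsto (fun z : KLattice A K × KLattice A K => m z.1)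
          (𝓝[{z | z.1.Matched z.2}] (L₁, L₂)) (𝓝 (m L₁)) :=
        hm.tendsto.comp ((continuous_fst.tendsto (L₁, L₂)).mono_left nhdsWithin_le_nhds)
      have h1 : Tendsto (fun z : KLattice A K × KLattice A K => (z.1, m z.1))
          (𝓝[{z | z.1.Matched z.2}] (L₁, L₂)) (𝓝[{z | z.1.Matched z.2}] (L₁, m L₁)) :=
        tendsto_nhdsWithin_iff.2
          ⟨((continuous_fst.tendsto (L₁, L₂)).mono_left nhdsWithin_le_nhds).prodMk_nhds hlim,
            hfst (h.mono fun _ h => h.1)⟩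
      have h2 : Tendsto (fun z : KLattice A K × KLattice A K => (m z.1, z.2))
          (𝓝[{z | z.1.Matched z.2}] (L₁, L₂)) (𝓝[{z | z.1.Matched z.2}] (m L₁, L₂)) :=
        tendsto_nhdsWithin_iff.2
          ⟨hlim.prodMk_nhds ((continuous_snd.tendsto (L₁, L₂)).mono_left nhdsWithin_le_nhds), by
            filter_upwards [hfst h, self_mem_nhdsWithin] with z hz hz'
            exact hz.1.symm.trans hz'⟩
      have h3 := h.self_of_nhds.1
      refine ContinuousWithinAt.congr_of_eventuallyEq_of_mem
        (((hf.2.2.1 _ h3).tendsto.comp h1).mul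
          ((hg.2.2.1 (m L₁, L₂) (h3.symm.trans hL)).tendsto.comp h2)) ?_ hL
      filter_upwards [hfst h] with z hz
      refine (finsum_eq_single _ (m z.1) fun M hM => ite_eq_right_iff.2 fun hMΛ => ?_).trans
        (if_pos hz.2)
      by_contra hne
      exact hM (((convAlgebra.matched hf (left_ne_zero_of_mul hne)).symm.trans hz.1).eq
        (hMΛ.trans hz.2.symm))
  exact ContinuousWithinAt.congr_of_eventuallyEq_of_mem (tendsto_finsetSum _ fun Λ _ => hF Λ)
    hsum hL

theorem convMul_mem {f g : KLattice A K → KLattice A K → C} (hf : f ∈ convAlgebra A K C)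
    (hg : g ∈ convAlgebra A K C) : convMul f g ∈ convAlgebra A K C := by
  refine mem_convAlgebra_iff.2 ⟨fun _ _ => convMul_eq_zero hf hg, convMul_smul_smul hf hg,
    continuousOn_convMul hf hg, ?_⟩
  obtain ⟨-, -, -, Z, hZ, hZM, hZf⟩ := mem_convAlgebra_iff.1 hf
  obtain ⟨-, -, -, W, hW, hWM, hWg⟩ := mem_convAlgebra_iff.1 hg
  -- These are the scalars aligning a pair of `W` with a pair of `Z`. Only finitely many are needed,
  -- since finitely many modules occur; composing `Z` with these translates of `W` carries the
  -- support of the product.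
  let E : Set Kˣ := {γ | ∃ z ∈ Z, ∃ w ∈ W, z.2 = γ • w.1}
  have hE : E.Finite := by
    refine ((finite_image_Λ hZ).biUnion fun s _ => (finite_image_Λ hW).biUnion
      (t := fun t => {γ : Kˣ | (t.1 ≠ ⊥ ∧ t.1.FG) ∧ γ • t.1 = s.2}) fun t _ => ?_).subset ?_
    · by_cases ht : t.1 ≠ ⊥ ∧ t.1.FG
      · exact (finite_setOf_units_smul_eq ht.2 ht.1 s.2).subset fun γ hγ => hγ.2
      · exact Set.finite_empty.subset fun γ hγ => ht hγ.1
    · rintro γ ⟨z, hz, w, hw, h⟩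
      simp only [Set.mem_iUnion]
      exact ⟨_, ⟨z, hz, rfl⟩, _, ⟨w, hw, rfl⟩, ⟨w.1.ne_bot, w.1.fg⟩,
        (congrArg KLattice.Λ h).symm⟩
  have hW' : IsCompact (⋃ γ ∈ E, (fun w : KLattice A K × KLattice A K => γ • w) '' W) :=
    hE.isCompact_biUnion fun γ _ => hW.image (continuous_const_smul γ)
  let D : Set ((KLattice A K × KLattice A K) × (KLattice A K × KLattice A K)) :=
    {x | x.1.2 = x.2.1}
  -- Composability is a closed condition because the space of lattices is Hausdorff.
  have hD : IsClosed D := isClosed_eq (by fun_prop) (by fun_prop)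
  refine ⟨_, ((hZ.prod hW').inter_right hD).image
    (f := fun x => (x.1.1, x.2.2)) (by fun_prop), ?_, fun L₁ L₂ h => ?_⟩
  · rintro _ ⟨⟨⟨a, b⟩, ⟨b', c⟩⟩, ⟨⟨hab, hbc⟩, hb⟩, rfl⟩
    obtain rfl : b = b' := hb
    simp only [Set.mem_iUnion] at hbc
    obtain ⟨γ, -, w, hw, h⟩ := hbc
    have h1 : b.Matched c := by
      have := (hWM hw).smul γ
      rwa [show b = γ • w.1 from (congrArg Prod.fst h).symm,
        show c = γ • w.2 from (congrArg Prod.snd h).symm]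
    exact Matched.trans (show a.Matched b from hZM hab) h1
  · obtain ⟨M, hM⟩ : ∃ M, f L₁ M * g M L₂ ≠ 0 := by
      by_contra! h'
      exact h (finsum_eq_zero_of_forall_eq_zero h')
    obtain ⟨z, hz, γ, rfl, rfl⟩ := hZf L₁ M (left_ne_zero_of_mul hM)
    obtain ⟨w, hw, δ, h1, rfl⟩ := hWg _ L₂ (right_ne_zero_of_mul hM)
    have h2 : z.2 = (γ⁻¹ * δ) • w.1 := by rw [mul_smul, ← h1, inv_smul_smul]
    refine ⟨_, ⟨(z, (γ⁻¹ * δ) • w), ⟨⟨hz, ?_⟩, h2⟩, rfl⟩, γ, rfl, ?_⟩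
    · simp only [Set.mem_iUnion]
      exact ⟨_, ⟨z, hz, w, hw, h2⟩, w, hw, rfl⟩
    · change δ • w.2 = γ • (γ⁻¹ * δ) • w.2
      rw [← mul_smul, mul_inv_cancel_left]

end Convolution

/-! ### Twisting by characters of the ideals -/

section Twist

open scoped Pointwise Topology
open Filter KLattice

variable {A K C : Type*} [CommRing A] [Field K] [Algebra A K] [NormedField C]
  [IsFractionRing A K] [IsDedekindDomain A]

theorem KLattice.exists_ideal_smul_eq_ideal_smul (L₁ L₂ : KLattice A K) :
    ∃ I : (Ideal A)⁰ × (Ideal A)⁰, (I.1 : Ideal A) • L₁.Λ = (I.2 : Ideal A) • L₂.Λ := by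
  obtain ⟨I, J, h⟩ := _root_.exists_ideal_smul_eq_ideal_smul L₁.fg L₁.ne_bot L₂.fg L₂.ne_bot
  exact ⟨(I, J), h⟩

/-- The value of a character `χ` of the ideals on the fractional ideal `Λ₂ / Λ₁`. -/
def idealRatio (χ : (Ideal A)⁰ →* Cˣ) (L₁ L₂ : KLattice A K) : Cˣ :=
  χ (L₁.exists_ideal_smul_eq_ideal_smul L₂).choose.1 /
    χ (L₁.exists_ideal_smul_eq_ideal_smul L₂).choose.2

theorem idealRatio_eq (χ : (Ideal A)⁰ →* Cˣ) {L₁ L₂ : KLattice A K} {I J : (Ideal A)⁰}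
    (h : (I : Ideal A) • L₁.Λ = (J : Ideal A) • L₂.Λ) : idealRatio χ L₁ L₂ = χ I / χ J := by
  have := ideal_mul_eq_of_smul_eq L₁.fg L₁.ne_bot
    (L₁.exists_ideal_smul_eq_ideal_smul L₂).choose_spec h
  rw [idealRatio, div_eq_div_iff_mul_eq_mul, ← map_mul, ← map_mul, this]

theorem idealRatio_congr (χ : (Ideal A)⁰ →* Cˣ) {L₁ L₂ L₁' L₂' : KLattice A K}
    (h₁ : L₁'.Λ = L₁.Λ) (h₂ : L₂'.Λ = L₂.Λ) : idealRatio χ L₁' L₂' = idealRatio χ L₁ L₂ := by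
  obtain ⟨⟨I, J⟩, h⟩ := L₁.exists_ideal_smul_eq_ideal_smul L₂
  rw [idealRatio_eq χ h, idealRatio_eq χ (I := I) (J := J) (by rw [h₁, h₂, h])]

theorem idealRatio_smul_smul (χ : (Ideal A)⁰ →* Cˣ) (γ : Kˣ) (L₁ L₂ : KLattice A K) :
    idealRatio χ (γ • L₁) (γ • L₂) = idealRatio χ L₁ L₂ := by
  obtain ⟨⟨I, J⟩, h⟩ := L₁.exists_ideal_smul_eq_ideal_smul L₂
  rw [idealRatio_eq χ h, idealRatio_eq χ (I := I) (J := J)]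
  rw [smul_Λ, smul_Λ, ← units_smul_ideal_smul, ← units_smul_ideal_smul]
  exact congrArg (γ • ·) h

/-- The cocycle identity `(Λ₂ / Λ₁)(Λ₃ / Λ₂) = Λ₃ / Λ₁`, which makes the twist multiplicative for
convolution. -/
theorem idealRatio_mul_idealRatio (χ : (Ideal A)⁰ →* Cˣ) (L₁ L₂ L₃ : KLattice A K) :
    idealRatio χ L₁ L₂ * idealRatio χ L₂ L₃ = idealRatio χ L₁ L₃ := by
  obtain ⟨⟨I, J⟩, h⟩ := L₁.exists_ideal_smul_eq_ideal_smul L₂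
  obtain ⟨⟨I', J'⟩, h'⟩ := L₂.exists_ideal_smul_eq_ideal_smul L₃
  rw [idealRatio_eq χ h, idealRatio_eq χ h', idealRatio_eq χ (I := I' * I) (J := J * J'),
    map_mul, map_mul, div_mul_div_comm, mul_comm (χ I)]
  dsimp only at h h'
  rw [Submonoid.coe_mul, Submonoid.coe_mul, Submodule.mul_smul, h, Submodule.mul_smul, ← h',
    ← Submodule.mul_smul, ← Submodule.mul_smul, mul_comm]

theorem idealRatio_one (L₁ L₂ : KLattice A K) :
    idealRatio (1 : (Ideal A)⁰ →* Cˣ) L₁ L₂ = 1 := by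
  simp [idealRatio]

theorem idealRatio_mul (χ χ' : (Ideal A)⁰ →* Cˣ) (L₁ L₂ : KLattice A K) :
    idealRatio (χ * χ') L₁ L₂ = idealRatio χ L₁ L₂ * idealRatio χ' L₁ L₂ := by
  simp only [idealRatio, MonoidHom.mul_apply, mul_div_mul_comm]

/-- Multiplication of functions on pairs of lattices by a character of the ideals. -/
def twist (χ : (Ideal A)⁰ →* Cˣ) : convAlgebra A K C →ₗ[C] convAlgebra A K C where
  toFun f := ⟨fun L₁ L₂ => (idealRatio χ L₁ L₂ : C) * f.1 L₁ L₂, by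
    obtain ⟨h1, h2, h3, Z, hZ, hZM, h4⟩ := mem_convAlgebra_iff.1 f.2
    refine mem_convAlgebra_iff.2 ⟨fun L₁ L₂ h => ?_, fun γ L₁ L₂ => ?_, ?_, Z, hZ, hZM,
      fun L₁ L₂ h => h4 L₁ L₂ (right_ne_zero_of_mul h)⟩
    · rw [h1 _ _ h, mul_zero]
    · rw [idealRatio_smul_smul, h2]
    · refine ContinuousOn.mul (Continuous.continuousOn ?_) h3
      refine IsLocallyConstant.continuous ((IsLocallyConstant.iff_eventually_eq _).2 fun z => ?_)
      filter_upwards [(eventually_Λ_eq z.1).prod_nhds (eventually_Λ_eq z.2)] with w hw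
      rw [idealRatio_congr χ hw.1 hw.2]⟩
  map_add' f g := by
    ext L₁ L₂
    exact mul_add _ _ _
  map_smul' a f := by
    ext L₁ L₂
    exact mul_left_comm _ _ _

theorem twist_apply (χ : (Ideal A)⁰ →* Cˣ) (f : convAlgebra A K C) (L₁ L₂ : KLattice A K) :
    (twist χ f).1 L₁ L₂ = idealRatio χ L₁ L₂ * f.1 L₁ L₂ := rfl

theorem twist_twist (χ χ' : (Ideal A)⁰ →* Cˣ) (f : convAlgebra A K C) :
    twist χ (twist χ' f) = twist (χ * χ') f := by
  ext L₁ L₂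
  rw [twist_apply, twist_apply, twist_apply, idealRatio_mul, Units.val_mul, mul_assoc]

theorem twist_one (f : convAlgebra A K C) : twist 1 f = f := by
  ext L₁ L₂
  rw [twist_apply, idealRatio_one, Units.val_one, one_mul]

variable (A K C) in
/-- The action of the characters of the ideals on the convolution algebra. -/
def twistHom : ((Ideal A)⁰ →* Cˣ) →* (convAlgebra A K C ≃ₗ[C] convAlgebra A K C) where
  toFun χ := LinearEquiv.ofLinearMap (twist χ) (twist χ⁻¹)
    (LinearMap.ext fun f => (twist_twist _ _ f).trans
      ((congrArg (fun χ => twist χ f) (mul_inv_cancel χ)).trans (twist_one f)))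
    (LinearMap.ext fun f => (twist_twist _ _ f).trans
      ((congrArg (fun χ => twist χ f) (inv_mul_cancel χ)).trans (twist_one f)))
  map_one' := LinearEquiv.ext twist_one
  map_mul' χ χ' := LinearEquiv.ext fun f => (twist_twist χ χ' f).symm

theorem twistHom_apply (χ : (Ideal A)⁰ →* Cˣ) (f : convAlgebra A K C) (L₁ L₂ : KLattice A K) :
    (twistHom A K C χ f).1 L₁ L₂ = idealRatio χ L₁ L₂ * f.1 L₁ L₂ := rfl

theorem twistHom_convMul (χ : (Ideal A)⁰ →* Cˣ) (f g : convAlgebra A K C)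
    (h : convMul f.1 g.1 ∈ convAlgebra A K C) :
    (twistHom A K C χ ⟨convMul f.1 g.1, h⟩).1 =
      convMul (twistHom A K C χ f).1 (twistHom A K C χ g).1 := by
  ext L₁ L₂
  rw [twistHom_apply, ← smul_eq_mul]
  refine (smul_finsum _ _).trans (finsum_congr fun M => ?_)
  rw [twistHom_apply, twistHom_apply, ← idealRatio_mul_idealRatio χ L₁ M L₂, Units.val_mul,
    smul_eq_mul]
  ring

end Twist

/-! ### Powers of ideals and convergence of the zeta series -/

section IdealExponentiation

variable {Fq K : Type*} [Field Fq] [Finite Fq] [Field K] [Algebra Fq K]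

/-- The exponentiation of ideals as a family of characters of the ideals. -/
theorem IsCurveFunctionField.exists_idealExp_hom (hK : IsCurveFunctionField Fq K) (P : Place K)
    (p : ℕ) [Fact p.Prime] [CharP Fq p] {u : P.KInfty} (hu : P.IsUniformizer u) :
    ∃ E : SInfty P p →* ((Ideal (regularRing Fq P))⁰ →* P.CInftyˣ),
      ∀ s I, (E s I : P.CInfty) = idealExp Fq P p u s I := by
  have := charP_of_injective_algebraMap (algebraMap Fq K).injective p
  have := Place.charP_CInfty P p
  have hχ := (isOneUnitExtension_oneUnitPart P hK p hu).1
  have hne : ∀ s I, idealExp Fq P p u s I ≠ 0 := fun s I => by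
    refine mul_ne_zero (pow_ne_zero _ s.1.ne_zero) (norm_ne_zero_iff.1 ?_)
    rw [norm_oneUnitPow (hχ I)]
    exact one_ne_zero
  have hdeg : idealDeg Fq P 1 = 0 := by
    have := hK.idealDeg_mul P 1 1
    rw [one_mul] at this
    omega
  refine ⟨⟨⟨fun s => ⟨⟨fun I => Units.mk0 _ (hne s I), ?_⟩, fun I J => ?_⟩, ?_⟩, fun s t => ?_⟩,
    fun s I => rfl⟩
  · refine Units.ext ?_
    simp [idealExp, hdeg, one_oneUnitPow]
  · refine Units.ext ?_
    simp only [idealExp, Units.val_mk0, Units.val_mul, hK.idealDeg_mul P, MonoidHom.map_mul, pow_add,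
      mul_oneUnitPow (hχ I) (hχ J)]
    ring
  · refine MonoidHom.ext fun I => Units.ext ?_
    simp [idealExp, oneUnitPow_zero]
  · refine MonoidHom.ext fun I => Units.ext ?_
    simp only [idealExp, MonoidHom.coe_mk, OneHom.coe_mk, MonoidHom.mul_apply, Units.val_mk0,
      Units.val_mul, Prod.fst_mul, Prod.snd_mul, toAdd_mul, oneUnitPow_add (hχ I), mul_pow]
    ring

theorem norm_idealExp {P : Place K} {p : ℕ} [Fact p.Prime] [CharP P.CInfty p] {u : P.KInfty}
    {I : (Ideal (regularRing Fq P))⁰} (hχ : ‖oneUnitPart Fq P u I - 1‖ < 1) (s : SInfty P p) :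
    ‖idealExp Fq P p u s I‖ = ‖(s.1 : P.CInfty)‖ ^ idealDeg Fq P I := by
  rw [idealExp, norm_mul, norm_pow, norm_oneUnitPow hχ, mul_one]

theorem continuous_idealExp {P : Place K} {p : ℕ} [Fact p.Prime] [CharP P.CInfty p] {u : P.KInfty}
    {I : (Ideal (regularRing Fq P))⁰} (hχ : ‖oneUnitPart Fq P u I - 1‖ < 1) :
    Continuous fun s : SInfty P p => idealExp Fq P p u s I :=
  ((Units.continuous_val.comp continuous_fst).pow _).mul
    ((continuous_oneUnitPow hχ).comp (continuous_toAdd.comp continuous_snd))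

/-- It suffices that the terms tend to zero along the cofinite filter: their norm is `|x| ^ deg I`,
and finitely many ideals have bounded degree. -/
theorem IsCurveFunctionField.summable_idealExp (hK : IsCurveFunctionField Fq K) (P : Place K)
    (p : ℕ) [Fact p.Prime] [CharP Fq p] {u : P.KInfty} (hu : P.IsUniformizer u) {s : SInfty P p}
    (hs : ‖(s.1 : P.CInfty)‖ < 1) : Summable fun I => idealExp Fq P p u s I := by
  have := charP_of_injective_algebraMap (algebraMap Fq K).injective p
  have := Place.charP_CInfty P p
  have hχ := (isOneUnitExtension_oneUnitPart P hK p hu).1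
  refine NonarchimedeanAddGroup.summable_of_tendsto_cofinite_zero ?_
  rw [tendsto_zero_iff_norm_tendsto_zero]
  simp only [norm_idealExp (hχ _)]
  refine (tendsto_pow_atTop_nhds_zero_of_lt_one (norm_nonneg _) hs).comp ?_
  refine Filter.tendsto_atTop.2 fun n => ?_
  rw [Filter.eventually_cofinite]
  exact (hK.finite_idealDeg_le P n).subset fun I hI => (not_le.1 hI).le

end IdealExponentiation

/-! ### Diagonal operators on `V_L` -/

namespace VSpace

open KLattice

variable {A K C : Type*} [CommRing A] [Field K] [Algebra A K] [NormedField C] {L : KLattice A K}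

theorem ext_of_commClass {ξ η : VSpace C L} (h : ∀ c : commClass L, ξ.1 c = η.1 c) : ξ = η := by
  refine Subtype.ext (Finsupp.ext fun c => ?_)
  by_cases hc : c ∈ commClass L
  · exact h ⟨c, hc⟩
  · rw [(Finsupp.mem_supported' C _).1 ξ.2 c hc, (Finsupp.mem_supported' C _).1 η.2 c hc]

theorem norm_apply_le_supNorm (ξ : VSpace C L) (c : LatticeClass A K) : ‖ξ.1 c‖ ≤ supNorm ξ := by
  refine le_ciSup (f := fun c => ‖ξ.1 c‖) ?_ c
  refine (((ξ.1.support.finite_toSet.image fun c => ‖ξ.1 c‖).insert 0).subset ?_).bddAbove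
  rintro _ ⟨c, rfl⟩
  by_cases hc : ξ.1 c = 0
  · exact Or.inl (by simp only [hc, norm_zero])
  · exact Or.inr ⟨c, Finsupp.mem_support_iff.2 hc, rfl⟩

theorem supNorm_nonneg (ξ : VSpace C L) : 0 ≤ supNorm ξ := Real.iSup_nonneg fun _ => norm_nonneg _

theorem supNorm_le {ξ : VSpace C L} {B : ℝ} (hB : 0 ≤ B) (h : ∀ c, ‖ξ.1 c‖ ≤ B) : supNorm ξ ≤ B :=
  Real.iSup_le h hB

/-- The diagonal operator with the given diagonal entries. -/
def diag (w : LatticeClass A K → C) : Module.End C (VSpace C L) where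
  toFun ξ := ⟨Finsupp.onFinset ξ.1.support (fun c => w c * ξ.1 c) fun _ h =>
      Finsupp.mem_support_iff.2 (right_ne_zero_of_mul h),
    (Finsupp.mem_supported' C _).2 fun c hc => by
      rw [Finsupp.onFinset_apply, (Finsupp.mem_supported' C _).1 ξ.2 c hc, mul_zero]⟩
  map_add' ξ η := Subtype.ext (Finsupp.ext fun _ => mul_add _ _ _)
  map_smul' a ξ := Subtype.ext (Finsupp.ext fun _ => mul_left_comm _ _ _)

variable (C L) in
/-- The invertible diagonal operators. -/
def diagHom : (LatticeClass A K → Cˣ) →* (VSpace C L ≃ₗ[C] VSpace C L) where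
  toFun w := LinearEquiv.ofLinearMap (diag fun c => w c) (diag fun c => ↑(w c)⁻¹)
    (LinearMap.ext fun _ => Subtype.ext (Finsupp.ext fun c => (w c).mul_inv_cancel_left _))
    (LinearMap.ext fun _ => Subtype.ext (Finsupp.ext fun c => (w c).inv_mul_cancel_left _))
  map_one' := LinearEquiv.ext fun _ => Subtype.ext (Finsupp.ext fun _ => one_mul _)
  map_mul' _ _ := LinearEquiv.ext fun _ => Subtype.ext (Finsupp.ext fun _ => mul_assoc _ _ _)

theorem diagHom_apply (w : LatticeClass A K → Cˣ) (ξ : VSpace C L) (c : LatticeClass A K) :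
    (diagHom C L w ξ).1 c = w c * ξ.1 c := rfl

open Classical in
variable (C) in
/-- The action of the characters of a group on `V_L`, for a bijection of `c(L)` with the group
elements under consideration. -/
def charHom {G : Type*} [Monoid G] (e : commClass L ≃ G) :
    (G →* Cˣ) →* (VSpace C L ≃ₗ[C] VSpace C L) :=
  (diagHom C L).comp
    -- Off `c(L)` the vectors vanish; the value `1` there only keeps the weight invertible and
    -- multiplicative in `χ`.
    { toFun := fun χ c => if h : c ∈ commClass L then χ (e ⟨c, h⟩) else 1
      map_one' := by
        ext c
        simp
      map_mul' := fun χ χ' => by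
        ext c
        by_cases h : c ∈ commClass L <;> simp [h] }

theorem charHom_apply {G : Type*} [Monoid G] (e : commClass L ≃ G) (χ : G →* Cˣ) (ξ : VSpace C L)
    (c : commClass L) : (charHom C e χ ξ).1 c = χ (e c) * ξ.1 c := by
  refine (diagHom_apply _ ξ c).trans ?_
  simp

theorem charHom_basisVec {G : Type*} [Monoid G] (e : commClass L ≃ G) (χ : G →* Cˣ) (g : G) :
    charHom C e χ (basisVec C (e.symm g)) = (χ g : C) • basisVec C (e.symm g) := by
  refine ext_of_commClass fun c => ?_
  rw [charHom_apply]
  change _ * (Finsupp.single (e.symm g : LatticeClass A K) (1 : C)) c =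
    (χ g : C) * (Finsupp.single (e.symm g : LatticeClass A K) (1 : C)) c
  by_cases h : c = e.symm g
  · rw [h, e.apply_symm_apply]
  · rw [Finsupp.single_eq_of_ne fun h' => h (Subtype.ext h'), mul_zero, mul_zero]

theorem supNorm_charHom_le {G : Type*} [Monoid G] (e : commClass L ≃ G) {χ : G →* Cˣ}
    (hχ : ∀ g, ‖(χ g : C)‖ ≤ 1) (ξ : VSpace C L) : supNorm (charHom C e χ ξ) ≤ supNorm ξ := by
  refine supNorm_le (supNorm_nonneg ξ) fun c => ?_
  by_cases hc : c ∈ commClass L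
  · rw [charHom_apply e χ ξ ⟨c, hc⟩, norm_mul]
    exact (mul_le_of_le_one_left (norm_nonneg _) (hχ _)).trans (norm_apply_le_supNorm ξ c)
  · rw [(Finsupp.mem_supported' C _).1 (charHom C e χ ξ).2 c hc, norm_zero]
    exact supNorm_nonneg ξ

theorem supNorm_charHom {G : Type*} [Monoid G] (e : commClass L ≃ G) {χ : G →* Cˣ}
    (hχ : ∀ g, ‖(χ g : C)‖ = 1) (ξ : VSpace C L) : supNorm (charHom C e χ ξ) = supNorm ξ := by
  refine le_antisymm (supNorm_charHom_le e (fun g => (hχ g).le) ξ) ?_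
  have h : charHom C e χ⁻¹ (charHom C e χ ξ) = ξ := by
    exact (congrArg (fun T : VSpace C L ≃ₗ[C] VSpace C L => T (charHom C e χ ξ))
      (map_inv (charHom C e) χ)).trans (LinearEquiv.symm_apply_apply _ ξ)
  calc supNorm ξ = supNorm (charHom C e χ⁻¹ (charHom C e χ ξ)) := by rw [h]
    _ ≤ _ := supNorm_charHom_le e (fun g => by simp [hχ]) _

theorem hasTrace_charHom {G : Type*} [Monoid G] (e : commClass L ≃ G) {χ : G →* Cˣ}
    (hχ : ∀ g, ‖(χ g : C)‖ ≤ 1) (hs : Summable fun g => (χ g : C)) :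
    HasTrace (charHom C e χ : Module.End C (VSpace C L)) (∑' g, (χ g : C)) := by
  refine ⟨⟨1, fun ξ => (supNorm_charHom_le e hχ ξ).trans (one_mul _).ge⟩, ?_⟩
  refine ((e.hasSum_iff (f := fun g => (χ g : C))).2 hs.hasSum).congr_fun fun c => ?_
  refine (charHom_apply e χ _ c).trans ?_
  simp [basisVec]

end VSpace

/-! ### The representation on `V_L` -/

section Representation

open scoped Pointwise
open KLattice

variable {A K C : Type*} [CommRing A] [Field K] [Algebra A K] [NormedField C] {L : KLattice A K}

theorem convAlgebra.finsum_smul_mul (f : convAlgebra A K C) (γ : Kˣ) (L' : KLattice A K)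
    (η : LatticeClass A K → C) :
    ∑ᶠ M, f.1 (γ • L') M * η ⟦M⟧ = ∑ᶠ M, f.1 L' M * η ⟦M⟧ := by
  refine (finsum_comp_equiv (MulAction.toPerm γ)).symm.trans (finsum_congr fun M => ?_)
  rw [MulAction.toPerm_apply, convAlgebra.smul_apply f.2, mk_smul]

/-- The function `L' ↦ ∑ f(L', L'') ξ(L'')` on lattice classes. -/
def convAction (f : convAlgebra A K C) (η : LatticeClass A K → C) : LatticeClass A K → C :=
  Quotient.lift (fun L' => ∑ᶠ M, f.1 L' M * η ⟦M⟧) fun L' L'' h => by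
    obtain ⟨γ, rfl⟩ := mk_eq_mk_iff.1 (Quotient.sound h)
    exact (convAlgebra.finsum_smul_mul f γ L' η).symm

theorem exists_of_convAction_ne_zero {f : convAlgebra A K C} {η : LatticeClass A K → C}
    {L' : KLattice A K} (h : convAction f η ⟦L'⟧ ≠ 0) :
    ∃ M, f.1 L' M ≠ 0 ∧ η ⟦M⟧ ≠ 0 := by
  by_contra! h'
  refine h (finsum_eq_zero_of_forall_eq_zero fun M => ?_)
  by_cases hM : f.1 L' M = 0
  · rw [hM, zero_mul]
  · rw [h' M hM, mul_zero]

variable [IsFractionRing A K] [IsDedekindDomain A]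

theorem convAction_eq_zero (f : convAlgebra A K C) (ξ : VSpace C L) {c : LatticeClass A K}
    (hc : c ∉ commClass L) : convAction f ξ.1 c = 0 := by
  obtain ⟨L', rfl⟩ := Quotient.exists_rep c
  by_contra h
  obtain ⟨M, hM, hξ⟩ := exists_of_convAction_ne_zero h
  have hM' : (⟦M⟧ : LatticeClass A K) ∈ commClass L := by
    by_contra h'
    exact hξ ((Finsupp.mem_supported' C _).1 ξ.2 _ h')
  obtain ⟨γ, hγ⟩ := mk_mem_commClass_iff.1 hM'
  exact hc (mk_mem_commClass_iff.2 ⟨γ, hγ.trans ((convAlgebra.matched f.2 hM).symm.smul γ)⟩)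

variable [Finite Aˣ]

theorem convAlgebra.finite_support_mul (f : convAlgebra A K C) (L' : KLattice A K)
    (η : KLattice A K → C) : (Function.support fun M => f.1 L' M * η M).Finite :=
  (convAlgebra.finite_right f.2 L').subset fun _ hM => left_ne_zero_of_mul hM

/-- The columns of `f` are finite as well: each class in the support of `ξ` is reached from finitely
many lattices, up to scaling. -/
theorem finite_support_convAction (f : convAlgebra A K C) (ξ : LatticeClass A K →₀ C) :
    (Function.support (convAction f ξ)).Finite := by
  refine (ξ.support.finite_toSet.biUnion fun c _ =>
    (convAlgebra.finite_left f.2 c.out).image (Quotient.mk KLattice.isoSetoid)).subset ?_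
  intro c hc
  obtain ⟨L', rfl⟩ := Quotient.exists_rep c
  obtain ⟨M, hM, hξ⟩ := exists_of_convAction_ne_zero hc
  obtain ⟨γ, hγ⟩ := mk_eq_mk_iff.1 (Quotient.out_eq (⟦M⟧ : LatticeClass A K)).symm
  simp only [Set.mem_iUnion]
  refine ⟨⟦M⟧, Finsupp.mem_support_iff.2 hξ, γ • L', ?_, mk_smul γ L'⟩
  rw [Set.mem_ofPred_eq, hγ, convAlgebra.smul_apply f.2]
  exact hM

variable (C L) in
/-- The representation of the convolution algebra on `V_L`. -/
def latticeRep : convAlgebra A K C →ₗ[C] Module.End C (VSpace C L) :=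
  LinearMap.mk₂ C
    (fun f ξ => ⟨Finsupp.ofSupportFinite _ (finite_support_convAction f ξ.1),
      (Finsupp.mem_supported' C _).2 fun _ hc => convAction_eq_zero f ξ hc⟩)
    (fun f g ξ => Subtype.ext (Finsupp.ext fun c => by
      obtain ⟨L', rfl⟩ := Quotient.exists_rep c
      change ∑ᶠ M, (f.1 L' M + g.1 L' M) * _ = ∑ᶠ M, f.1 L' M * _ + ∑ᶠ M, g.1 L' M * _
      rw [← finsum_add_distrib (convAlgebra.finite_support_mul f L' _)
        (convAlgebra.finite_support_mul g L' _)]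
      simp only [add_mul]))
    (fun a f ξ => Subtype.ext (Finsupp.ext fun c => by
      obtain ⟨L', rfl⟩ := Quotient.exists_rep c
      change ∑ᶠ M, (a * f.1 L' M) * _ = a • ∑ᶠ M, f.1 L' M * _
      rw [smul_finsum]
      simp only [smul_eq_mul, mul_assoc]))
    (fun f ξ η => Subtype.ext (Finsupp.ext fun c => by
      obtain ⟨L', rfl⟩ := Quotient.exists_rep c
      change ∑ᶠ M, f.1 L' M * (ξ.1 ⟦M⟧ + η.1 ⟦M⟧) = ∑ᶠ M, f.1 L' M * _ + ∑ᶠ M, f.1 L' M * _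
      rw [← finsum_add_distrib (convAlgebra.finite_support_mul f L' _)
        (convAlgebra.finite_support_mul f L' _)]
      simp only [mul_add]))
    (fun a f ξ => Subtype.ext (Finsupp.ext fun c => by
      obtain ⟨L', rfl⟩ := Quotient.exists_rep c
      change ∑ᶠ M, f.1 L' M * (a * ξ.1 ⟦M⟧) = a • ∑ᶠ M, f.1 L' M * _
      rw [smul_finsum]
      simp only [smul_eq_mul, mul_left_comm]))

theorem latticeRep_mk (f : convAlgebra A K C) (ξ : VSpace C L) (L' : KLattice A K) :
    (latticeRep C L f ξ).1 ⟦L'⟧ = ∑ᶠ M, f.1 L' M * ξ.1 ⟦M⟧ := rfl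

theorem latticeRep_convMul (f g : convAlgebra A K C) (h : convMul f.1 g.1 ∈ convAlgebra A K C) :
    latticeRep C L ⟨convMul f.1 g.1, h⟩ = latticeRep C L f * latticeRep C L g := by
  refine LinearMap.ext fun ξ => Subtype.ext (Finsupp.ext fun c => ?_)
  obtain ⟨L', rfl⟩ := Quotient.exists_rep c
  exact finsum_finsum_mul_mul (convAlgebra.finite_right f.2 _)
    fun N => convAlgebra.finite_right g.2 N

/-- `f` is bounded on a compact set carrying its support modulo scaling, and the ultrametric
inequality makes the number of summands irrelevant. -/
theorem isBounded_latticeRep [IsUltrametricDist C] (f : convAlgebra A K C) :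
    VSpace.IsBounded (latticeRep C L f) := by
  obtain ⟨-, hinv, hcont, Z, hZ, hZM, hZf⟩ := mem_convAlgebra_iff.1 f.2
  obtain ⟨B, hB⟩ := hZ.exists_bound_of_continuousOn (hcont.mono hZM)
  have hB' : ∀ L' M, ‖f.1 L' M‖ ≤ max B 0 := fun L' M => by
    by_cases h : f.1 L' M = 0
    · rw [h, norm_zero]
      exact le_max_right _ _
    · obtain ⟨z, hz, γ, rfl, rfl⟩ := hZf L' M h
      rw [hinv]
      exact (hB z hz).trans (le_max_left _ _)
  refine ⟨max B 0, fun ξ => ?_⟩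
  have h0 := mul_nonneg (le_max_right B 0) (VSpace.supNorm_nonneg ξ)
  refine VSpace.supNorm_le h0 fun c => ?_
  obtain ⟨L', rfl⟩ := Quotient.exists_rep c
  rw [latticeRep_mk, finsum_eq_sum _ (convAlgebra.finite_support_mul f L' _)]
  refine IsUltrametricDist.norm_sum_le_of_forall_le_of_nonneg h0 fun M _ => ?_
  rw [norm_mul]
  exact mul_le_mul (hB' _ _) (VSpace.norm_apply_le_supNorm ξ _) (norm_nonneg _) (le_max_right _ _)

/-- The operators attached to a character of the ideals implement the twist by the character. -/
theorem latticeRep_twistHom (hA : ¬ IsField A) (hL : L.IsInvertible) (e : commClass L ≃ (Ideal A)⁰)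
    (he : ∀ c J, e c = J ↔
      ∃ L' : KLattice A K, (⟦L'⟧ : LatticeClass A K) = c ∧ IsIdealTranslate (J : Ideal A) L L')
    (χ : (Ideal A)⁰ →* Cˣ) (f : convAlgebra A K C) (ξ : VSpace C L) :
    latticeRep C L (twistHom A K C χ f) ξ =
      VSpace.charHom C e χ (latticeRep C L f (VSpace.charHom C e χ⁻¹ ξ)) := by
  refine VSpace.ext_of_commClass fun c => ?_
  obtain ⟨L', ⟨hL', hm⟩, -⟩ := hL.existsUnique_matched hA c.2
  obtain ⟨J, hJ⟩ := hL.exists_isIdealTranslate hm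
  rw [VSpace.charHom_apply, (he c J).2 ⟨L', hL', hJ⟩, ← hL', latticeRep_mk, latticeRep_mk,
    ← smul_eq_mul, smul_finsum]
  refine finsum_congr fun M => ?_
  rw [twistHom_apply]
  by_cases hM : f.1 L' M = 0
  · simp [hM]
  have hm' := hm.trans (convAlgebra.matched f.2 hM)
  -- Now `JΛ(L') = Λ(L) = J'Λ(M)`, so the cocycle takes the value `χ(J) / χ(J')`, the factor
  -- produced by conjugation with a diagonal operator.
  obtain ⟨J', hJ'⟩ := hL.exists_isIdealTranslate hm'
  rw [VSpace.charHom_apply e χ⁻¹ ξ ⟨⟦M⟧, hm'.mk_mem_commClass⟩, (he _ J').2 ⟨M, rfl, hJ'⟩,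
    idealRatio_eq χ (hJ.1.trans hJ'.1.symm), div_eq_mul_inv, Units.val_mul, smul_eq_mul,
    MonoidHom.inv_apply]
  ring

end Representation

/-! ### Covariance, the trace and the partition function -/

section SpectralOperators

open KLattice

variable {Fq K : Type*} [Field Fq] [Finite Fq] [Field K] [Algebra Fq K]

theorem idealExp_sZero {P : Place K} {p : ℕ} [Fact p.Prime] [CharP P.CInfty p] (u : P.KInfty)
    (I : (Ideal (regularRing Fq P))⁰) :
    idealExp Fq P p u (sZero P p) I = oneUnitPart Fq P u I := by
  simp [idealExp, sZero, oneUnitPow_one]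

theorem idealExp_inv_one {P : Place K} {p : ℕ} [Fact p.Prime] [CharP P.CInfty p] (u : P.KInfty)
    (x : P.CInftyˣ) (I : (Ideal (regularRing Fq P))⁰) :
    idealExp Fq P p u (x, 1)⁻¹ I = ((x : P.CInfty) ^ idealDeg Fq P I)⁻¹ := by
  simp [idealExp, oneUnitPow_zero]

/-- A family of characters `ε` of the ideals, indexed by a group `S`, gives a time evolution of the
convolution algebra and operators `U(s)` on `V_L` which implement it. -/
theorem exists_covariant_representation {A K C S : Type*} [CommRing A] [Field K] [Algebra A K]
    [NormedField C] [IsUltrametricDist C] [IsFractionRing A K] [IsDedekindDomain A] [Finite Aˣ]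
    [Group S] [TopologicalSpace S] (hA : ¬ IsField A) {L : KLattice A K} (hL : L.IsInvertible)
    (E : S →* ((Ideal A)⁰ →* Cˣ)) {ε : S → (Ideal A)⁰ → C} (hE : ∀ s I, (E s I : C) = ε s I)
    (hε : ∀ I, Continuous fun s => ε s I) :
    ∃ e : commClass L ≃ (Ideal A)⁰,
      (∀ c J, e c = J ↔
        ∃ L' : KLattice A K, (⟦L'⟧ : LatticeClass A K) = c ∧ IsIdealTranslate J.1 L L') ∧
    ∃ (σ : S →* (convAlgebra A K C ≃ₗ[C] convAlgebra A K C))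
      (π : convAlgebra A K C →ₗ[C] Module.End C (VSpace C L))
      (U : S →* (VSpace C L ≃ₗ[C] VSpace C L)),
      (∀ s f (L₁ L₂ : KLattice A K) (I J : (Ideal A)⁰), (I : Ideal A) • L₁.Λ = (J : Ideal A) • L₂.Λ →
        (σ s f).1 L₁ L₂ = ε s I / ε s J * f.1 L₁ L₂) ∧
      (∀ s (f g : convAlgebra A K C),
        (σ s ⟨convMul f.1 g.1, convMul_mem f.2 g.2⟩).1 = convMul (σ s f).1 (σ s g).1) ∧
      VSpace.IsPiL π ∧
      (∀ f g : convAlgebra A K C, π ⟨convMul f.1 g.1, convMul_mem f.2 g.2⟩ = π f * π g) ∧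
      (∀ f, VSpace.IsBounded (π f)) ∧
      (∀ s (ξ : VSpace C L) (c : commClass L), (U s ξ).1 c = ε s (e c) * ξ.1 c) ∧
      (∀ s J, U s (VSpace.basisVec C (e.symm J)) = ε s J • VSpace.basisVec C (e.symm J)) ∧
      (∀ (ξ : VSpace C L) (c : commClass L), Continuous fun s => (U s ξ).1 c) ∧
      (∀ s, (∀ J, ‖ε s J‖ = 1) → ∀ ξ : VSpace C L, VSpace.supNorm (U s ξ) = VSpace.supNorm ξ) ∧
      (∀ s (f : convAlgebra A K C) (ξ : VSpace C L), π (σ s f) ξ = U s (π f ((U s)⁻¹ ξ))) ∧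
      (∀ s, (∀ J, ‖ε s⁻¹ J‖ ≤ 1) → (Summable fun J => ε s⁻¹ J) →
        VSpace.HasTrace (((U s)⁻¹ : VSpace C L ≃ₗ[C] VSpace C L) : Module.End C (VSpace C L))
          (∑' J, ε s⁻¹ J)) := by
  obtain ⟨e, he⟩ := hL.exists_commClass_equiv hA
  refine ⟨e, he, (twistHom A K C).comp E, latticeRep C L, (VSpace.charHom C e).comp E, ?_, ?_, ?_,
    ?_, ?_, ?_, ?_, ?_, ?_, ?_, ?_⟩
  · intro s f L₁ L₂ I J h
    rw [← hE, ← hE, MonoidHom.comp_apply, twistHom_apply, idealRatio_eq _ h, Units.val_div_eq_div_val]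
  · exact fun s f g => twistHom_convMul _ f g _
  · exact fun f ξ L' _ => latticeRep_mk f ξ L'
  · exact fun f g => latticeRep_convMul f g _
  · exact isBounded_latticeRep
  · intro s ξ c
    rw [← hE]
    exact VSpace.charHom_apply e _ ξ c
  · intro s J
    rw [← hE]
    exact VSpace.charHom_basisVec e _ J
  · intro ξ c
    exact ((hε (e c)).mul (continuous_const (y := ξ.1 c))).congr fun s =>
      ((VSpace.charHom_apply e _ ξ c).trans (congrArg (· * ξ.1 c) (hE s (e c)))).symm
  · intro s hs ξ
    exact VSpace.supNorm_charHom e (fun J => by rw [hE, hs]) ξ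
  · intro s f ξ
    refine (latticeRep_twistHom hA hL e he (E s) f ξ).trans ?_
    exact congrArg (fun T : VSpace C L ≃ₗ[C] VSpace C L =>
      VSpace.charHom C e (E s) (latticeRep C L f (T ξ))) (map_inv (VSpace.charHom C e) (E s))
  · intro s h1 h2
    have h3 : ((VSpace.charHom C e).comp E s)⁻¹ = VSpace.charHom C e (E s⁻¹) :=
      (map_inv ((VSpace.charHom C e).comp E) s).symm
    rw [h3]
    simp only [← hE] at h1 h2 ⊢
    exact VSpace.hasTrace_charHom e h1 h2

end SpectralOperators

end

set_option maxHeartbeats 1000000 in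
theorem theorem4p6 {Fq K : Type*} [Field Fq] [Finite Fq] [Field K] [Algebra Fq K]
    (hK : IsCurveFunctionField Fq K) (p : ℕ) [Fact p.Prime] [CharP Fq p]
    (P : Place K) (u : P.KInfty) (hu : P.IsUniformizer u)
    (L : KLattice (regularRing Fq P) K) (hL : L.IsInvertible) :
    -- the one-unit parts of ideals are given by a unique extension
    (∃! χ, IsOneUnitExtension Fq P u χ) ∧
    -- the functions on commensurable pairs form an algebra under convolution
    (∀ f g h : Observables Fq P,
      convMul (convMul f.1 g.1) h.1 = convMul f.1 (convMul g.1 h.1)) ∧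
    ∃ hmul : ∀ f g : Observables Fq P, convMul f.1 g.1 ∈ Observables Fq P,
    -- `c(L)` is the set of the lattices `J⁻¹ L`, for `J` a nonzero ideal
    ∃ e : commClass L ≃ (Ideal (regularRing Fq P))⁰,
      (∀ c J, e c = J ↔ ∃ L' : KLattice (regularRing Fq P) K,
        (⟦L'⟧ : LatticeClass (regularRing Fq P) K) = c ∧ KLattice.IsIdealTranslate J.1 L L') ∧
    -- the time evolution, the representation and the operators `U(s)`
    ∃ (σ : SInfty P p →* (Observables Fq P ≃ₗ[P.CInfty]
          Observables Fq P))
      (π : Observables Fq P →ₗ[P.CInfty]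
          Module.End P.CInfty (VSpace P.CInfty L))
      (U : SInfty P p →* (VSpace P.CInfty L ≃ₗ[P.CInfty] VSpace P.CInfty L)),
      IsTimeEvolution P p u σ ∧
      (∀ (s : SInfty P p) (f g : Observables Fq P), (σ s ⟨convMul f.1 g.1, hmul f g⟩).1 = convMul (σ s f).1 (σ s g).1) ∧
      VSpace.IsPiL π ∧
      (∀ f g : Observables Fq P, π ⟨convMul f.1 g.1, hmul f g⟩ = π f * π g) ∧
      (∀ f : Observables Fq P, VSpace.IsBounded (π f)) ∧
      (∀ (s : SInfty P p) (ξ : VSpace P.CInfty L) (c : commClass L), (U s ξ).1 c = idealExp Fq P p u s (e c) * ξ.1 c) ∧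
      (∀ (s : SInfty P p) (J : (Ideal (regularRing Fq P))⁰), U s (VSpace.basisVec P.CInfty (e.symm J)) =
        idealExp Fq P p u s J • VSpace.basisVec P.CInfty (e.symm J)) ∧
      (∀ (ξ : VSpace P.CInfty L) (c : commClass L), Continuous fun s : SInfty P p => (U s ξ).1 c) ∧
      (∀ s : SInfty P p, ‖(s.1 : P.CInfty)‖ = 1 → ∀ ξ : VSpace P.CInfty L,
        VSpace.supNorm (U s ξ) = VSpace.supNorm ξ) ∧
      -- `U` implements the time evolution in the representation
      (∀ (s : SInfty P p) (f : Observables Fq P) (ξ : VSpace P.CInfty L),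
        π (σ s f) ξ = U s (π f ((U s)⁻¹ ξ))) ∧
      -- the exponential of the Hamiltonian
      (∀ (ξ : VSpace P.CInfty L) (c : commClass L), (U (sZero P p) ξ).1 c = oneUnitPart Fq P u (e c) * ξ.1 c) ∧
      -- convergence of `Z(s) = Tr (U(s)⁻¹) = ∑ J ^ (-s)` for `|x| > q`
      (∀ s : SInfty P p, (Nat.card Fq : ℝ) < ‖(s.1 : P.CInfty)‖ →
        Summable (fun J => idealExp Fq P p u s⁻¹ J) ∧
        VSpace.HasTrace (((U s)⁻¹ : VSpace P.CInfty L ≃ₗ[P.CInfty] VSpace P.CInfty L) :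
          Module.End P.CInfty (VSpace P.CInfty L)) (∑' J, idealExp Fq P p u s⁻¹ J)) ∧
      -- the partition function, `s = (x, 0)`, is the zeta function of `A`
      (∀ x : P.CInftyˣ, (Nat.card Fq : ℝ) < ‖(x : P.CInfty)‖ →
        (∀ J, idealExp Fq P p u (x, 1)⁻¹ J = ((x : P.CInfty) ^ idealDeg Fq P J)⁻¹) ∧
        Summable (fun J => ((x : P.CInfty) ^ idealDeg Fq P J)⁻¹) ∧
        VSpace.HasTrace (((U (x, 1))⁻¹ : VSpace P.CInfty L ≃ₗ[P.CInfty] VSpace P.CInfty L) :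
          Module.End P.CInfty (VSpace P.CInfty L))
          (∑' J, ((x : P.CInfty) ^ idealDeg Fq P J)⁻¹)) := by
  have := charP_of_injective_algebraMap (algebraMap Fq K).injective p
  have := Place.charP_CInfty P p
  have := hK.isDedekindDomain_regularRing P
  have := hK.isFractionRing_regularRing P
  have := hK.finite_units_regularRing P
  have hA := hK.not_isField_regularRing P
  have hχ := (isOneUnitExtension_oneUnitPart P hK p hu).1
  obtain ⟨E, hE⟩ := hK.exists_idealExp_hom P p hu
  obtain ⟨e, he, σ, π, U, h1, h2, h3, h4, h5, h6, h7, h8, h9, h10, h11⟩ :=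
    exists_covariant_representation (A := regularRing Fq P) (K := K) (C := P.CInfty)
      (S := SInfty P p) hA hL E (ε := idealExp Fq P p u) hE fun I => continuous_idealExp (hχ I)
  have hsum : ∀ s : SInfty P p, (Nat.card Fq : ℝ) < ‖(s.1 : P.CInfty)‖ →
      Summable (fun J => idealExp Fq P p u s⁻¹ J) ∧
      VSpace.HasTrace (((U s)⁻¹ : VSpace P.CInfty L ≃ₗ[P.CInfty] VSpace P.CInfty L) :
        Module.End P.CInfty (VSpace P.CInfty L)) (∑' J, idealExp Fq P p u s⁻¹ J) := fun s hs => by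
    -- This single bound makes the inverse operator a contraction and its diagonal summable.
    have hlt : ‖((s⁻¹).1 : P.CInfty)‖ < 1 := by
      rw [Prod.fst_inv, Units.val_inv_eq_inv_val, norm_inv]
      exact inv_lt_one_of_one_lt₀ (lt_trans (mod_cast Finite.one_lt_card) hs)
    have hs' := hK.summable_idealExp P p hu hlt
    exact ⟨hs', h11 s (fun J => (norm_idealExp (hχ J) _).trans_le
      (pow_le_one₀ (norm_nonneg _) hlt.le)) hs'⟩
  refine ⟨existsUnique_isOneUnitExtension P hK p hu, fun f g h => convMul_assoc f.2 g.2,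
    fun f g => convMul_mem f.2 g.2, e, he, σ, π, U, h1, h2, h3, h4, h5, h6, h7, h8,
    fun s hs => h9 s fun J => by rw [norm_idealExp (hχ J), hs, one_pow], h10, fun ξ c => ?_, hsum,
    fun x hx => ⟨idealExp_inv_one u x, ?_⟩⟩
  · rw [← idealExp_sZero (p := p)]
    exact h6 _ ξ c
  · have h := hsum (x, 1) hx
    simp only [idealExp_inv_one] at h
    exact h
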